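/- Let $M$ be a smooth manifold (Hausdorff, second countable, without boundary, of dimension $m$), and let $E\to M$ be a smooth complex vector bundle of rank $n$ with a smooth hermitian metric and an orientation, i.e. a smooth complex volume form $\mathrm{vol}$ of norm one (an $SU(n)$-structure). Let $\mathfrak A=\Gamma(\mathrm{End}\,E)$ be the algebra of smooth sections of $\mathrm{End}(E)$. For a complex unital algebra $A$ with center $Z(A)$, let $\mathrm{Der}(A)$ be its Lie algebra of ($\mathbb C$-linear) derivations, and let $\Omega^q_{\mathrm{Der}}(A)$ be the space of $Z(A)$-multilinear alternating maps $\mathrm{Der}(A)^q\to A$, with the differential $$(\hat d\omega)(X_0,\dots,X_q)=\sum_{i}(-1)^iX_i\,\omega(X_0,\dots,\widehat{X_i},\dots,X_q)+\sum_{i<j}(-1)^{i+j}\omega([X_i,X_j],X_0,\dots,\widehat{X_i},\dots,\widehat{X_j},\dots,X_q).$$ Let $\mathfrak U=\{U_\alpha\}_{\alpha\in I}$ be a good cover of $M$ (all nonempty finite intersections are diffeomorphic to $\mathbb R^m$) indexed by a totally ordered set $I$, and for each $\alpha$ let $e_\alpha$ be a smooth orthonormal frame of $E$ over $U_\alpha$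 with $\mathrm{vol}(e_\alpha)=1$. Let $g_{\alpha\beta}:U_\alpha\cap U_\beta\to SU(n)$ be the transition functions, $(e_\beta)_j=\sum_i (g_{\alpha\beta})_{ij}(e_\alpha)_i$. For $U\subset M$ open put $\mathfrak A(U)=C^\infty(U)\otimes M_n(\mathbb C)$. The frame $e_\alpha$ gives a homomorphism $\mathfrak A\to\mathfrak A(V)$ for $V\subset U_\alpha$ open (the matrix of a section in the frame), for $V\subset U$ there is the restriction $\mathfrak A(U)\to\mathfrak A(V)$, and a smooth $g:V\to SU(n)$ gives the automorphism $a\mapsto g^{-1}ag$ of $\mathfrak A(V)$. Each composite $r:A\to B$ of these homomorphisms used below induces a map $r_*:\Omega^q_{\mathrm{Der}}(A)\to\Omega^q_{\mathrm{Der}}(B)$: $r_*\omega$ is the unique form with $r(\omega(X_1,\dots,X_q))=(r_*\omega)(Y_1,\dots,Y_q)$ whenever $r\circ X_i=Y_i\circ r$ for all $i$. Write $\omega_{\upharpoonright V}$ for the image of $\omega$ under restriction, and $(\omega_{\upharpoonright V})^g$ for its image under restriction to $V$ followed by $a\mapsto g^{-1}ag$. For $p,q\ge 0$ let $$C^{p,q}(\mathfrak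 U,\mathcal F)=\prod_{\alpha_0<\dots<\alpha_p}\Omega^q_{\mathrm{Der}}(\mathfrak A(U_{\alpha_0\dots\alpha_p})),\qquad U_{\alpha_0\dots\alpha_p}=U_{\alpha_0}\cap\dots\cap U_{\alpha_p},$$ with $\hat d:C^{p,q}\to C^{p,q+1}$ acting componentwise and the twisted Čech differential $\delta:C^{p,q}\to C^{p+1,q}$, $$(\delta\omega)_{\alpha_0\dots\alpha_{p+1}}=\sum_{i=0}^{p}(-1)^i\,\omega_{\alpha_0\dots\widehat{\alpha_i}\dots\alpha_{p+1}}+(-1)^{p+1}\,\omega_{\alpha_0\dots\alpha_p}^{\,g_{\alpha_p\alpha_{p+1}}}$$ (all terms restricted to $U_{\alpha_0\dots\alpha_{p+1}}$). Let $C^k(\mathfrak U,\mathcal F)=\bigoplus_{p+q=k}C^{p,q}(\mathfrak U,\mathcal F)$ with $D=\delta+(-1)^p\hat d$, and let $\varepsilon:\Omega^k_{\mathrm{Der}}(\mathfrak A)\to C^{0,k}(\mathfrak U,\mathcal F)\subset C^k(\mathfrak U,\mathcal F)$ send a form to the family of its images on the $U_\alpha$ in the frames $e_\alpha$. Then $\hat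 d^2=0$ on $\Omega_{\mathrm{Der}}(\mathfrak A)$, $D^2=0$, $D\varepsilon=\varepsilon\hat d$, and $\varepsilon$ induces isomorphisms of complex vector spaces $$H^k(\Omega_{\mathrm{Der}}(\mathfrak A),\hat d)\;\cong\;H^k(C(\mathfrak U,\mathcal F),D)\qquad\text{for all }k\ge 0 .$$ -/

import Mathlib

open scoped Manifold ContDiff InnerProductSpace
open Bundle TopologicalSpace

noncomputable section

namespace NCDeRham

section Algebra

attribute [local instance] LieRing.ofAssociativeRing

/-- The Lie algebra of derivations of a complex (not necessarily commutative) algebra,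
with the commutator bracket. -/
def Der (A : Type*) [Ring A] [Algebra ℂ A] : LieSubalgebra ℂ (Module.End ℂ A) where
  carrier := {X | ∀ a b, X (a * b) = X a * b + a * X b}
  add_mem' := by
    intro X Y hX hY a b
    simp only [Set.mem_ofPred_eq] at hX hY
    simp only [LinearMap.add_apply, hX, hY]
    noncomm_ring
  zero_mem' := by intro a b; simp
  smul_mem' := by
    intro c X hX a b
    simp only [Set.mem_ofPred_eq] at hX
    simp [hX]
  lie_mem' := by
    intro X Y hX hY a b
    have hX' : ∀ a b, X (a * b) = X a * b + a * X b := hX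
    have hY' : ∀ a b, Y (a * b) = Y a * b + a * Y b := hY
    simp only [Ring.lie_def, LinearMap.sub_apply, Module.End.mul_apply, hX', hY', map_add]
    noncomm_ring

variable {A : Type*} [Ring A] [Algebra ℂ A] {B : Type*} [Ring B] [Algebra ℂ B]

theorem Der.leibniz (X : Der A) (a b : A) : X.1 (a * b) = X.1 a * b + a * X.1 b := X.2 a b

instance : AddCommGroup (Der A) := inferInstance

instance : Module ℂ (Der A) := inferInstance

/-- Derivations form a module over the center: `(z • X) a = z * X a`. -/
instance : SMul (Subalgebra.center ℂ A) (Der A) where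
  smul z X := ⟨LinearMap.mulLeft ℂ (z : A) ∘ₗ X.1, by
    intro a b
    have h := (Subalgebra.mem_center_iff.mp z.2) a
    simp only [LinearMap.comp_apply, LinearMap.mulLeft_apply, Der.leibniz X, mul_add, mul_assoc]
    rw [← mul_assoc (z : A) a, ← h, mul_assoc]⟩

theorem Der.smul_apply (z : Subalgebra.center ℂ A) (X : Der A) (a : A) :
    (z • X).1 a = z * X.1 a := rfl

variable (A) in
/-- Noncommutative `q`-forms of the derivation-based differential calculus: maps
`Der A × ⋯ × Der A → A` which are alternating and multilinear over the center of `A`. -/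
def Form (q : ℕ) : Submodule ℂ (Der A [⋀^Fin q]→ₗ[ℂ] A) where
  carrier := {w | ∀ (z : Subalgebra.center ℂ A) (X : Fin q → Der A) (i : Fin q),
    w (Function.update X i (z • X i)) = z * w X}
  add_mem' := by
    intro w η hw hη z X i
    simp only [Set.mem_ofPred_eq] at hw hη
    simp [hw, hη, mul_add]
  zero_mem' := by intro z X i; simp
  smul_mem' := by
    intro c w hw z X i
    simp only [Set.mem_ofPred_eq] at hw
    simp [hw]

instance (q : ℕ) : AddCommGroup (Form A q) := Submodule.addCommGroup _

instance (q : ℕ) : Module ℂ (Form A q) := Submodule.module _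

/-- The Koszul formula
`(dw)(X₀,…,X_q) = ∑ᵢ (-1)ⁱ Xᵢ(w(X₀,…,X̂ᵢ,…,X_q))
  + ∑_{i<j} (-1)^(i+j) w([Xᵢ,Xⱼ],X₀,…,X̂ᵢ,…,X̂ⱼ,…,X_q)`.
In the second sum the pair `i < j` of the usual formula is `(i.castSucc, j.succ)` with `i ≤ j`,
whence the sign in front of it. -/
def koszul : {q : ℕ} → (Der A [⋀^Fin q]→ₗ[ℂ] A) → (Fin (q + 1) → Der A) → A
  | 0, w, X => ∑ i : Fin 1, (-1 : ℤ) ^ (i : ℕ) • (X i).1 (w (i.removeNth X))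
  | q + 1, w, X => (∑ i : Fin (q + 2), (-1 : ℤ) ^ (i : ℕ) • (X i).1 (w (i.removeNth X)))
      - ∑ i : Fin (q + 1), ∑ j ≥ i, (-1 : ℤ) ^ (i + j : ℕ) •
          w (Matrix.vecCons ⁅X i.castSucc, X j.succ⁆ (j.removeNth (i.castSucc.removeNth X)))

/-- `X ↦ X ∘ w`. -/
def actAux {q : ℕ} (w : Der A [⋀^Fin q]→ₗ[ℂ] A) : Der A →ₗ[ℂ] (Der A [⋀^Fin q]→ₗ[ℂ] A) where
  toFun X := X.1.compAlternatingMap w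
  map_add' X Y := by ext; simp
  map_smul' c X := by ext; simp

/-- `(X, Y) ↦ w([X, Y], ⋯)`. -/
def bracketAux {q : ℕ} (w : Der A [⋀^Fin (q + 1)]→ₗ[ℂ] A) :
    Der A →ₗ[ℂ] Der A →ₗ[ℂ] (Der A [⋀^Fin q]→ₗ[ℂ] A) :=
  LinearMap.compr₂ (LieModule.toEnd ℂ (Der A) (Der A)).toLinearMap w.curryLeft

/-- An alternating map whose values are given by the Koszul formula. -/
def koszulAux : {q : ℕ} → (Der A [⋀^Fin q]→ₗ[ℂ] A) → (Der A [⋀^Fin (q + 1)]→ₗ[ℂ] A)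
  | 0, w => AlternatingMap.alternatizeUncurryFin (actAux w)
  | _ + 1, w => AlternatingMap.alternatizeUncurryFin (actAux w) - (2⁻¹ : ℂ) •
      AlternatingMap.alternatizeUncurryFin
        (AlternatingMap.alternatizeUncurryFinLM ∘ₗ bracketAux w)

theorem koszulAux_apply : {q : ℕ} → (w : Der A [⋀^Fin q]→ₗ[ℂ] A) → (X : Fin (q + 1) → Der A) →
    koszulAux w X = koszul w X
  | 0, w, X => by
    simp [koszulAux, koszul, actAux, AlternatingMap.alternatizeUncurryFin_apply]
  | q + 1, w, X => by
    simp only [koszulAux, koszul, AlternatingMap.sub_apply, AlternatingMap.smul_apply,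
      AlternatingMap.alternatizeUncurryFin_apply (actAux w),
      AlternatingMap.alternatizeUncurryFin_alternatizeUncurryFinLM_comp_apply]
    congr 1
    rw [Finset.smul_sum]
    refine Finset.sum_congr rfl fun i _ => ?_
    rw [Finset.smul_sum]
    refine Finset.sum_congr rfl fun j _ => ?_
    have h : bracketAux w (X j.succ) (X i.castSucc) = - bracketAux w (X i.castSucc) (X j.succ) := by
      simp only [bracketAux, LinearMap.compr₂_apply, LieHom.coe_toLinearMap,
        LieModule.toEnd_apply_apply]
      rw [← lie_skew, map_neg]
    rw [h, AlternatingMap.neg_apply, sub_neg_eq_add, ← two_smul ℂ, smul_comm, smul_smul,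
      inv_mul_cancel₀ (two_ne_zero), one_smul]
    rfl

theorem Form.map_smul {q : ℕ} (w : Form A q) (z : Subalgebra.center ℂ A) (X : Fin q → Der A)
    (i : Fin q) : w.1 (Function.update X i (z • X i)) = z * w.1 X := w.2 z X i

theorem Form.map_cons_smul {q : ℕ} (w : Form A (q + 1)) (z : Subalgebra.center ℂ A) (x : Der A)
    (v : Fin q → Der A) :
    w.1 (Fin.cons (z • x) v) = z * w.1 (Fin.cons x v) := by
  have := Form.map_smul w z (Fin.cons x v) 0
  rwa [Fin.update_cons_zero, Fin.cons_zero] at this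

/-- The value of a derivation on a central element is central. -/
theorem Der.apply_mem_center (X : Der A) (z : Subalgebra.center ℂ A) :
    X.1 z ∈ Subalgebra.center ℂ A := by
  rw [Subalgebra.mem_center_iff]
  intro b
  have h := Subalgebra.mem_center_iff.mp z.2
  have h1 := congrArg X.1 (h b)
  rw [Der.leibniz, Der.leibniz, h (X.1 b), add_comm (X.1 (z : A) * b)] at h1
  exact add_left_cancel h1

theorem Der.smul_lie (z : Subalgebra.center ℂ A) (X Y : Der A) :
    ⁅z • X, Y⁆ = z • ⁅X, Y⁆ - (⟨Y.1 z, Der.apply_mem_center Y z⟩ : Subalgebra.center ℂ A) • X := by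
  apply Subtype.ext
  apply LinearMap.ext
  intro a
  change (z : A) * X.1 (Y.1 a) - Y.1 ((z : A) * X.1 a) =
    (z : A) * (X.1 (Y.1 a) - Y.1 (X.1 a)) - Y.1 z * X.1 a
  rw [Der.leibniz]
  noncomm_ring

theorem koszul_cons_smul : {q : ℕ} → (w : Form A q) → (z : Subalgebra.center ℂ A) → (x : Der A) →
    (v : Fin q → Der A) →
    koszul w.1 (Fin.cons (z • x) v) = z * koszul w.1 (Fin.cons x v)
  | 0, w, z, x, v => by
    simp [koszul, Der.smul_apply]
  | q + 1, w, z, x, v => by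
    have rem : ∀ (y : Der A) (i : Fin (q + 1)), i.succ.removeNth (Fin.cons y v : Fin (q + 2) → Der A)
        = Fin.cons y (i.removeNth v) := by
      intro y i
      ext1 k
      refine Fin.cases ?_ (fun k => ?_) k
      · simp [Fin.removeNth]
      · simp [Fin.removeNth, Fin.succ_succAbove_succ]
    have h1 : ∀ i : Fin (q + 1), (-1 : ℤ) ^ (i.succ : ℕ) •
          (v i).1 (w.1 (Fin.cons (z • x) (i.removeNth v)))
        = z * ((-1 : ℤ) ^ (i.succ : ℕ) • (v i).1 (w.1 (Fin.cons x (i.removeNth v))))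
          - (-1 : ℤ) ^ (i : ℕ) • ((v i).1 z * w.1 (Fin.cons x (i.removeNth v))) := by
      intro i
      rw [Form.map_cons_smul, Der.leibniz, Fin.val_succ, pow_succ, smul_add, mul_smul_comm]
      simp only [mul_neg, mul_one, neg_smul]
      abel
    have h2 : ∀ j : Fin (q + 1),
        w.1 (Matrix.vecCons ⁅z • x, v j⁆ (j.removeNth v)) =
          z * w.1 (Matrix.vecCons ⁅x, v j⁆ (j.removeNth v)) -
            (v j).1 z * w.1 (Fin.cons x (j.removeNth v)) := by
      intro j
      have e : ∀ y, Matrix.vecCons y (j.removeNth v) = Fin.cons y (j.removeNth v) := fun y => rfl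
      have := w.1.map_update_sub (Fin.cons 0 (j.removeNth v)) 0 (z • ⁅x, v j⁆)
        ((⟨(v j).1 z, Der.apply_mem_center (v j) z⟩ : Subalgebra.center ℂ A) • x)
      simp only [Fin.update_cons_zero] at this
      rw [e, e, Der.smul_lie, this, Form.map_cons_smul, Form.map_cons_smul]
    have h3 : ∀ (i : Fin q) (j : Fin (q + 1)), i.succ ≤ j →
        w.1 (Matrix.vecCons ⁅v i.castSucc, v j⁆
            (j.removeNth (i.succ.castSucc.removeNth (Fin.cons (z • x) v : Fin (q + 2) → Der A)))) =
          z * w.1 (Matrix.vecCons ⁅v i.castSucc, v j⁆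
            (j.removeNth (i.succ.castSucc.removeNth (Fin.cons x v : Fin (q + 2) → Der A)))) := by
      intro i j hij
      obtain ⟨j, rfl⟩ := Fin.exists_succ_eq.mpr (ne_of_gt (lt_of_lt_of_le (Fin.succ_pos i) hij))
      obtain ⟨q, rfl⟩ : ∃ q', q = q' + 1 := ⟨q - 1, by have := i.2; omega⟩
      have hr : ∀ y : Der A, j.succ.removeNth (i.succ.castSucc.removeNth
          (Fin.cons y v : Fin (q + 1 + 2) → Der A)) =
          Fin.cons y (j.removeNth (i.castSucc.removeNth v)) := by
        intro y
        rw [← Fin.succ_castSucc, rem]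
        ext1 k
        refine Fin.cases ?_ (fun k => ?_) k
        · simp [Fin.removeNth]
        · simp [Fin.removeNth, Fin.succ_succAbove_succ]
      rw [hr, hr]
      have := Form.map_smul w z (Matrix.vecCons ⁅v i.castSucc, v j.succ⁆
        (Fin.cons x (j.removeNth (i.castSucc.removeNth v)))) 1
      rw [← this]
      congr 1
      ext1 k
      refine Fin.cases ?_ (fun k => Fin.cases ?_ (fun k => ?_) k) k <;> rfl
    have r0 : ∀ y : Der A, (0 : Fin (q + 2)).removeNth (Fin.cons y v : Fin (q + 2) → Der A) = v :=
      fun y => by ext1 k; simp [Fin.removeNth]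
    have dec : ∀ y : Der A, koszul w.1 (Fin.cons y v) = y.1 (w.1 v)
        + ∑ i : Fin (q + 1), (-1 : ℤ) ^ (i.succ : ℕ) • (v i).1 (w.1 (Fin.cons y (i.removeNth v)))
        - (∑ j : Fin (q + 1), (-1 : ℤ) ^ (j : ℕ) •
            w.1 (Matrix.vecCons ⁅y, v j⁆ (j.removeNth v))
          + ∑ i : Fin q, ∑ j ≥ i.succ, (-1 : ℤ) ^ ((i.succ : ℕ) + j : ℕ) •
          w.1 (Matrix.vecCons ⁅v i.castSucc, v j⁆
            (j.removeNth (i.succ.castSucc.removeNth (Fin.cons y v : Fin (q + 2) → Der A))))) := by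
      intro y
      have hI : Finset.Ici (0 : Fin (q + 1)) = Finset.univ := by ext; simp
      rw [koszul]
      congr 1
      · rw [Fin.sum_univ_succ]
        simp only [Fin.cons_zero, Fin.cons_succ, rem, r0, Fin.val_zero, pow_zero, one_smul]
      · rw [Fin.sum_univ_succ]
        congr 1
        simp only [Fin.cons_zero, Fin.cons_succ, Fin.castSucc_zero, hI, Fin.val_zero, zero_add, r0]
    have h5 : (∑ i : Fin q, ∑ j ≥ i.succ, (-1 : ℤ) ^ ((i.succ : ℕ) + j : ℕ) •
          w.1 (Matrix.vecCons ⁅v i.castSucc, v j⁆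
            (j.removeNth (i.succ.castSucc.removeNth (Fin.cons (z • x) v : Fin (q + 2) → Der A))))) =
        z * ∑ i : Fin q, ∑ j ≥ i.succ, (-1 : ℤ) ^ ((i.succ : ℕ) + j : ℕ) •
          w.1 (Matrix.vecCons ⁅v i.castSucc, v j⁆
            (j.removeNth (i.succ.castSucc.removeNth (Fin.cons x v : Fin (q + 2) → Der A)))) := by
      rw [Finset.mul_sum]
      refine Finset.sum_congr rfl fun i _ => ?_
      rw [Finset.mul_sum]
      refine Finset.sum_congr rfl fun j hj => ?_
      rw [h3 i j (Finset.mem_Ici.mp hj), mul_smul_comm]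
    rw [dec, dec, h5]
    simp only [h1, h2, Finset.sum_sub_distrib, smul_sub, Der.smul_apply, mul_sub, mul_add,
      Finset.mul_sum, mul_smul_comm]
    abel

theorem koszulAux_mem {q : ℕ} (w : Form A q) : koszulAux w.1 ∈ Form A (q + 1) := by
  intro z X k
  have key : ∀ (x : Der A) (v : Fin q → Der A),
      koszulAux w.1 (k.insertNth (z • x) v) = z * koszulAux w.1 (k.insertNth x v) := by
    intro x v
    rw [AlternatingMap.map_insertNth, AlternatingMap.map_insertNth, koszulAux_apply,
      koszulAux_apply, mul_smul_comm]
    congr 1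
    exact koszul_cons_smul w z x v
  have := key (X k) (k.removeNth X)
  rwa [Fin.insertNth_self_removeNth, Fin.insertNth_removeNth] at this

variable (A) in
/-- The differential `d̂` of the derivation-based calculus. -/
def dForm (q : ℕ) : Form A q →ₗ[ℂ] Form A (q + 1) where
  toFun w := ⟨{
      toFun := koszul w.1
      map_update_add' := by
        intro _ X i x y
        rw [← koszulAux_apply, ← koszulAux_apply, ← koszulAux_apply]
        convert (koszulAux w.1).map_update_add X i x y
      map_update_smul' := by
        intro _ X i c x
        rw [← koszulAux_apply, ← koszulAux_apply]
        convert (koszulAux w.1).map_update_smul X i c x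
      map_eq_zero_of_eq' := by
        intro X i j h hij
        rw [← koszulAux_apply]
        exact (koszulAux w.1).map_eq_zero_of_eq X h hij }, by
    intro z X i
    have := koszulAux_mem w z X i
    rwa [koszulAux_apply, koszulAux_apply] at this⟩
  map_add' w η := by
    ext X
    change koszul (w.1 + η.1) X = koszul w.1 X + koszul η.1 X
    cases q <;> simp [koszul, Finset.sum_add_distrib] <;> abel
  map_smul' c w := by
    ext X
    change koszul (c • w.1) X = c • koszul w.1 X
    cases q <;> simp [koszul, smul_sub, Finset.smul_sum]

theorem dForm_apply {q : ℕ} (w : Form A q) (X : Fin (q + 1) → Der A) :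
    (dForm A q w).1 X = koszul w.1 X := rfl


/-- Along a homomorphism `r : A → B`, a derivation `X` of `A` and a derivation `Y` of `B` are
`r`-related if `r (X a) = Y (r a)`. -/
def DerRelated (r : A →ₐ[ℂ] B) (X : Der A) (Y : Der B) : Prop := ∀ a, r (X.1 a) = Y.1 (r a)

/-- `η` is the image of the form `w` along `r : A → B`: the two forms take `r`-related values on
`r`-related derivations. -/
def FormRelated (r : A →ₐ[ℂ] B) {q : ℕ} (w : Form A q) (η : Form B q) : Prop :=
  ∀ (X : Fin q → Der A) (Y : Fin q → Der B), (∀ i, DerRelated r (X i) (Y i)) →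
    r (w.1 X) = η.1 Y

/-- Every form on `A` has exactly one image on `B` along `r`. -/
def UniqueImage (r : A →ₐ[ℂ] B) : Prop :=
  ∀ (q : ℕ) (w : Form A q), ∃! η : Form B q, FormRelated r w η

/-- The map induced on forms by a homomorphism along which forms have unique images. -/
def formMap (r : A →ₐ[ℂ] B) (h : UniqueImage r) (q : ℕ) : Form A q →ₗ[ℂ] Form B q where
  toFun w := (h q w).choose
  map_add' w w' := by
    refine ((h q (w + w')).choose_spec.2 _ ?_).symm
    intro X Y hXY
    have h1 := (h q w).choose_spec.1 X Y hXY
    have h2 := (h q w').choose_spec.1 X Y hXY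
    change r (w.1 X + w'.1 X) = _
    rw [map_add, h1, h2]
    rfl
  map_smul' c w := by
    refine ((h q (c • w)).choose_spec.2 _ ?_).symm
    intro X Y hXY
    have h1 := (h q w).choose_spec.1 X Y hXY
    change r (c • w.1 X) = _
    rw [map_smul, h1]
    rfl

theorem formMap_related (r : A →ₐ[ℂ] B) (h : UniqueImage r) {q : ℕ} (w : Form A q) :
    FormRelated r w (formMap r h q w) := (h q w).choose_spec.1

theorem Form.map_smul_univ {q : ℕ} (w : Form A q) (z : Subalgebra.center ℂ A)
    (X : Fin q → Der A) : w.1 (fun i => z • X i) = (z : A) ^ q * w.1 X := by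
  have h : ∀ s : Finset (Fin q), w.1 (s.piecewise (fun i => z • X i) X) =
      (z : A) ^ s.card * w.1 X := by
    intro s
    induction s using Finset.induction_on with
    | empty => simp
    | insert i s hi ih =>
      rw [Finset.piecewise_insert, Finset.card_insert_of_notMem hi, pow_succ', mul_assoc, ← ih,
        ← Form.map_smul w z _ i, Finset.piecewise_eq_of_notMem _ _ _ hi]
  have := h Finset.univ
  rwa [Finset.piecewise_univ, Finset.card_univ, Fintype.card_fin] at this

/-- An element `χ` of `A` playing the role of a bump function whose support lies in the smaller
domain on which the elements of `B` live. -/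
structure BumpLike (r : A →ₐ[ℂ] B) (χ : A) : Prop where
  mem_center : χ ∈ Subalgebra.center ℂ A
  map_mem_center : r χ ∈ Subalgebra.center ℂ B
  exists_ext : ∀ b, ∃ a, r a = r χ * b
  mul_eq_zero : ∀ a, r a = 0 → χ * a = 0

namespace BumpLike

variable {r : A →ₐ[ℂ] B} {χ : A} (hχ : BumpLike r χ)

theorem comm (hχ : BumpLike r χ) (a : A) : χ * a = a * χ :=
  (Subalgebra.mem_center_iff.mp hχ.mem_center a).symm

theorem mapComm (hχ : BumpLike r χ) (b : B) : r χ * b = b * r χ :=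
  (Subalgebra.mem_center_iff.mp hχ.map_mem_center b).symm

/-- `χ² b`, extended by zero. -/
def ext (b : B) : A := χ * (hχ.exists_ext b).choose

theorem ext_eq {b : B} {a : A} (h : r a = r χ * b) : hχ.ext b = χ * a := by
  rw [← sub_eq_zero, ext, ← mul_sub]
  apply hχ.mul_eq_zero
  rw [map_sub, (hχ.exists_ext b).choose_spec, h, sub_self]

theorem map_ext (b : B) : r (hχ.ext b) = r χ * r χ * b := by
  rw [ext, map_mul, (hχ.exists_ext b).choose_spec, mul_assoc]

theorem ext_add (b b' : B) : hχ.ext (b + b') = hχ.ext b + hχ.ext b' := by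
  obtain ⟨a, ha⟩ := hχ.exists_ext b
  obtain ⟨a', ha'⟩ := hχ.exists_ext b'
  rw [hχ.ext_eq ha, hχ.ext_eq ha', ← mul_add]
  exact hχ.ext_eq (by rw [map_add, ha, ha', mul_add])

theorem ext_smul (c : ℂ) (b : B) : hχ.ext (c • b) = c • hχ.ext b := by
  obtain ⟨a, ha⟩ := hχ.exists_ext b
  rw [hχ.ext_eq ha, ← mul_smul_comm]
  exact hχ.ext_eq (by rw [map_smul, ha, mul_smul_comm])

theorem ext_mul_map (b : B) (a' : A) : hχ.ext (b * r a') = hχ.ext b * a' := by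
  obtain ⟨a, ha⟩ := hχ.exists_ext b
  rw [hχ.ext_eq ha, mul_assoc]
  exact hχ.ext_eq (by rw [map_mul, ha, mul_assoc])

theorem ext_map_mul (b : B) (a' : A) : hχ.ext (r a' * b) = a' * hχ.ext b := by
  obtain ⟨a, ha⟩ := hχ.exists_ext b
  rw [hχ.ext_eq ha, ← mul_assoc, ← hχ.comm, mul_assoc]
  refine hχ.ext_eq ?_
  rw [map_mul, ha, ← mul_assoc, ← mul_assoc, hχ.mapComm]

theorem ext_map (a : A) : hχ.ext (r a) = χ * χ * a := by
  rw [mul_assoc]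
  exact hχ.ext_eq (by rw [map_mul])

theorem ext_mem_center (z : Subalgebra.center ℂ B) : hχ.ext z ∈ Subalgebra.center ℂ A := by
  rw [Subalgebra.mem_center_iff]
  intro a
  rw [← hχ.ext_map_mul, ← hχ.ext_mul_map, Subalgebra.mem_center_iff.mp z.2]

theorem ext_mul (z : Subalgebra.center ℂ B) (b : B) :
    χ * χ * hχ.ext (z * b) = hχ.ext z * hχ.ext b := by
  obtain ⟨a, ha⟩ := hχ.exists_ext b
  obtain ⟨c, hc⟩ := hχ.exists_ext (z : B)
  obtain ⟨d, hd⟩ := hχ.exists_ext (z * b)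
  rw [hχ.ext_eq ha, hχ.ext_eq hc, hχ.ext_eq hd, ← sub_eq_zero, mul_assoc, mul_assoc, ← mul_sub]
  apply hχ.mul_eq_zero
  simp only [map_sub, map_mul, ha, hc, hd]
  rw [sub_eq_zero, mul_assoc (r χ) (z : B), ← mul_assoc (z : B) (r χ), ← hχ.mapComm z]
  simp only [mul_assoc]
  rw [← mul_assoc (z : B) (r χ), ← hχ.mapComm z, mul_assoc]

theorem ext_compare {χ' : A} (hχ' : BumpLike r χ') (b : B) :
    χ' * χ' * hχ.ext b = χ * χ * hχ'.ext b := by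
  obtain ⟨a, ha⟩ := hχ.exists_ext b
  obtain ⟨a', ha'⟩ := hχ'.exists_ext b
  rw [hχ.ext_eq ha, hχ'.ext_eq ha', ← sub_eq_zero, ← mul_assoc, ← hχ.comm (χ' * χ'), mul_assoc,
    mul_assoc χ χ, ← mul_sub]
  apply hχ.mul_eq_zero
  simp only [map_sub, map_mul, ha, ha', sub_eq_zero]
  have h1 : r χ * (r χ' * (r χ' * b)) = r χ' * (r χ' * (r χ * b)) := by
    rw [← mul_assoc, hχ.mapComm (r χ'), mul_assoc, ← mul_assoc (r χ), hχ.mapComm (r χ'), mul_assoc]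
  rw [h1, mul_assoc]

/-- The derivation `χ² Y`, extended by zero. -/
def lift (Y : Der B) : Der A := ⟨{
    toFun := fun a => hχ.ext (Y.1 (r a))
    map_add' := fun a a' => by simp only [map_add, hχ.ext_add]
    map_smul' := fun c a => by simp only [map_smul, hχ.ext_smul, RingHom.id_apply] }, by
  intro a b
  simp only [LinearMap.coe_mk, AddHom.coe_mk, map_mul, Der.leibniz, hχ.ext_add, hχ.ext_mul_map,
    hχ.ext_map_mul]⟩

theorem lift_apply (Y : Der B) (a : A) : (hχ.lift Y).1 a = hχ.ext (Y.1 (r a)) := rfl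

theorem lift_add (Y Y' : Der B) : hχ.lift (Y + Y') = hχ.lift Y + hχ.lift Y' :=
  Subtype.ext (LinearMap.ext fun _ => hχ.ext_add _ _)

theorem lift_smul (c : ℂ) (Y : Der B) : hχ.lift (c • Y) = c • hχ.lift Y :=
  Subtype.ext (LinearMap.ext fun _ => hχ.ext_smul _ _)

theorem sq_mem_center (hχ : BumpLike r χ) : χ * χ ∈ Subalgebra.center ℂ A := mul_mem hχ.mem_center hχ.mem_center

theorem map_sq_mem_center (hχ : BumpLike r χ) : r χ * r χ ∈ Subalgebra.center ℂ B :=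
  mul_mem hχ.map_mem_center hχ.map_mem_center

theorem lift_center_smul (z : Subalgebra.center ℂ B) (Y : Der B) :
    (⟨χ * χ, hχ.sq_mem_center⟩ : Subalgebra.center ℂ A) • hχ.lift (z • Y) =
      (⟨hχ.ext z, hχ.ext_mem_center z⟩ : Subalgebra.center ℂ A) • hχ.lift Y :=
  Subtype.ext (LinearMap.ext fun _ => hχ.ext_mul z _)

theorem lift_compare {χ' : A} (hχ' : BumpLike r χ') (Y : Der B) :
    (⟨χ' * χ', hχ'.sq_mem_center⟩ : Subalgebra.center ℂ A) • hχ.lift Y =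
      (⟨χ * χ, hχ.sq_mem_center⟩ : Subalgebra.center ℂ A) • hχ'.lift Y :=
  Subtype.ext (LinearMap.ext fun _ => hχ.ext_compare hχ' _)

theorem lift_related (Y : Der B) : DerRelated r (hχ.lift Y)
    ((⟨r χ * r χ, hχ.map_sq_mem_center⟩ : Subalgebra.center ℂ B) • Y) :=
  fun _ => hχ.map_ext _

theorem lift_of_related {X : Der A} {Y : Der B} (h : DerRelated r X Y) :
    hχ.lift Y = (⟨χ * χ, hχ.sq_mem_center⟩ : Subalgebra.center ℂ A) • X :=
  Subtype.ext (LinearMap.ext fun a => by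
    rw [lift_apply, ← h a, hχ.ext_map]
    rfl)

theorem lift_update {q : ℕ} [DecidableEq (Fin q)] (Y : Fin q → Der B) (i : Fin q) (y : Der B) :
    (fun k => hχ.lift (Function.update Y i y k)) =
      Function.update (fun k => hχ.lift (Y k)) i (hχ.lift y) := by
  funext k
  by_cases hk : k = i
  · subst hk; simp
  · simp [hk]

end BumpLike

/-- Forms have unique images along `r : A → B` if `B` is an algebra of functions on a space,
closed under local gluing, and each point of that space has a bump function as above. -/
theorem uniqueImage_of_bump {V R : Type*} [TopologicalSpace V] [Ring R] [Algebra ℂ R]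
    (S : Subalgebra ℂ (V → R))
    (hS : ∀ f : V → R, (∀ y, ∃ b ∈ S, f =ᶠ[nhds y] b) → f ∈ S)
    (r : A →ₐ[ℂ] S)
    (hr : ∀ y : V, ∃ χ, BumpLike r χ ∧ (r χ).1 =ᶠ[nhds y] 1) : UniqueImage r := by
  intro q w
  choose χ hχ h1 using hr
  have hone : ∀ y, (r (χ y)).1 y = 1 := fun y => (h1 y).eq_of_nhds
  have eval : ∀ (a b : S) (y : V), (a * b).1 y = a.1 y * b.1 y := fun a b y => rfl
  have hcomp : ∀ (y y' : V), (r (χ y)).1 y' = 1 → ∀ Y : Fin q → Der S,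
      (r (w.1 fun i => (hχ y).lift (Y i))).1 y' = (r (w.1 fun i => (hχ y').lift (Y i))).1 y' := by
    intro y y' hy Y
    have e : (fun i => (⟨χ y' * χ y', (hχ y').sq_mem_center⟩ : Subalgebra.center ℂ A) •
          (hχ y).lift (Y i)) =
        fun i => (⟨χ y * χ y, (hχ y).sq_mem_center⟩ : Subalgebra.center ℂ A) •
          (hχ y').lift (Y i) := funext fun i => (hχ y).lift_compare (hχ y') (Y i)
    have e2 := congrArg (fun X => (r (w.1 X)).1 y') e
    simp only [Form.map_smul_univ, map_mul, map_pow] at e2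
    simpa [hone, hy] using e2
  let F : (Fin q → Der S) → V → R := fun Y y => (r (w.1 fun i => (hχ y).lift (Y i))).1 y
  have hF : ∀ Y, F Y ∈ S := by
    intro Y
    apply hS
    intro y
    refine ⟨_, (r (w.1 fun i => (hχ y).lift (Y i))).2, ?_⟩
    filter_upwards [h1 y] with y' hy'
    exact (hcomp y y' hy' Y).symm
  let η : Form S q := ⟨{
      toFun := fun Y => ⟨F Y, hF Y⟩
      map_update_add' := by
        intro inst Y i x y
        apply Subtype.ext
        funext p
        have := (w.1).map_update_add (fun k => (hχ p).lift (Y k)) i ((hχ p).lift x) ((hχ p).lift y)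
        rw [← BumpLike.lift_add, ← BumpLike.lift_update, ← BumpLike.lift_update,
          ← BumpLike.lift_update] at this
        have e := congrArg (fun X => (r X).1 p) this
        simp only [map_add] at e
        exact e
      map_update_smul' := by
        intro inst Y i c x
        apply Subtype.ext
        funext p
        have := (w.1).map_update_smul (fun k => (hχ p).lift (Y k)) i c ((hχ p).lift x)
        rw [← BumpLike.lift_smul, ← BumpLike.lift_update, ← BumpLike.lift_update] at this
        have e := congrArg (fun X => (r X).1 p) this
        simp only [map_smul] at e
        exact e
      map_eq_zero_of_eq' := by
        intro Y i j hij hne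
        apply Subtype.ext
        funext p
        change (r (w.1 fun i => (hχ p).lift (Y i))).1 p = 0
        rw [(w.1).map_eq_zero_of_eq (fun i => (hχ p).lift (Y i)) (by simp only [hij]) hne, map_zero]
        rfl }, by
    intro z Y i
    apply Subtype.ext
    funext p
    change (r (w.1 fun k => (hχ p).lift (Function.update Y i (z • Y i) k))).1 p =
      z.1.1 p * (r (w.1 fun k => (hχ p).lift (Y k))).1 p
    have e1 := Form.map_smul w ⟨χ p * χ p, (hχ p).sq_mem_center⟩
      (Function.update (fun k => (hχ p).lift (Y k)) i ((hχ p).lift (z • Y i))) i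
    have e2 := Form.map_smul w ⟨(hχ p).ext z, (hχ p).ext_mem_center z⟩
      (fun k => (hχ p).lift (Y k)) i
    rw [Function.update_self, Function.update_idem, BumpLike.lift_center_smul, e2,
      ← BumpLike.lift_update] at e1
    have e := congrArg (fun X => (r X).1 p) e1
    simp only [map_mul, BumpLike.map_ext, eval, hone, one_mul] at e
    exact e.symm⟩
  refine ⟨η, ?_, ?_⟩
  · intro X Y hXY
    apply Subtype.ext
    funext p
    change _ = (r (w.1 fun i => (hχ p).lift (Y i))).1 p
    have e : (fun i => (hχ p).lift (Y i)) =
        fun i => (⟨χ p * χ p, (hχ p).sq_mem_center⟩ : Subalgebra.center ℂ A) • X i :=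
      funext fun i => (hχ p).lift_of_related (hXY i)
    rw [e, Form.map_smul_univ]
    simp [eval, hone]
  · intro η' hη'
    apply Subtype.ext
    apply AlternatingMap.ext
    intro Y
    apply Subtype.ext
    funext p
    change _ = (r (w.1 fun i => (hχ p).lift (Y i))).1 p
    rw [hη' _ _ fun i => (hχ p).lift_related (Y i), Form.map_smul_univ]
    simp [eval, hone]

end Algebra

section Geometry

theorem contMDiffAt_cmul {H X F' : Type*} [NormedAddCommGroup F'] [NormedSpace ℝ F']
    [TopologicalSpace H] {I : ModelWithCorners ℝ F' H} [TopologicalSpace X] [ChartedSpace H X]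
    {f g : X → ℂ} {x : X} (hf : ContMDiffAt I 𝓘(ℝ, ℂ) ∞ f x) (hg : ContMDiffAt I 𝓘(ℝ, ℂ) ∞ g x) :
    ContMDiffAt I 𝓘(ℝ, ℂ) ∞ (fun y => f y * g y) x :=
  (contDiff_mul (𝕜 := ℝ) (𝔸 := ℂ)).contMDiff.contMDiffAt.comp x (hf.prodMk_space hg)

theorem contMDiff_cmul {H X F' : Type*} [NormedAddCommGroup F'] [NormedSpace ℝ F']
    [TopologicalSpace H] {I : ModelWithCorners ℝ F' H} [TopologicalSpace X] [ChartedSpace H X]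
    {f g : X → ℂ} (hf : ContMDiff I 𝓘(ℝ, ℂ) ∞ f) (hg : ContMDiff I 𝓘(ℝ, ℂ) ∞ g) :
    ContMDiff I 𝓘(ℝ, ℂ) ∞ (fun y => f y * g y) :=
  fun x => contMDiffAt_cmul (hf x) (hg x)

/-- The algebra `C^∞(U) ⊗ M_n(ℂ)` of smooth functions on `U` with values in `M_n(ℂ)`. -/
def MatAlg (m n : ℕ) {M : Type*} [TopologicalSpace M] [ChartedSpace (EuclideanSpace ℝ (Fin m)) M]
    (U : Opens M) : Subalgebra ℂ (U → Matrix (Fin n) (Fin n) ℂ) where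
  carrier := {a | ∀ i j, ContMDiff (𝓡 m) 𝓘(ℝ, ℂ) ∞ (fun x : U => a x i j)}
  mul_mem' := by
    intro a b ha hb i j
    simp only [Pi.mul_apply, Matrix.mul_apply]
    exact contMDiff_finsetSum fun k _ => contMDiff_cmul (ha i k) (hb k j)
  add_mem' := by
    intro a b ha hb i j
    exact (ha i j).add (hb i j)
  algebraMap_mem' := by
    intro c i j
    exact contMDiff_const

variable {m n : ℕ} {M : Type*} [TopologicalSpace M] [ChartedSpace (EuclideanSpace ℝ (Fin m)) M]

instance (U : Opens M) : Ring (MatAlg m n U) := Subalgebra.toRing _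

instance (U : Opens M) : Algebra ℂ (MatAlg m n U) := Subalgebra.algebra _

/-- Restriction of matrix valued functions. -/
def resHom {V U : Opens M} (h : V ≤ U) : MatAlg m n U →ₐ[ℂ] MatAlg m n V where
  toFun a := ⟨fun x => a.1 (Opens.inclusion h x), fun i j => (a.2 i j).comp (contMDiff_inclusion h)⟩
  map_one' := rfl
  map_mul' _ _ := rfl
  map_zero' := rfl
  map_add' _ _ := rfl
  commutes' _ := rfl

/-- The change of trivialization `a ↦ g⁻¹ a g` for a smooth map `g : V → SU(n)`. -/
def conjHom {V : Opens M} (g : V → Matrix.specialUnitaryGroup (Fin n) ℂ)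
    (hg : ∀ i j, ContMDiff (𝓡 m) 𝓘(ℝ, ℂ) ∞ (fun x => (g x).1 i j)) :
    MatAlg m n V →ₐ[ℂ] MatAlg m n V where
  toFun a := ⟨fun x => ((g x)⁻¹).1 * a.1 x * (g x).1, by
    intro i j
    simp only [Matrix.mul_apply]
    refine contMDiff_finsetSum fun k _ => contMDiff_cmul
      (contMDiff_finsetSum fun l _ => contMDiff_cmul ?_ (a.2 l k)) (hg k j)
    exact (Complex.conjCLE.contDiff.contMDiff.comp (hg l i) :)⟩
  map_one' := by
    apply Subtype.ext
    funext x
    change ((g x)⁻¹).1 * 1 * (g x).1 = 1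
    rw [mul_one]
    exact congrArg Subtype.val (inv_mul_cancel (g x))
  map_mul' a b := by
    apply Subtype.ext
    funext x
    change ((g x)⁻¹).1 * (a.1 x * b.1 x) * (g x).1 =
      ((g x)⁻¹).1 * a.1 x * (g x).1 * (((g x)⁻¹).1 * b.1 x * (g x).1)
    have : (g x).1 * ((g x)⁻¹).1 = 1 := congrArg Subtype.val (mul_inv_cancel (g x))
    calc _ = ((g x)⁻¹).1 * a.1 x * 1 * b.1 x * (g x).1 := by simp only [mul_one, mul_assoc]
      _ = _ := by rw [← this]; simp only [mul_assoc]
  map_zero' := by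
    apply Subtype.ext
    funext x
    change ((g x)⁻¹).1 * 0 * (g x).1 = 0
    simp
  map_add' a b := by
    apply Subtype.ext
    funext x
    change ((g x)⁻¹).1 * (a.1 x + b.1 x) * (g x).1 = _ + _
    rw [mul_add, add_mul]
  commutes' c := by
    apply Subtype.ext
    funext x
    change ((g x)⁻¹).1 * algebraMap ℂ _ c * (g x).1 = algebraMap ℂ _ c
    rw [mul_assoc, Algebra.commutes, ← mul_assoc]
    have : ((g x)⁻¹).1 * (g x).1 = 1 := congrArg Subtype.val (inv_mul_cancel (g x))
    rw [this, one_mul]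

theorem MatAlg.glue {V : Opens M} (f : V → Matrix (Fin n) (Fin n) ℂ)
    (hf : ∀ y, ∃ b ∈ MatAlg m n V, f =ᶠ[nhds y] b) : f ∈ MatAlg m n V := by
  intro i j y
  obtain ⟨b, hb, e⟩ := hf y
  exact (hb i j y).congr_of_eventuallyEq (e.mono fun z hz => congrFun (congrFun hz i) j)

theorem contMDiff_extend {V : Opens M} {f : M → ℝ} (hf : ContMDiff (𝓡 m) 𝓘(ℝ, ℝ) ∞ f)
    (hV : tsupport f ⊆ V) {b : V → ℂ} (hb : ContMDiff (𝓡 m) 𝓘(ℝ, ℂ) ∞ b) [DecidablePred (· ∈ V)] :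
    ContMDiff (𝓡 m) 𝓘(ℝ, ℂ) ∞ (fun x : M => if h : x ∈ V then (f x : ℂ) * b ⟨x, h⟩ else 0) := by
  intro x
  by_cases hx : x ∈ V
  · refine (contMDiffAt_subtype_iff (U := V) (x := ⟨x, hx⟩)).mp ?_
    have h1 : ContMDiff (𝓡 m) 𝓘(ℝ, ℂ) ∞ (fun y : V => (f y : ℂ)) :=
      (Complex.ofRealCLM.contDiff.contMDiff.comp (hf.comp contMDiff_subtype_val) :)
    convert (contMDiff_cmul h1 hb) ⟨x, hx⟩ using 2 with y
    simp
  · have hx' : x ∉ tsupport f := fun h => hx (hV h)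
    refine (contMDiffAt_const (c := (0 : ℂ))).congr_of_eventuallyEq ?_
    filter_upwards [(notMem_tsupport_iff_eventuallyEq.mp hx')] with y hy
    simp [hy]

theorem exists_bump [IsManifold (𝓡 m) ∞ M] [T2Space M] (V : Opens M) (y : V) :
    ∃ f : M → ℝ, ContMDiff (𝓡 m) 𝓘(ℝ, ℝ) ∞ f ∧ tsupport f ⊆ V ∧ f =ᶠ[nhds (y : M)] 1 := by
  obtain ⟨f, -, hf⟩ := (SmoothBumpFunction.nhds_basis_tsupport (I := 𝓡 m) (y : M)).mem_iff.mp
    (V.isOpen.mem_nhds y.2)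
  exact ⟨f, f.contMDiff, hf, f.eventuallyEq_one⟩

/-- A scalar function, as a multiple of the identity matrix. -/
def MatAlg.scalar (U : Opens M) {f : M → ℝ} (hf : ContMDiff (𝓡 m) 𝓘(ℝ, ℝ) ∞ f) : MatAlg m n U :=
  ⟨fun x => (f x : ℂ) • 1, fun i j => by
    have h1 : ContMDiff (𝓡 m) 𝓘(ℝ, ℂ) ∞ (fun y : U => (f y : ℂ)) :=
      (Complex.ofRealCLM.contDiff.contMDiff.comp (hf.comp contMDiff_subtype_val) :)
    exact contMDiff_cmul h1 contMDiff_const⟩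

theorem MatAlg.scalar_mem_center (U : Opens M) {f : M → ℝ}
    (hf : ContMDiff (𝓡 m) 𝓘(ℝ, ℝ) ∞ f) :
    (MatAlg.scalar U hf : MatAlg m n U) ∈ Subalgebra.center ℂ (MatAlg m n U) := by
  rw [Subalgebra.mem_center_iff]
  intro a
  apply Subtype.ext
  funext x
  change a.1 x * ((f x : ℂ) • 1) = ((f x : ℂ) • 1) * a.1 x
  simp

theorem resHom_bump [IsManifold (𝓡 m) ∞ M] [T2Space M] {V U : Opens M} (h : V ≤ U) (y : V) :
    ∃ χ : MatAlg m n U, BumpLike (resHom h) χ ∧ (resHom h χ).1 =ᶠ[nhds y] 1 := by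
  classical
  obtain ⟨f, hf, hV, h1⟩ := exists_bump (m := m) V y
  refine ⟨MatAlg.scalar U hf, ⟨MatAlg.scalar_mem_center U hf, MatAlg.scalar_mem_center V hf, ?_, ?_⟩,
    ?_⟩
  · intro b
    refine ⟨⟨fun x => Matrix.of fun i j =>
      if h : (x : M) ∈ V then (f x : ℂ) * b.1 ⟨x, h⟩ i j else 0, fun i j =>
        (contMDiff_extend hf hV (b.2 i j)).comp contMDiff_subtype_val⟩, ?_⟩
    apply Subtype.ext
    funext x
    change (Matrix.of fun i j => if h : (x : M) ∈ V then (f x : ℂ) * b.1 ⟨x, h⟩ i j else 0) =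
      ((f x : ℂ) • 1) * b.1 x
    ext i j
    simp
  · intro a ha
    apply Subtype.ext
    funext x
    change ((f x : ℂ) • 1) * a.1 x = 0
    by_cases hx : (x : M) ∈ V
    · have : a.1 x = 0 := congrFun (congrArg Subtype.val ha) ⟨x, hx⟩
      rw [this, mul_zero]
    · have : f x = 0 := image_eq_zero_of_notMem_tsupport fun h => hx (hV h)
      simp [this]
  · have := (continuous_subtype_val.continuousAt (x := y)).eventually h1
    filter_upwards [this] with z hz
    change (f z : ℂ) • (1 : Matrix (Fin n) (Fin n) ℂ) = 1
    rw [hz]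
    simp

theorem conjHom_bump {A : Type*} [Ring A] [Algebra ℂ A] {V : Opens M} (r : A →ₐ[ℂ] MatAlg m n V)
    (hr : ∀ y, ∃ χ : A, BumpLike r χ ∧ (r χ).1 =ᶠ[nhds y] 1)
    (g : V → Matrix.specialUnitaryGroup (Fin n) ℂ)
    (hg : ∀ i j, ContMDiff (𝓡 m) 𝓘(ℝ, ℂ) ∞ (fun x => (g x).1 i j)) (y : V) :
    ∃ χ : A, BumpLike ((conjHom g hg).comp r) χ ∧ ((conjHom g hg).comp r χ).1 =ᶠ[nhds y] 1 := by
  have hg' : ∀ i j, ContMDiff (𝓡 m) 𝓘(ℝ, ℂ) ∞ (fun x => ((g x)⁻¹).1 i j) := fun i j =>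
    (Complex.conjCLE.contDiff.contMDiff.comp (hg j i) :)
  have i1 : ∀ x, ((g x)⁻¹).1 * (g x).1 = 1 := fun x => congrArg Subtype.val (inv_mul_cancel (g x))
  have i2 : ∀ x, (g x).1 * ((g x)⁻¹).1 = 1 := fun x => congrArg Subtype.val (mul_inv_cancel (g x))
  have hinv : ∀ b, conjHom g hg (conjHom (fun x => (g x)⁻¹) hg' b) = b := by
    intro b
    apply Subtype.ext
    funext x
    change ((g x)⁻¹).1 * (((g x)⁻¹)⁻¹.1 * b.1 x * ((g x)⁻¹).1) * (g x).1 = b.1 x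
    rw [inv_inv]
    calc _ = (((g x)⁻¹).1 * (g x).1) * b.1 x * (((g x)⁻¹).1 * (g x).1) := by simp only [mul_assoc]
      _ = _ := by rw [i1, one_mul, mul_one]
  have hinv' : ∀ b, conjHom (fun x => (g x)⁻¹) hg' (conjHom g hg b) = b := by
    intro b
    apply Subtype.ext
    funext x
    change ((g x)⁻¹)⁻¹.1 * (((g x)⁻¹).1 * b.1 x * (g x).1) * ((g x)⁻¹).1 = b.1 x
    rw [inv_inv]
    calc _ = ((g x).1 * ((g x)⁻¹).1) * b.1 x * ((g x).1 * ((g x)⁻¹).1) := by simp only [mul_assoc]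
      _ = _ := by rw [i2, one_mul, mul_one]
  obtain ⟨χ, hχ, h1⟩ := hr y
  refine ⟨χ, ⟨hχ.mem_center, ?_, ?_, ?_⟩, ?_⟩
  · rw [Subalgebra.mem_center_iff]
    intro b
    rw [← hinv b, AlgHom.comp_apply, ← map_mul, ← map_mul, hχ.mapComm]
  · intro b
    obtain ⟨a, ha⟩ := hχ.exists_ext (conjHom (fun x => (g x)⁻¹) hg' b)
    exact ⟨a, by rw [AlgHom.comp_apply, AlgHom.comp_apply, ha, map_mul, hinv]⟩
  · intro a ha
    apply hχ.mul_eq_zero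
    rw [← hinv' (r a)]
    rw [AlgHom.comp_apply] at ha
    rw [ha, map_zero]
  · filter_upwards [h1] with x hx
    change ((g x)⁻¹).1 * (r χ).1 x * (g x).1 = 1
    rw [hx, Pi.one_apply, mul_one, i1]

theorem resHom_uniqueImage [IsManifold (𝓡 m) ∞ M] [T2Space M] {V U : Opens M} (h : V ≤ U) :
    UniqueImage (resHom h : MatAlg m n U →ₐ[ℂ] MatAlg m n V) :=
  uniqueImage_of_bump (MatAlg m n V) MatAlg.glue _ (resHom_bump h)

theorem conjHom_uniqueImage [IsManifold (𝓡 m) ∞ M] [T2Space M] {V U : Opens M} (h : V ≤ U)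
    (g : V → Matrix.specialUnitaryGroup (Fin n) ℂ)
    (hg : ∀ i j, ContMDiff (𝓡 m) 𝓘(ℝ, ℂ) ∞ (fun x => (g x).1 i j)) :
    UniqueImage ((conjHom g hg).comp (resHom h : MatAlg m n U →ₐ[ℂ] MatAlg m n V)) :=
  uniqueImage_of_bump (MatAlg m n V) MatAlg.glue _ (conjHom_bump _ (resHom_bump h) g hg)

end Geometry

section Bundle

variable {m n : ℕ} {M : Type*} [TopologicalSpace M] [ChartedSpace (EuclideanSpace ℝ (Fin m)) M]
  {E : M → Type*} [∀ x, NormedAddCommGroup (E x)] [∀ x, InnerProductSpace ℂ (E x)]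
  [TopologicalSpace (TotalSpace (EuclideanSpace ℂ (Fin n)) E)]
  [FiberBundle (EuclideanSpace ℂ (Fin n)) E]

/-- The section `s` of the bundle `E` of rank `n` is smooth at `x₀`. -/
def SmoothSecAt (m n : ℕ) {M : Type*} [TopologicalSpace M]
    [ChartedSpace (EuclideanSpace ℝ (Fin m)) M]
    {E : M → Type*} [∀ x, NormedAddCommGroup (E x)] [∀ x, InnerProductSpace ℂ (E x)]
    [TopologicalSpace (TotalSpace (EuclideanSpace ℂ (Fin n)) E)]
    [FiberBundle (EuclideanSpace ℂ (Fin n)) E]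
    (s : ∀ x, E x) (x₀ : M) : Prop :=
  ContMDiffAt (𝓡 m) ((𝓡 m).prod 𝓘(ℝ, EuclideanSpace ℂ (Fin n))) ∞
    (fun x => TotalSpace.mk' (EuclideanSpace ℂ (Fin n)) x (s x)) x₀

variable [VectorBundle ℂ (EuclideanSpace ℂ (Fin n)) E]
  [VectorBundle ℝ (EuclideanSpace ℂ (Fin n)) E]
  [ContMDiffVectorBundle ∞ (EuclideanSpace ℂ (Fin n)) E (𝓡 m)]

theorem SmoothSecAt.smul {f : M → ℂ} {s : ∀ x, E x} {x₀ : M}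
    (hf : ContMDiffAt (𝓡 m) 𝓘(ℝ, ℂ) ∞ f x₀) (hs : SmoothSecAt m n s x₀) :
    SmoothSecAt m n (fun x => f x • s x) x₀ := by
  unfold SmoothSecAt at hs ⊢
  rw [contMDiffAt_section] at hs ⊢
  have h1 : ContMDiffAt (𝓡 m) 𝓘(ℝ, EuclideanSpace ℂ (Fin n)) ∞ (fun x => f x •
      (trivializationAt (EuclideanSpace ℂ (Fin n)) E x₀ ⟨x, s x⟩).2) x₀ :=
    (isBoundedBilinearMap_smul (𝕜 := ℝ) (A := ℂ)
      (E := EuclideanSpace ℂ (Fin n))).contDiff.contMDiff.contMDiffAt.comp x₀ (hf.prodMk_space hs)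
  refine h1.congr_of_eventuallyEq ?_
  filter_upwards [(trivializationAt (EuclideanSpace ℂ (Fin n)) E x₀).open_baseSet.mem_nhds
    (FiberBundle.mem_baseSet_trivializationAt' x₀)] with x hx
  exact ((trivializationAt (EuclideanSpace ℂ (Fin n)) E x₀).linear ℂ hx).map_smul (f x) (s x)

theorem SmoothSecAt.add {s t : ∀ x, E x} {x₀ : M} (hs : SmoothSecAt m n s x₀)
    (ht : SmoothSecAt m n t x₀) : SmoothSecAt m n (fun x => s x + t x) x₀ :=
  ContMDiffAt.add_section hs ht

theorem SmoothSecAt.zero {x₀ : M} : SmoothSecAt m n (fun x => (0 : E x)) x₀ :=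
  (contMDiff_zeroSection ℝ E) x₀

theorem SmoothSecAt.sum {κ : Type*} (K : Finset κ) {s : κ → ∀ x, E x} {x₀ : M}
    (hs : ∀ k ∈ K, SmoothSecAt m n (s k) x₀) : SmoothSecAt m n (fun x => ∑ k ∈ K, s k x) x₀ := by
  classical
  induction K using Finset.induction_on with
  | empty => simpa using SmoothSecAt.zero
  | insert k K hk ih =>
    simp only [Finset.sum_insert hk]
    exact (hs k (Finset.mem_insert_self k K)).add
      (ih fun l hl => hs l (Finset.mem_insert_of_mem hl))

theorem SmoothSecAt.congr {s t : ∀ x, E x} {x₀ : M} (hs : SmoothSecAt m n s x₀)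
    (h : ∀ᶠ x in nhds x₀, t x = s x) : SmoothSecAt m n t x₀ :=
  ContMDiffAt.congr_of_eventuallyEq hs (h.mono fun x hx => by simp only [hx])

variable (m n E) in
/-- The algebra of smooth sections of `End(E)`: families of complex linear endomorphisms of the
fibers of `E` which map smooth local sections of `E` to smooth local sections. -/
def EndAlg : Subalgebra ℂ (∀ x, Module.End ℂ (E x)) where
  carrier := {a | ∀ (x₀ : M) (s : ∀ x, E x), SmoothSecAt m n s x₀ →
    SmoothSecAt m n (fun x => a x (s x)) x₀}
  mul_mem' := by
    intro a b ha hb x₀ s hs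
    exact ha x₀ _ (hb x₀ s hs)
  add_mem' := by
    intro a b ha hb x₀ s hs
    exact (ha x₀ s hs).add (hb x₀ s hs)
  algebraMap_mem' := by
    intro c x₀ s hs
    exact SmoothSecAt.smul (contMDiffAt_const (c := c)) hs

instance : Ring (EndAlg m n E) := Subalgebra.toRing _

instance : Algebra ℂ (EndAlg m n E) := Subalgebra.algebra _

variable (m n E) in
/-- A smooth hermitian metric (the inner products of the fibers) together with an orientation,
i.e. a smooth complex volume form of norm one. -/
structure OrientedHermitian where
  smooth_inner : ∀ (x₀ : M) (s t : ∀ x, E x), SmoothSecAt m n s x₀ → SmoothSecAt m n t x₀ →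
    ContMDiffAt (𝓡 m) 𝓘(ℝ, ℂ) ∞ (fun x => inner ℂ (s x) (t x)) x₀
  vol : ∀ x, E x [⋀^Fin n]→ₗ[ℂ] ℂ
  smooth_vol : ∀ (x₀ : M) (s : Fin n → ∀ x, E x), (∀ j, SmoothSecAt m n (s j) x₀) →
    ContMDiffAt (𝓡 m) 𝓘(ℝ, ℂ) ∞ (fun x => vol x (fun j => s j x)) x₀
  norm_vol : ∀ (x : M) (b : OrthonormalBasis (Fin n) ℂ (E x)), ‖vol x b‖ = 1

/-- A trivialization of the oriented hermitian bundle `E` over `U`: a smooth orthonormal frame of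
volume one, i.e. a smooth section over `U` of the `SU(n)`-principal frame bundle.
(The values of the frame outside of `U` are irrelevant.) -/
structure SUFrame (o : OrientedHermitian m n E) (U : Opens M) where
  basis : ∀ x, OrthonormalBasis (Fin n) ℂ (E x)
  smooth : ∀ x₀ ∈ U, ∀ j, SmoothSecAt m n (fun x => basis x j) x₀
  vol_eq_one : ∀ x ∈ U, o.vol x (basis x) = 1

variable {o : OrientedHermitian m n E}

/-- The restriction of a trivialization to a smaller open set. -/
def SUFrame.restrict {U V : Opens M} (e : SUFrame o U) (h : V ≤ U) : SUFrame o V where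
  basis := e.basis
  smooth x hx := e.smooth x (h hx)
  vol_eq_one x hx := e.vol_eq_one x (h hx)

/-- The transition matrix `g` from the frame `e` to the frame `e'`: `e'ⱼ = ∑ᵢ gᵢⱼ eᵢ`. -/
def transition {U U' V : Opens M} (e : SUFrame o U) (e' : SUFrame o U') (h : V ≤ U) (h' : V ≤ U')
    (x : V) : Matrix.specialUnitaryGroup (Fin n) ℂ :=
  ⟨(e.basis x).toBasis.toMatrix (e'.basis x), by
    rw [Matrix.mem_specialUnitaryGroup_iff]
    refine ⟨(e.basis x).toMatrix_orthonormalBasis_mem_unitary (e'.basis x), ?_⟩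
    have h1 := congrArg (fun f => f (e'.basis x))
      ((o.vol x).eq_smul_basis_det (e.basis x).toBasis)
    have h2 : o.vol x (e.basis x).toBasis = 1 := by
      rw [OrthonormalBasis.coe_toBasis]; exact e.vol_eq_one x (h x.2)
    simp only [AlternatingMap.smul_apply, h2, one_smul, e'.vol_eq_one x (h' x.2)] at h1
    exact h1.symm⟩

theorem transition_smooth {U U' V : Opens M} (e : SUFrame o U) (e' : SUFrame o U') (h : V ≤ U)
    (h' : V ≤ U') (i j : Fin n) :
    ContMDiff (𝓡 m) 𝓘(ℝ, ℂ) ∞ (fun x : V => (transition e e' h h' x).1 i j) := by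
  intro x
  have h1 := o.smooth_inner x _ _ (e.smooth x (h x.2) i) (e'.smooth x (h' x.2) j)
  refine (contMDiffAt_subtype_iff.mpr h1).congr_of_eventuallyEq (Filter.Eventually.of_forall ?_)
  intro y
  simp [transition, Module.Basis.toMatrix_apply, OrthonormalBasis.repr_apply_apply]

/-- The trivialization over `U` of a section of `End(E)`: its matrix in the given frame. -/
def locHom {U : Opens M} (e : SUFrame o U) : EndAlg m n E →ₐ[ℂ] MatAlg m n U where
  toFun a := ⟨fun x => LinearMap.toMatrix (e.basis x).toBasis (e.basis x).toBasis (a.1 x), by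
    intro i j x
    have h1 := o.smooth_inner x _ _ (e.smooth x x.2 i) (a.2 x _ (e.smooth x x.2 j))
    refine (contMDiffAt_subtype_iff.mpr h1).congr_of_eventuallyEq (Filter.Eventually.of_forall ?_)
    intro y
    simp [LinearMap.toMatrix_apply, OrthonormalBasis.repr_apply_apply]⟩
  map_one' := Subtype.ext (funext fun x => LinearMap.toMatrix_one _)
  map_mul' a b := Subtype.ext (funext fun x => LinearMap.toMatrix_mul _ _ _)
  map_zero' := Subtype.ext (funext fun x => map_zero _)
  map_add' a b := Subtype.ext (funext fun x => map_add _ _ _)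
  commutes' c := by
    apply Subtype.ext
    funext x
    change LinearMap.toMatrix _ _ (algebraMap ℂ (Module.End ℂ (E x)) c) = algebraMap ℂ _ c
    rw [Algebra.algebraMap_eq_smul_one, Algebra.algebraMap_eq_smul_one, map_smul,
      LinearMap.toMatrix_one]

/-- A scalar function, as a multiple of the identity endomorphism. -/
def EndAlg.scalar {f : M → ℝ} (hf : ContMDiff (𝓡 m) 𝓘(ℝ, ℝ) ∞ f) : EndAlg m n E :=
  ⟨fun x => (f x : ℂ) • 1, fun x₀ s hs => by
    have h1 : ContMDiff (𝓡 m) 𝓘(ℝ, ℂ) ∞ (fun y : M => (f y : ℂ)) :=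
      (Complex.ofRealCLM.contDiff.contMDiff.comp hf :)
    exact SmoothSecAt.smul (h1 x₀) hs⟩

theorem locHom_bump [IsManifold (𝓡 m) ∞ M] [T2Space M] {U : Opens M} (e : SUFrame o U) (y : U) :
    ∃ χ : EndAlg m n E, BumpLike (locHom e) χ ∧ (locHom e χ).1 =ᶠ[nhds y] 1 := by
  classical
  obtain ⟨f, hf, hU, h1⟩ := exists_bump (m := m) U y
  have hloc : locHom e (EndAlg.scalar hf) = MatAlg.scalar U hf := by
    apply Subtype.ext
    funext x
    change LinearMap.toMatrix _ _ ((f x : ℂ) • (1 : Module.End ℂ (E x))) = (f x : ℂ) • 1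
    rw [map_smul, LinearMap.toMatrix_one]
  refine ⟨EndAlg.scalar hf, ⟨?_, ?_, ?_, ?_⟩, ?_⟩
  · rw [Subalgebra.mem_center_iff]
    intro a
    apply Subtype.ext
    funext x
    change a.1 x * ((f x : ℂ) • 1) = ((f x : ℂ) • 1) * a.1 x
    simp
  · rw [hloc]
    exact MatAlg.scalar_mem_center U hf
  · intro b
    let β : M → Matrix (Fin n) (Fin n) ℂ := fun x => Matrix.of fun i j =>
      if h : (x : M) ∈ U then (f x : ℂ) * b.1 ⟨x, h⟩ i j else 0
    have hβ : ∀ i j, ContMDiff (𝓡 m) 𝓘(ℝ, ℂ) ∞ (fun x => β x i j) := fun i j =>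
      contMDiff_extend hf hU (b.2 i j)
    have hmem : (fun x => Matrix.toLin (e.basis x).toBasis (e.basis x).toBasis (β x)) ∈
        EndAlg m n E := by
      intro x₀ s hs
      by_cases hx : x₀ ∈ U
      · have h2 : SmoothSecAt m n (fun x => ∑ i, (∑ j, β x i j * inner ℂ (e.basis x j) (s x)) •
            e.basis x i) x₀ :=
          SmoothSecAt.sum _ fun i _ => SmoothSecAt.smul
            (contMDiffAt_finsetSum fun j _ => contMDiffAt_cmul (hβ i j x₀)
              (o.smooth_inner x₀ _ _ (e.smooth x₀ hx j) hs)) (e.smooth x₀ hx i)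
        refine h2.congr (Filter.Eventually.of_forall fun x => ?_)
        simp [Matrix.toLin_apply, Matrix.mulVec, dotProduct, OrthonormalBasis.repr_apply_apply]
      · have hx' : x₀ ∉ tsupport f := fun h => hx (hU h)
        refine SmoothSecAt.zero.congr ?_
        filter_upwards [(notMem_tsupport_iff_eventuallyEq.mp hx')] with x hx
        have : β x = 0 := by
          ext i j
          simp [β, hx]
        simp [this]
    refine ⟨⟨_, hmem⟩, ?_⟩
    rw [hloc]
    apply Subtype.ext
    funext x
    change LinearMap.toMatrix _ _ (Matrix.toLin _ _ (β x)) = ((f x : ℂ) • 1) * b.1 x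
    rw [LinearMap.toMatrix_toLin]
    ext i j
    simp [β]
  · intro a ha
    apply Subtype.ext
    funext x
    change ((f x : ℂ) • 1) * a.1 x = 0
    by_cases hx : x ∈ U
    · have h2 : LinearMap.toMatrix (e.basis x).toBasis (e.basis x).toBasis (a.1 x) = 0 :=
        congrFun (congrArg Subtype.val ha) ⟨x, hx⟩
      rw [(LinearEquiv.map_eq_zero_iff _).mp h2, mul_zero]
    · have : f x = 0 := image_eq_zero_of_notMem_tsupport fun h => hx (hU h)
      simp [this]
  · rw [hloc]
    have := (continuous_subtype_val.continuousAt (x := y)).eventually h1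
    filter_upwards [this] with z hz
    change (f z : ℂ) • (1 : Matrix (Fin n) (Fin n) ℂ) = 1
    rw [hz]
    simp

theorem locHom_uniqueImage [IsManifold (𝓡 m) ∞ M] [T2Space M] {U : Opens M} (e : SUFrame o U) :
    UniqueImage (locHom e) :=
  uniqueImage_of_bump (MatAlg m n U) MatAlg.glue _ (locHom_bump e)

end Bundle

section Cohomology

variable {C : ℕ → Type*} [∀ k, AddCommGroup (C k)] [∀ k, Module ℂ (C k)]

/-- The coboundaries of degree `k` of a complex `C⁰ → C¹ → ⋯`. -/
def coboundaries (d : ∀ k, C k →ₗ[ℂ] C (k + 1)) : ∀ k, Submodule ℂ (C k)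
  | 0 => ⊥
  | k + 1 => LinearMap.range (d k)

/-- The cohomology in degree `k` of a complex `C⁰ → C¹ → ⋯`. -/
def Cohomology (d : ∀ k, C k →ₗ[ℂ] C (k + 1)) (k : ℕ) : Type _ :=
  LinearMap.ker (d k) ⧸ (coboundaries d k).submoduleOf (LinearMap.ker (d k))

instance (d : ∀ k, C k →ₗ[ℂ] C (k + 1)) (k : ℕ) : AddCommGroup (Cohomology d k) :=
  Submodule.Quotient.addCommGroup _

instance (d : ∀ k, C k →ₗ[ℂ] C (k + 1)) (k : ℕ) : Module ℂ (Cohomology d k) :=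
  Submodule.Quotient.module _

/-- The class of a cocycle. -/
def Cohomology.mk (d : ∀ k, C k →ₗ[ℂ] C (k + 1)) (k : ℕ) : LinearMap.ker (d k) →ₗ[ℂ] Cohomology d k :=
  Submodule.mkQ _

end Cohomology

section Cech

variable {m n : ℕ} {M : Type*} [TopologicalSpace M] [ChartedSpace (EuclideanSpace ℝ (Fin m)) M]
  {ι : Type*}

/-- `U` is a good cover of `M`: the nonempty finite intersections of its members are diffeomorphic
to `ℝᵐ`. -/
def IsGoodCover (m : ℕ) {M : Type*} [TopologicalSpace M]
    [ChartedSpace (EuclideanSpace ℝ (Fin m)) M] {ι : Type*} (U : ι → Opens M) : Prop :=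
  (∀ x, ∃ i, x ∈ U i) ∧
    ∀ s : Finset ι, s.Nonempty → ((s.inf U : Opens M) : Set M).Nonempty →
      Nonempty ((s.inf U : Opens M) ≃ₘ^∞⟮𝓡 m, 𝓡 m⟯ EuclideanSpace ℝ (Fin m))

variable [LinearOrder ι]

/-- The intersection `U_{α₀} ∩ ⋯ ∩ U_{α_p}`, for `α₀ < ⋯ < α_p`. -/
def inter (U : ι → Opens M) {p : ℕ} (a : Fin (p + 1) ↪o ι) : Opens M :=
  ⟨⋂ i, (U (a i) : Set M), isOpen_iInter_of_finite fun i => (U (a i)).isOpen⟩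

theorem inter_le (U : ι → Opens M) {p : ℕ} (a : Fin (p + 1) ↪o ι) (i : Fin (p + 1)) :
    inter U a ≤ U (a i) := Set.iInter_subset _ i

/-- The sequence `α₀ < ⋯ < α_{p+1}` with `αᵢ` omitted. -/
def face {p : ℕ} (a : Fin (p + 2) ↪o ι) (i : Fin (p + 2)) : Fin (p + 1) ↪o ι :=
  (Fin.succAboveOrderEmb i).trans a

theorem inter_le_face (U : ι → Opens M) {p : ℕ} (a : Fin (p + 2) ↪o ι) (i : Fin (p + 2)) :
    inter U a ≤ inter U (face a i) :=
  Set.subset_iInter fun j => Set.iInter_subset (fun k => (U (a k) : Set M)) (i.succAbove j)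

/-- The space `C^{p,q}(𝔘, 𝓕)`. On `U_{α₀ ⋯ α_p}` the trivialization is that of `U_{α_p}`. -/
def CechForm (m n : ℕ) {M : Type*} [TopologicalSpace M]
    [ChartedSpace (EuclideanSpace ℝ (Fin m)) M] {ι : Type*} [LinearOrder ι]
    (U : ι → Opens M) (p q : ℕ) : Type _ :=
  ∀ a : Fin (p + 1) ↪o ι, Form (MatAlg m n (inter U a)) q

instance (p q : ℕ) (U : ι → Opens M) : AddCommGroup (CechForm m n U p q) :=
  Pi.addCommGroup

instance (p q : ℕ) (U : ι → Opens M) : Module ℂ (CechForm m n U p q) :=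
  Pi.module _ _ _

/-- The vertical differential `d̂ : C^{p,q} → C^{p,q+1}`. -/
def dCech (m n : ℕ) {M : Type*} [TopologicalSpace M]
    [ChartedSpace (EuclideanSpace ℝ (Fin m)) M] {ι : Type*} [LinearOrder ι]
    (U : ι → Opens M) (p q : ℕ) : CechForm m n U p q →ₗ[ℂ] CechForm m n U p (q + 1) :=
  LinearMap.pi fun a => dForm _ q ∘ₗ LinearMap.proj a

/-- The total complex in degree `k`: the direct sum of the `C^{p,q}` with `p + q = k`. -/
def Tot (m n : ℕ) {M : Type*} [TopologicalSpace M]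
    [ChartedSpace (EuclideanSpace ℝ (Fin m)) M] {ι : Type*} [LinearOrder ι]
    (U : ι → Opens M) (k : ℕ) : Type _ :=
  ∀ s : {s : ℕ × ℕ // s.1 + s.2 = k}, CechForm m n U s.1.1 s.1.2

instance (k : ℕ) (U : ι → Opens M) : AddCommGroup (Tot m n U k) := Pi.addCommGroup

instance (k : ℕ) (U : ι → Opens M) : Module ℂ (Tot m n U k) := Pi.module _ _ _

/-- The component in `C^{p,q}` of an element of the total complex. -/
def Tot.comp {U : ι → Opens M} {k : ℕ} (p q : ℕ) (h : p + q = k) :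
    Tot m n U k →ₗ[ℂ] CechForm m n U p q where
  toFun c := c ⟨(p, q), h⟩
  map_add' _ _ := rfl
  map_smul' _ _ := rfl

variable [IsManifold (𝓡 m) ∞ M] [T2Space M]
  {E : M → Type*} [∀ x, NormedAddCommGroup (E x)] [∀ x, InnerProductSpace ℂ (E x)]
  [TopologicalSpace (TotalSpace (EuclideanSpace ℂ (Fin n)) E)]
  [FiberBundle (EuclideanSpace ℂ (Fin n)) E]
  [VectorBundle ℂ (EuclideanSpace ℂ (Fin n)) E]
  [VectorBundle ℝ (EuclideanSpace ℂ (Fin n)) E]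
  [ContMDiffVectorBundle ∞ (EuclideanSpace ℂ (Fin n)) E (𝓡 m)]
  {o : OrientedHermitian m n E} {U : ι → Opens M} (e : ∀ i, SUFrame o (U i))

/-- The transition function `g_{α_p α_{p+1}}` on `U_{α₀ ⋯ α_{p+1}}`. -/
def lastTransition {p : ℕ} (a : Fin (p + 2) ↪o ι) (x : inter U a) :
    Matrix.specialUnitaryGroup (Fin n) ℂ :=
  transition (e (a (Fin.last p).castSucc)) (e (a (Fin.last (p + 1))))
    (inter_le U a _) (inter_le U a _) x

theorem lastTransition_smooth {p : ℕ} (a : Fin (p + 2) ↪o ι) (i j : Fin n) :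
    ContMDiff (𝓡 m) 𝓘(ℝ, ℂ) ∞ (fun x => (lastTransition e a x).1 i j) :=
  transition_smooth _ _ _ _ i j

/-- The restriction of a form from `U_{α₀ ⋯ α̂ᵢ ⋯ α_{p+1}}` to `U_{α₀ ⋯ α_{p+1}}`. -/
def resForm (n : ℕ) {M : Type*} [TopologicalSpace M] [ChartedSpace (EuclideanSpace ℝ (Fin m)) M]
    [IsManifold (𝓡 m) ∞ M] [T2Space M] (U : ι → Opens M)
    {p : ℕ} (q : ℕ) (a : Fin (p + 2) ↪o ι) (i : Fin (p + 2)) :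
    Form (MatAlg m n (inter U (face a i))) q →ₗ[ℂ] Form (MatAlg m n (inter U a)) q :=
  formMap (A := MatAlg m n (inter U (face a i))) (B := MatAlg m n (inter U a))
    (resHom (inter_le_face U a i)) (resHom_uniqueImage _) q

/-- The restriction of a form from `U_{α₀ ⋯ α_p}` to `U_{α₀ ⋯ α_{p+1}}`, followed by the change of
trivialization by `g_{α_p α_{p+1}}`. -/
def twistForm {p : ℕ} (q : ℕ) (a : Fin (p + 2) ↪o ι) :
    Form (MatAlg m n (inter U (face a (Fin.last (p + 1))))) q →ₗ[ℂ]
      Form (MatAlg m n (inter U a)) q :=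
  formMap (A := MatAlg m n (inter U (face a (Fin.last (p + 1))))) (B := MatAlg m n (inter U a))
    ((conjHom (lastTransition e a) (lastTransition_smooth e a)).comp
    (resHom (inter_le_face U a (Fin.last (p + 1))))) (conjHom_uniqueImage _ _ _) q

/-- The twisted Čech differential `δ : C^{p,q} → C^{p+1,q}`. -/
def cechDelta (p q : ℕ) : CechForm m n U p q →ₗ[ℂ] CechForm m n U (p + 1) q where
  toFun c := fun a =>
    (∑ i : Fin (p + 1), (-1 : ℂ) ^ (i : ℕ) • resForm n U q a i.castSucc (c (face a i.castSucc)))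
    + (-1 : ℂ) ^ (p + 1) • twistForm e q a (c (face a (Fin.last (p + 1))))
  map_add' c c' := by
    funext a
    change (∑ i : Fin (p + 1), (-1 : ℂ) ^ (i : ℕ) • resForm n U q a i.castSucc
        (c (face a i.castSucc) + c' (face a i.castSucc)))
      + (-1 : ℂ) ^ (p + 1) • twistForm e q a
        (c (face a (Fin.last (p + 1))) + c' (face a (Fin.last (p + 1)))) = (_ + _) + (_ + _)
    simp only [map_add, smul_add, Finset.sum_add_distrib]
    exact add_add_add_comm _ _ _ _
  map_smul' z c := by
    funext a
    change (∑ i : Fin (p + 1), (-1 : ℂ) ^ (i : ℕ) • resForm n U q a i.castSucc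
        (z • c (face a i.castSucc)))
      + (-1 : ℂ) ^ (p + 1) • twistForm e q a (z • c (face a (Fin.last (p + 1)))) = z • (_ + _)
    simp only [map_smul, smul_add, Finset.smul_sum, smul_comm z]

/-- The differential `D = δ + (-1)^p d̂` of the total complex. -/
def totalD (k : ℕ) : Tot m n U k →ₗ[ℂ] Tot m n U (k + 1) :=
  LinearMap.pi fun s => match s with
    | ⟨(0, 0), _⟩ => 0
    | ⟨(0, q + 1), h⟩ => dCech m n U 0 q ∘ₗ Tot.comp 0 q (Nat.succ.inj h)
    | ⟨(p + 1, 0), h⟩ => cechDelta e p 0 ∘ₗ Tot.comp p 0 (Nat.succ.inj h)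
    | ⟨(p + 1, q + 1), h⟩ =>
        cechDelta e p (q + 1) ∘ₗ Tot.comp p (q + 1) (by simp only at h; omega)
        + (-1 : ℂ) ^ (p + 1) •
          (dCech m n U (p + 1) q ∘ₗ Tot.comp (p + 1) q (Nat.succ.inj h))

/-- The restriction of a form on `𝔄` to `U_{α₀}`, in the trivialization over `U_{α₀}`. -/
def locForm (q : ℕ) (a : Fin 1 ↪o ι) :
    Form (EndAlg m n E) q →ₗ[ℂ] Form (MatAlg m n (inter U a)) q :=
  formMap (A := EndAlg m n E) (B := MatAlg m n (inter U a))
    (locHom ((e (a 0)).restrict (inter_le U a 0))) (locHom_uniqueImage _) q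

/-- The restriction map `δ : Ω_Der^q(𝔄) = C^{-1,q} → C^{0,q}`. -/
def locCech (q : ℕ) : Form (EndAlg m n E) q →ₗ[ℂ] CechForm m n U 0 q :=
  LinearMap.pi fun a => locForm e q a

/-- The augmentation from `Ω_Der(𝔄)` to the total complex, with values in `C^{0,k}`. -/
def augmentation (k : ℕ) : Form (EndAlg m n E) k →ₗ[ℂ] Tot m n U k :=
  LinearMap.single ℂ (fun s : {s : ℕ × ℕ // s.1 + s.2 = k} => CechForm m n U s.1.1 s.1.2)
    ⟨(0, k), Nat.zero_add k⟩ ∘ₗ locCech e k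

end Cech

end NCDeRham

end

open NCDeRham

/-! The Čech complex in each form degree, augmented by the global forms, is exact, and a double
complex with exact augmented rows has the same cohomology as its augmentation column. The point is
that rows remain exact although the coefficients are noncommutative forms and the Čech differential
is twisted.

The twist disappears once a local form is read as a family of endomorphisms of the fibers. A
derivation of the global algebra pushes forward uniquely to a derivation of each local algebra
(`IsLocal.push`), and a form on the local algebra is determined by its values on push-forwards
(`IsLocal.form_ext`). Reading these values as endomorphisms of `E x` through the frame gives
`secOf`. Conversely every smooth family of fiber forms comes from a local form (`exists_secOf`), or
from a global one if it is smooth on all of `M` (`exists_globalForm`). Conjugation by a transition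
function only changes the frame in which the same endomorphism is written, so at each point the
twisted differential is the untwisted differential of a simplex (`cechVal_cechDelta`).

At a point, the simplex has a cone homotopy for each apex (`simplexDelta_cone_add`). Averaging these
with a subordinate partition of unity keeps smoothness and yields primitives of Čech cocycles; on
the empty simplex it glues a cocycle of degree zero to a global form.

The vertical identity `d̂² = 0` is proved by Cartan's calculus, and `d̂` commutes with the Čech
differential because Koszul's formula is natural for related derivations. The rest is homological
algebra: a total cochain whose differential has only a component in column zero can be pushed,
column by column, into column zero, which gives both surjectivity and injectivity on cohomology. -/

noncomputable section

namespace NCDeRham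

/-! ### Cartan calculus and the vanishing of the squared differential -/

section Cartan

attribute [local instance] LieRing.ofAssociativeRing

variable {A : Type*} [Ring A] [Algebra ℂ A]

theorem koszulAux_sub {q : ℕ} (w w' : Der A [⋀^Fin q]→ₗ[ℂ] A) :
    koszulAux (w - w') = koszulAux w - koszulAux w' := by
  ext X
  rw [AlternatingMap.sub_apply, koszulAux_apply, koszulAux_apply, koszulAux_apply]
  cases q <;> simp [koszul, Finset.sum_sub_distrib, smul_sub] ; abel

theorem succ_removeNth_cons {q : ℕ} {D : Type*} (y : D) (v : Fin (q + 1) → D)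
    (i : Fin (q + 1)) :
    i.succ.removeNth (Fin.cons y v : Fin (q + 2) → D) = Fin.cons y (i.removeNth v) := by
  ext1 k
  refine Fin.cases ?_ (fun k => ?_) k
  · simp [Fin.removeNth]
  · simp [Fin.removeNth, Fin.succ_succAbove_succ]

/-- Koszul's terms are sorted by the role of `x`: it acts from outside, it enters the bracket, or it
is merely an argument of `w`. The terms of the last kind are those of the formula for the
contraction by `x`, with the opposite sign. -/
theorem koszul_vecCons {q : ℕ} (w : Der A [⋀^Fin (q + 1)]→ₗ[ℂ] A) (x : Der A)
    (v : Fin (q + 1) → Der A) :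
    koszul w (Matrix.vecCons x v) = x.1 (w v)
      - ∑ j : Fin (q + 1), w (Function.update v j ⁅x, v j⁆) - koszul (w.curryLeft x) v := by
  have rem := fun i => succ_removeNth_cons x v i
  have r0 : (0 : Fin (q + 2)).removeNth (Fin.cons x v : Fin (q + 2) → Der A) = v := by
    ext1 k; simp [Fin.removeNth]
  -- Moving the bracket from the head to slot `j` costs the sign `(-1)^j` that Koszul's formula
  -- carries.
  have hup : ∀ j : Fin (q + 1), w (Function.update v j ⁅x, v j⁆) =
      (-1 : ℤ) ^ (j : ℕ) • w (Matrix.vecCons ⁅x, v j⁆ (j.removeNth v)) := by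
    intro j
    rw [← Fin.insertNth_removeNth, AlternatingMap.map_insertNth]
  have hI : Finset.Ici (0 : Fin (q + 1)) = Finset.univ := by ext; simp
  change koszul w (Fin.cons x v) = _
  have dec : koszul w (Fin.cons x v) = x.1 (w v)
        + ∑ i : Fin (q + 1), (-1 : ℤ) ^ (i.succ : ℕ) • (v i).1 (w (Fin.cons x (i.removeNth v)))
        - (∑ j : Fin (q + 1), (-1 : ℤ) ^ (j : ℕ) •
            w (Matrix.vecCons ⁅x, v j⁆ (j.removeNth v))
          + ∑ i : Fin q, ∑ j ≥ i.succ, (-1 : ℤ) ^ ((i.succ : ℕ) + j : ℕ) •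
          w (Matrix.vecCons ⁅v i.castSucc, v j⁆
            (j.removeNth (i.succ.castSucc.removeNth (Fin.cons x v : Fin (q + 2) → Der A))))) := by
    rw [koszul]
    congr 1
    · rw [Fin.sum_univ_succ]
      simp only [Fin.cons_zero, Fin.cons_succ, rem, r0, Fin.val_zero, pow_zero, one_smul]
    · rw [Fin.sum_univ_succ]
      congr 1
      simp only [Fin.cons_zero, Fin.cons_succ, Fin.castSucc_zero, hI, Fin.val_zero, zero_add, r0]
  have e1 : ∑ i : Fin (q + 1), (-1 : ℤ) ^ (i.succ : ℕ) • (v i).1 (w (Fin.cons x (i.removeNth v))) =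
      - ∑ i : Fin (q + 1), (-1 : ℤ) ^ (i : ℕ) • (v i).1 (w.curryLeft x (i.removeNth v)) := by
    rw [← Finset.sum_neg_distrib]
    refine Finset.sum_congr rfl fun i _ => ?_
    rw [Fin.val_succ, pow_succ, mul_neg_one, neg_smul]
    rfl
  rw [dec, e1]
  simp only [hup]
  cases q with
  | zero =>
    simp [koszul]
    abel
  | succ q =>
    have e2 : ∑ i : Fin (q + 1), ∑ j ≥ i.succ, (-1 : ℤ) ^ ((i.succ : ℕ) + j : ℕ) •
          w (Matrix.vecCons ⁅v i.castSucc, v j⁆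
            (j.removeNth (i.succ.castSucc.removeNth (Fin.cons x v : Fin (q + 3) → Der A)))) =
        - ∑ i : Fin (q + 1), ∑ j ≥ i, (-1 : ℤ) ^ (i + j : ℕ) •
          w.curryLeft x (Matrix.vecCons ⁅v i.castSucc, v j.succ⁆
            (j.removeNth (i.castSucc.removeNth v))) := by
      rw [← Finset.sum_neg_distrib]
      refine Finset.sum_congr rfl fun i _ => ?_
      -- The condition `j ≥ i.succ` makes `j` a successor as well. Shifting both indices preserves
      -- the parity of the exponent, so the minus sign comes only from exchanging `x` with the
      -- bracket.
      rw [← Finset.sum_neg_distrib, ← Fin.map_succEmb_Ici, Finset.sum_map]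
      refine Finset.sum_congr rfl fun j _ => ?_
      have h1 : j.succ.removeNth (i.succ.castSucc.removeNth
          (Fin.cons x v : Fin (q + 3) → Der A)) =
          Fin.cons x (j.removeNth (i.castSucc.removeNth v)) := by
        rw [← Fin.succ_castSucc, succ_removeNth_cons, succ_removeNth_cons]
      have h2 : w (Matrix.vecCons ⁅v i.castSucc, v j.succ⁆
          (Fin.cons x (j.removeNth (i.castSucc.removeNth v)))) =
          - w (Matrix.vecCons x (Matrix.vecCons ⁅v i.castSucc, v j.succ⁆
            (j.removeNth (i.castSucc.removeNth v)))) := by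
        rw [← w.map_swap _ (zero_ne_one (α := Fin (q + 2)))]
        congr 1
        ext1 k
        refine Fin.cases ?_ (fun k => Fin.cases ?_ (fun k => ?_) k) k
        · simp
        · simp
        · rw [Function.comp_apply, Equiv.swap_apply_of_ne_of_ne]
          · rfl
          · simp
          · exact fun h => Fin.succ_ne_zero k (Fin.succ_injective _ h)
      rw [Fin.coe_succEmb, h1, h2, smul_neg, AlternatingMap.curryLeft_apply_apply, Fin.val_succ,
        Fin.val_succ]
      congr 2
      ring
    rw [e2, koszul]
    abel

/-- The Lie derivative along a derivation, defined by Cartan's formula. -/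
def lieDer (x : Der A) : {q : ℕ} → (Der A [⋀^Fin q]→ₗ[ℂ] A) → (Der A [⋀^Fin q]→ₗ[ℂ] A)
  | 0, w => (koszulAux w).curryLeft x
  | _ + 1, w => (koszulAux w).curryLeft x + koszulAux (w.curryLeft x)

theorem curryLeft_koszulAux {q : ℕ} (x : Der A) (w : Der A [⋀^Fin (q + 1)]→ₗ[ℂ] A) :
    (koszulAux w).curryLeft x = lieDer x w - koszulAux (w.curryLeft x) := by
  rw [lieDer, add_sub_cancel_right]

theorem lieDer_apply (x : Der A) : {q : ℕ} → (w : Der A [⋀^Fin q]→ₗ[ℂ] A) → (v : Fin q → Der A) →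
    lieDer x w v = x.1 (w v) - ∑ j, w (Function.update v j ⁅x, v j⁆)
  | 0, w, v => by
    rw [lieDer, AlternatingMap.curryLeft_apply_apply, koszulAux_apply]
    simp only [koszul, Finset.univ_unique, Finset.sum_singleton]
    rw [Subsingleton.elim (Fin.removeNth _ _) v]
    simp
  | q + 1, w, v => by
    rw [lieDer, AlternatingMap.add_apply, AlternatingMap.curryLeft_apply_apply, koszulAux_apply,
      koszulAux_apply, koszul_vecCons]
    abel

theorem lieDer_sub (x : Der A) {q : ℕ} (w w' : Der A [⋀^Fin q]→ₗ[ℂ] A) :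
    lieDer x (w - w') = lieDer x w - lieDer x w' := by
  ext v
  simp only [lieDer_apply, AlternatingMap.sub_apply, map_sub, Finset.sum_sub_distrib]
  abel

/-- The correction is the summand for slot zero in `lieDer_apply`. With `ext_curryLeft` this rule
drives the inductions on degree below: an identity is contracted with a derivation and so reduced to
lower degree. -/
theorem curryLeft_lieDer (x y : Der A) {q : ℕ} (w : Der A [⋀^Fin (q + 1)]→ₗ[ℂ] A) :
    (lieDer x w).curryLeft y = lieDer x (w.curryLeft y) - w.curryLeft ⁅x, y⁆ := by
  ext v
  rw [AlternatingMap.curryLeft_apply_apply, AlternatingMap.sub_apply, lieDer_apply, lieDer_apply,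
    Fin.sum_univ_succ]
  have h0 : Function.update (Matrix.vecCons y v) 0 ⁅x, Matrix.vecCons y v 0⁆ =
      Matrix.vecCons ⁅x, y⁆ v := Fin.update_cons_zero _ _ _
  have hs : ∀ j : Fin q, Function.update (Matrix.vecCons y v) j.succ ⁅x, Matrix.vecCons y v j.succ⁆ =
      Matrix.vecCons y (Function.update v j ⁅x, v j⁆) := fun j => (Fin.cons_update _ _ _ _).symm
  simp only [h0, hs, AlternatingMap.curryLeft_apply_apply]
  abel

theorem ext_curryLeft {q : ℕ} {w w' : Der A [⋀^Fin (q + 1)]→ₗ[ℂ] A}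
    (h : ∀ x, w.curryLeft x = w'.curryLeft x) : w = w' := by
  ext v
  have := congrArg (fun f => f (Fin.tail v)) (h (v 0))
  simp only [AlternatingMap.curryLeft_apply_apply] at this
  rwa [show Matrix.vecCons (v 0) (Fin.tail v) = v from Fin.cons_self_tail v] at this

theorem curryLeft_sub' {q : ℕ} (w w' : Der A [⋀^Fin (q + 1)]→ₗ[ℂ] A) (x : Der A) :
    (w - w').curryLeft x = w.curryLeft x - w'.curryLeft x := rfl

/-- In degree zero this is the definition of the commutator. In higher degree, contraction with `z`
leaves the induction hypothesis and contractions by iterated brackets, which cancel by the Jacobi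
identity. -/
theorem lieDer_lie (x y : Der A) {q : ℕ} (w : Der A [⋀^Fin q]→ₗ[ℂ] A) :
    lieDer ⁅x, y⁆ w = lieDer x (lieDer y w) - lieDer y (lieDer x w) := by
  induction q with
  | zero =>
    ext v
    simp [lieDer_apply]
  | succ q ih =>
    refine ext_curryLeft fun z => ?_
    simp only [curryLeft_sub', curryLeft_lieDer, ih, lieDer_sub]
    rw [lie_lie, map_sub]
    abel

/-- Write `i`, `L` and `d` for contraction, Lie derivative and differential. After contraction with
`y`, Cartan's formula replaces `i_y d` by `L_y - d i_y`; the products of Lie derivatives combine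
through `lieDer_lie`, and the terms `d L_x i_y` and `L_x d i_y` agree by induction. -/
theorem koszulAux_lieDer (x : Der A) {q : ℕ} (w : Der A [⋀^Fin q]→ₗ[ℂ] A) :
    koszulAux (lieDer x w) = lieDer x (koszulAux w) := by
  induction q with
  | zero =>
    refine ext_curryLeft fun y => ?_
    rw [curryLeft_lieDer]
    change lieDer y (lieDer x w) = lieDer x (lieDer y w) - lieDer ⁅x, y⁆ w
    rw [lieDer_lie, sub_sub_cancel]
  | succ q ih =>
    refine ext_curryLeft fun y => ?_
    simp only [curryLeft_lieDer, curryLeft_koszulAux, lieDer_sub, koszulAux_sub, ih, lieDer_lie]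
    abel

/-- By Cartan's formula `i_x d d = L_x d - d L_x + d d i_x`. The first two terms cancel by
`koszulAux_lieDer`, and the last one vanishes by induction, or is absent in degree zero. -/
theorem koszulAux_koszulAux {q : ℕ} (w : Der A [⋀^Fin q]→ₗ[ℂ] A) :
    koszulAux (koszulAux w) = 0 := by
  induction q with
  | zero =>
    refine ext_curryLeft fun x => ?_
    rw [curryLeft_koszulAux, ← koszulAux_lieDer, lieDer, sub_self]
    rfl
  | succ q ih =>
    refine ext_curryLeft fun x => ?_
    rw [curryLeft_koszulAux, curryLeft_koszulAux, koszulAux_sub, ih, ← koszulAux_lieDer, sub_zero,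
      sub_self]
    rfl

theorem dForm_val {q : ℕ} (w : Form A q) : (dForm A q w).1 = koszulAux w.1 :=
  AlternatingMap.ext fun X => by rw [dForm_apply, koszulAux_apply]

theorem dForm_dForm {q : ℕ} (w : Form A q) : dForm A (q + 1) (dForm A q w) = 0 :=
  Subtype.ext (by rw [dForm_val, dForm_val, koszulAux_koszulAux]; rfl)

end Cartan

end NCDeRham

end

noncomputable section

namespace NCDeRham

/-! ### Related derivations, and transport of derivations and forms along a localization -/

section Push

attribute [local instance] LieRing.ofAssociativeRing

variable {A : Type*} [Ring A] [Algebra ℂ A] {B : Type*} [Ring B] [Algebra ℂ B]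

namespace ShortcutInstances

scoped instance : AddCommMonoid (Der A) := AddCommGroup.toAddCommMonoid

scoped instance : SMul ℂ (Der A) := Module.toDistribMulAction.toSMul

end ShortcutInstances

open scoped ShortcutInstances

theorem Form.ext_apply {q : ℕ} {w w' : Form A q} (h : ∀ X, w.1 X = w'.1 X) : w = w' :=
  Subtype.ext (AlternatingMap.ext h)

theorem DerRelated.add {r : A →ₐ[ℂ] B} {X X' : Der A} {Y Y' : Der B} (h : DerRelated r X Y)
    (h' : DerRelated r X' Y') : DerRelated r (X + X') (Y + Y') := fun a => by
  change r (X.1 a + X'.1 a) = Y.1 (r a) + Y'.1 (r a)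
  rw [map_add, h a, h' a]

theorem DerRelated.smul {r : A →ₐ[ℂ] B} {X : Der A} {Y : Der B} (h : DerRelated r X Y) (c : ℂ) :
    DerRelated r (c • X) (c • Y) := fun a => by
  change r (c • X.1 a) = c • Y.1 (r a)
  rw [map_smul, h a]

theorem DerRelated.center_smul {r : A →ₐ[ℂ] B} {X : Der A} {Y : Der B} (h : DerRelated r X Y)
    (z : Subalgebra.center ℂ A) (z' : Subalgebra.center ℂ B) (hz : r z = z') :
    DerRelated r (z • X) (z' • Y) := fun a => by
  rw [Der.smul_apply, Der.smul_apply, map_mul, h a, hz]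

theorem DerRelated.lie {r : A →ₐ[ℂ] B} {X X' : Der A} {Y Y' : Der B} (h : DerRelated r X Y)
    (h' : DerRelated r X' Y') : DerRelated r ⁅X, X'⁆ ⁅Y, Y'⁆ := fun a => by
  change r (X.1 (X'.1 a) - X'.1 (X.1 a)) = Y.1 (Y'.1 (r a)) - Y'.1 (Y.1 (r a))
  rw [map_sub, h, h', h', h]

theorem DerRelated.comp {C : Type*} [Ring C] [Algebra ℂ C] {r : A →ₐ[ℂ] B} {s : B →ₐ[ℂ] C}
    {X : Der A} {Y : Der B} {Z : Der C} (h : DerRelated r X Y) (h' : DerRelated s Y Z) :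
    DerRelated (s.comp r) X Z := fun a => by
  rw [AlgHom.comp_apply, AlgHom.comp_apply, h a, h']

/-- Brackets of related derivations are related, so Koszul's formula corresponds term by term. By
uniqueness of images this makes the differential commute with `formMap`. -/
theorem formRelated_koszul {r : A →ₐ[ℂ] B} : {q : ℕ} → {w : Form A q} → {η : Form B q} →
    FormRelated r w η → FormRelated r (dForm A q w) (dForm B q η)
  | 0, w, η, h, X, Y, hXY => by
    simp only [dForm_apply, koszul, map_sum, map_zsmul]
    refine Finset.sum_congr rfl fun i _ => ?_
    rw [hXY i, h (i.removeNth X) (i.removeNth Y) (fun j => hXY _)]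
  | q + 1, w, η, h, X, Y, hXY => by
    simp only [dForm_apply, koszul, map_sub, map_sum, map_zsmul]
    congr 1
    · refine Finset.sum_congr rfl fun i _ => ?_
      rw [hXY i, h (i.removeNth X) (i.removeNth Y) (fun j => hXY _)]
    · refine Finset.sum_congr rfl fun i _ => Finset.sum_congr rfl fun j _ => ?_
      rw [h]
      refine Fin.cases ?_ fun k => ?_
      · exact (hXY _).lie (hXY _)
      · exact hXY _

theorem formMap_eq {r : A →ₐ[ℂ] B} (h : UniqueImage r) {q : ℕ} {w : Form A q} {η : Form B q}
    (hw : FormRelated r w η) : formMap r h q w = η :=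
  ((h q w).choose_spec.2 _ hw).symm

theorem formMap_dForm {r : A →ₐ[ℂ] B} (h : UniqueImage r) {q : ℕ} (w : Form A q) :
    formMap r h (q + 1) (dForm A q w) = dForm B q (formMap r h q w) :=
  formMap_eq h (formRelated_koszul (formMap_related r h w))

variable {V R : Type*} [TopologicalSpace V] [Ring R] [Algebra ℂ R] {S : Subalgebra ℂ (V → R)}

/-- `r : A → S` exhibits the algebra `S` of functions on a space, closed under local gluing, as a
localization of `A`: each point of the space has a bump function in `A`. -/
structure IsLocal (r : A →ₐ[ℂ] S) : Prop where
  glue : ∀ f : V → R, (∀ y, ∃ b ∈ S, f =ᶠ[nhds y] b) → f ∈ S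
  bump : ∀ y : V, ∃ χ, BumpLike r χ ∧ (r χ).1 =ᶠ[nhds y] 1

theorem eval_mul {V R : Type*} [Ring R] [Algebra ℂ R] {S : Subalgebra ℂ (V → R)} (a b : S) (p : V) :
    (a * b).1 p = a.1 p * b.1 p := rfl

theorem eval_add {V R : Type*} [Ring R] [Algebra ℂ R] {S : Subalgebra ℂ (V → R)} (a b : S) (p : V) :
    (a + b).1 p = a.1 p + b.1 p := rfl

theorem eval_sub {V R : Type*} [Ring R] [Algebra ℂ R] {S : Subalgebra ℂ (V → R)} (a b : S) (p : V) :
    (a - b).1 p = a.1 p - b.1 p := rfl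

namespace BumpLike

theorem eval_ext {r : A →ₐ[ℂ] S} {χ : A} (hχ : BumpLike r χ) {p : V} (h : (r χ).1 p = 1) (b : S) :
    (r (hχ.ext b)).1 p = b.1 p := by
  rw [hχ.map_ext, eval_mul, eval_mul, h, one_mul, one_mul]

/-- The push-forward of a derivation, near the points where the bump function is one. -/
def pushAux {r : A →ₐ[ℂ] S} {χ : A} (hχ : BumpLike r χ) (X : Der A) (b : S) : S :=
  r (X.1 (hχ.ext b)) - (r (X.1 χ) * b + r (X.1 χ) * b)

/-- Since `hχ.ext b` stands for `χ² b`, Leibniz suggests that `X` maps it to `χ² X b + 2 χ (X χ) b`.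
Subtracting `2 (X χ) b` thus isolates `X b` wherever `χ` is one, with no appeal to locality of `X`.
Independence of `χ` follows by applying `X` to `ext_compare`. -/
theorem pushAux_compare {r : A →ₐ[ℂ] S} {χ χ' : A} (hχ : BumpLike r χ) (hχ' : BumpLike r χ')
    {p : V} (h : (r χ).1 p = 1) (h' : (r χ').1 p = 1) (X : Der A) (b : S) :
    (hχ.pushAux X b).1 p = (hχ'.pushAux X b).1 p := by
  have e := congrArg (fun a => (r (X.1 a)).1 p) (hχ.ext_compare hχ' b)
  simp only [Der.leibniz, map_add, map_mul, eval_add, eval_mul, h, h', eval_ext, one_mul,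
    mul_one] at e
  simp only [pushAux, eval_sub, eval_add, eval_mul]
  rw [sub_eq_sub_iff_add_eq_add, add_comm, ← add_mul, e, ← add_mul, add_comm]

/-- Both sides stand for `χ⁴ b b'`, because `r χ` is central; no centrality of `b` is involved. -/
theorem ext_mul' {r : A →ₐ[ℂ] B} {χ : A} (hχ : BumpLike r χ) (b b' : B) :
    χ * χ * hχ.ext (b * b') = hχ.ext b * hχ.ext b' := by
  obtain ⟨a, ha⟩ := hχ.exists_ext b'
  obtain ⟨c, hc⟩ := hχ.exists_ext b
  obtain ⟨d, hd⟩ := hχ.exists_ext (b * b')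
  rw [hχ.ext_eq ha, hχ.ext_eq hc, hχ.ext_eq hd, ← sub_eq_zero, mul_assoc, mul_assoc, ← mul_sub]
  apply hχ.mul_eq_zero
  simp only [map_sub, map_mul, ha, hc, hd]
  rw [sub_eq_zero, mul_assoc (r χ) b, ← mul_assoc b (r χ), ← hχ.mapComm b]
  simp only [mul_assoc]
  rw [← mul_assoc b (r χ), ← hχ.mapComm b, mul_assoc]

/-- At `p` the element `b` has the same value as the image of `hχ.ext b`, an element of `A`, with
which `z` commutes. -/
theorem eval_comm {r : A →ₐ[ℂ] S} {χ : A} (hχ : BumpLike r χ) {p : V} (h : (r χ).1 p = 1)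
    (z : Subalgebra.center ℂ A) (b : S) : (r z).1 p * b.1 p = b.1 p * (r z).1 p := by
  rw [← hχ.eval_ext h b, ← eval_mul, ← eval_mul, ← map_mul, ← map_mul,
    Subalgebra.mem_center_iff.mp z.2]

theorem pushAux_mul {r : A →ₐ[ℂ] S} {χ : A} (hχ : BumpLike r χ) {p : V} (h : (r χ).1 p = 1)
    (X : Der A) (b b' : S) : (hχ.pushAux X (b * b')).1 p =
      (hχ.pushAux X b).1 p * b'.1 p + b.1 p * (hχ.pushAux X b').1 p := by
  have e := congrArg (fun a => (r (X.1 a)).1 p) (hχ.ext_mul' b b')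
  simp only [Der.leibniz, map_add, map_mul, eval_add, eval_mul, h, hχ.eval_ext h, one_mul,
    mul_one] at e
  simp only [pushAux, eval_sub, eval_add, eval_mul]
  have e' := eq_sub_of_add_eq' e
  -- The derivative of the central element `χ` is central, so the correction term may be moved past
  -- `b`.
  have hc := hχ.eval_comm h ⟨_, Der.apply_mem_center X ⟨χ, hχ.mem_center⟩⟩ b
  dsimp only at hc
  rw [e', sub_mul, mul_sub, mul_add (b.1 p), ← mul_assoc (b.1 p), ← hc]
  noncomm_ring

theorem pushAux_map {r : A →ₐ[ℂ] S} {χ : A} (hχ : BumpLike r χ) {p : V} (h : (r χ).1 p = 1)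
    (X : Der A) (a : A) : (hχ.pushAux X (r a)).1 p = (r (X.1 a)).1 p := by
  simp only [pushAux, hχ.ext_map, Der.leibniz, map_add, map_mul, eval_sub, eval_add, eval_mul, h]
  noncomm_ring

end BumpLike

namespace IsLocal

variable {r : A →ₐ[ℂ] S} (h : IsLocal r)

/-- A bump function at a point. -/
def χ (p : V) : A := (h.bump p).choose

theorem bumpLike (p : V) : BumpLike r (h.χ p) := (h.bump p).choose_spec.1

theorem eventually_eq_one (p : V) : (r (h.χ p)).1 =ᶠ[nhds p] 1 := (h.bump p).choose_spec.2

theorem eval_one (p : V) : (r (h.χ p)).1 p = 1 := (h.eventually_eq_one p).eq_of_nhds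

/-- The push-forward of a derivation. -/
def push (X : Der A) : Der S := ⟨{
    toFun := fun b => ⟨fun p => ((h.bumpLike p).pushAux X b).1 p, by
      -- Each point uses its own bump function, but near `p` the one chosen at `p` computes the same
      -- values, so the result lies locally in `S`.
      refine h.glue _ fun p => ⟨_, ((h.bumpLike p).pushAux X b).2, ?_⟩
      filter_upwards [h.eventually_eq_one p] with p' hp'
      exact BumpLike.pushAux_compare _ _ (h.eval_one p') hp' X b⟩
    map_add' := fun b b' => Subtype.ext <| funext fun p => by
      change _ = ((h.bumpLike p).pushAux X b + (h.bumpLike p).pushAux X b').1 p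
      simp only [BumpLike.pushAux, BumpLike.ext_add, map_add, mul_add]
      abel_nf
    map_smul' := fun c b => Subtype.ext <| funext fun p => by
      change _ = (c • (h.bumpLike p).pushAux X b).1 p
      simp only [BumpLike.pushAux, BumpLike.ext_smul, map_smul, mul_smul_comm, smul_sub, smul_add] },
  fun b b' => Subtype.ext <| funext fun p =>
    (h.bumpLike p).pushAux_mul (h.eval_one p) X b b'⟩

theorem push_related (X : Der A) : DerRelated r X (h.push X) := fun a =>
  Subtype.ext <| funext fun p => ((h.bumpLike p).pushAux_map (h.eval_one p) X a).symm

/-- Expanding `Z (r χ * r χ * b)` by Leibniz in `S` and evaluating at `p`, where `χ` is one,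
expresses `Z b` through values of `Z` on the image of `r`. Those are prescribed by `X`. -/
theorem eq_of_related {r : A →ₐ[ℂ] S} (h : IsLocal r) {X : Der A} {Y Y' : Der S} (hY : DerRelated r X Y) (hY' : DerRelated r X Y') :
    Y = Y' := by
  refine Subtype.ext <| LinearMap.ext fun b => Subtype.ext <| funext fun p => ?_
  have key : ∀ Z : Der S, DerRelated r X Z → (Z.1 b).1 p = (r (X.1 ((h.bumpLike p).ext b))).1 p
      - ((r (X.1 (h.χ p))).1 p * b.1 p + (r (X.1 (h.χ p))).1 p * b.1 p) := by
    intro Z hZ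
    have e1 := hZ ((h.bumpLike p).ext b)
    rw [BumpLike.map_ext, Der.leibniz, Der.leibniz] at e1
    have e2 := congrArg (fun a : S => a.1 p) e1
    simp only [eval_add, eval_mul, h.eval_one, ← hZ (h.χ p), one_mul, mul_one] at e2
    rw [e2, add_mul]
    abel
  rw [key Y hY, key Y' hY']

theorem push_eq {X : Der A} {Y : Der S} (hY : DerRelated r X Y) : h.push X = Y :=
  h.eq_of_related (h.push_related X) hY

theorem map_mem_center {r : A →ₐ[ℂ] S} (h : IsLocal r) (z : Subalgebra.center ℂ A) : r z ∈ Subalgebra.center ℂ S := by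
  rw [Subalgebra.mem_center_iff]
  intro b
  exact Subtype.ext <| funext fun p => ((h.bumpLike p).eval_comm (h.eval_one p) z b).symm

theorem push_add (X X' : Der A) : h.push (X + X') = h.push X + h.push X' :=
  h.push_eq ((h.push_related X).add (h.push_related X'))

theorem push_smul (c : ℂ) (X : Der A) : h.push (c • X) = c • h.push X :=
  h.push_eq ((h.push_related X).smul c)

theorem push_center_smul (z : Subalgebra.center ℂ A) (X : Der A) :
    h.push (z • X) = (⟨r z, h.map_mem_center z⟩ : Subalgebra.center ℂ S) • h.push X :=
  h.push_eq ((h.push_related X).center_smul z _ rfl)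

theorem push_lift (p : V) (Y : Der S) : h.push ((h.bumpLike p).lift Y) =
    (⟨r (h.χ p) * r (h.χ p), (h.bumpLike p).map_sq_mem_center⟩ : Subalgebra.center ℂ S) • Y :=
  h.push_eq ((h.bumpLike p).lift_related Y)

/-- The push-forward of derivations as a linear map. -/
def pushLM : Der A →ₗ[ℂ] Der S where
  toFun := h.push
  map_add' := h.push_add
  map_smul' := h.push_smul

theorem formRelated_iff {q : ℕ} {w : Form A q} {η : Form S q} :
    FormRelated r w η ↔ ∀ X : Fin q → Der A, r (w.1 X) = η.1 fun i => h.push (X i) := by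
  refine ⟨fun H X => H X _ fun i => h.push_related _, fun H X Y hXY => ?_⟩
  rw [H X]
  congr 1
  exact funext fun i => h.push_eq (hXY i)

theorem formMap_push (h' : UniqueImage r) {q : ℕ} (w : Form A q) (X : Fin q → Der A) :
    (formMap r h' q w).1 (fun i => h.push (X i)) = r (w.1 X) :=
  (h.formRelated_iff.mp (formMap_related r h' w) X).symm

/-- An arbitrary derivation of `S`, multiplied by the square of the bump function at `p`, is a
push-forward. The factors come out by central linearity and have value one at `p`. -/
theorem form_ext {q : ℕ} {η η' : Form S q}
    (H : ∀ X : Fin q → Der A, (η.1 fun i => h.push (X i)) = η'.1 fun i => h.push (X i)) :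
    η = η' := by
  refine Subtype.ext <| AlternatingMap.ext fun Y => Subtype.ext <| funext fun p => ?_
  have e := congrArg (fun b : S => b.1 p) (H fun i => (h.bumpLike p).lift (Y i))
  simp only [push_lift, Form.map_smul_univ] at e
  rw [eval_mul, eval_mul] at e
  have h1 : (((r (h.χ p) * r (h.χ p)) ^ q : S)).1 p = 1 := by
    change ((r (h.χ p)).1 p * (r (h.χ p)).1 p) ^ q = 1
    rw [h.eval_one, one_mul, one_pow]
  rwa [h1, one_mul, one_mul] at e

/-- Existence to match `form_ext`. The value at `p` is `Φ` on the lifts of the arguments by the bump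
function at `p`; comparing lifts shows that nearby points may share a bump function, so the values
glue to an element of `S`. -/
theorem exists_form {q : ℕ} (Φ : Der A [⋀^Fin q]→ₗ[ℂ] S)
    (hΦ : ∀ (z : Subalgebra.center ℂ A) (X : Fin q → Der A) (i : Fin q),
      Φ (Function.update X i (z • X i)) = r z * Φ X) :
    ∃ η : Form S q, ∀ X : Fin q → Der A, (η.1 fun i => h.push (X i)) = Φ X := by
  have hpow : ∀ (z : Subalgebra.center ℂ A) (X : Fin q → Der A),
      Φ (fun i => z • X i) = r z ^ q * Φ X := by
    intro z X
    have H : ∀ s : Finset (Fin q), Φ (s.piecewise (fun i => z • X i) X) = r z ^ s.card * Φ X := by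
      intro s
      induction s using Finset.induction_on with
      | empty => simp
      | insert i s hi ih =>
        rw [Finset.piecewise_insert, Finset.card_insert_of_notMem hi, pow_succ', mul_assoc, ← ih,
          ← hΦ z _ i, Finset.piecewise_eq_of_notMem _ _ _ hi]
    have := H Finset.univ
    rwa [Finset.piecewise_univ, Finset.card_univ, Fintype.card_fin] at this
  have epow : ∀ (a : S) (k : ℕ) (p : V), (a ^ k).1 p = a.1 p ^ k := fun a k p => rfl
  have hone := h.eval_one
  have hcomp : ∀ (y y' : V), (r (h.χ y)).1 y' = 1 → ∀ Y : Fin q → Der S,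
      (Φ fun i => (h.bumpLike y).lift (Y i)).1 y' =
        (Φ fun i => (h.bumpLike y').lift (Y i)).1 y' := by
    intro y y' hy Y
    have e := congrArg (fun X => (Φ X).1 y') (funext fun i =>
      (h.bumpLike y).lift_compare (h.bumpLike y') (Y i))
    simp only [hpow, map_mul, eval_mul, epow, hone, hy, one_mul, one_pow] at e
    exact e
  let F : (Fin q → Der S) → S := fun Y => ⟨fun y => (Φ fun i => (h.bumpLike y).lift (Y i)).1 y, by
    refine h.glue _ fun y => ⟨_, (Φ fun i => (h.bumpLike y).lift (Y i)).2, ?_⟩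
    filter_upwards [h.eventually_eq_one y] with y' hy'
    exact (hcomp y y' hy' Y).symm⟩
  let η : Form S q := ⟨{
      toFun := F
      map_update_add' := by
        intro inst Y i x y
        refine Subtype.ext <| funext fun p => ?_
        have := Φ.map_update_add (fun k => (h.bumpLike p).lift (Y k)) i ((h.bumpLike p).lift x)
          ((h.bumpLike p).lift y)
        rw [← BumpLike.lift_add, ← BumpLike.lift_update, ← BumpLike.lift_update,
          ← BumpLike.lift_update] at this
        exact (congrArg (fun X : S => X.1 p) this :)
      map_update_smul' := by
        intro inst Y i c x
        refine Subtype.ext <| funext fun p => ?_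
        have := Φ.map_update_smul (fun k => (h.bumpLike p).lift (Y k)) i c ((h.bumpLike p).lift x)
        rw [← BumpLike.lift_smul, ← BumpLike.lift_update, ← BumpLike.lift_update] at this
        exact (congrArg (fun X : S => X.1 p) this :)
      map_eq_zero_of_eq' := by
        intro Y i j hij hne
        refine Subtype.ext <| funext fun p => ?_
        change (Φ fun i => (h.bumpLike p).lift (Y i)).1 p = 0
        rw [Φ.map_eq_zero_of_eq (fun i => (h.bumpLike p).lift (Y i)) (by simp only [hij]) hne]
        rfl }, by
    intro z Y i
    refine Subtype.ext <| funext fun p => ?_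
    change (Φ fun k => (h.bumpLike p).lift (Function.update Y i (z • Y i) k)).1 p =
      z.1.1 p * (Φ fun k => (h.bumpLike p).lift (Y k)).1 p
    -- The lift of `z • Y i` times `χ²` is the lift of `Y i` times the extension of `z`. Both
    -- multipliers are central in `A`, with values `1` and `z` at `p`.
    have e1 := hΦ ⟨h.χ p * h.χ p, (h.bumpLike p).sq_mem_center⟩
      (Function.update (fun k => (h.bumpLike p).lift (Y k)) i ((h.bumpLike p).lift (z • Y i))) i
    have e2 := hΦ ⟨(h.bumpLike p).ext z, (h.bumpLike p).ext_mem_center z⟩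
      (fun k => (h.bumpLike p).lift (Y k)) i
    rw [Function.update_self, Function.update_idem, BumpLike.lift_center_smul, e2,
      ← BumpLike.lift_update] at e1
    have e := congrArg (fun X : S => X.1 p) e1
    simp only [map_mul, BumpLike.map_ext, eval_mul, hone, one_mul] at e
    exact e.symm⟩
  refine ⟨η, fun X => Subtype.ext <| funext fun p => ?_⟩
  change (Φ fun i => (h.bumpLike p).lift (h.push (X i))).1 p = _
  have e : (fun i => (h.bumpLike p).lift (h.push (X i))) =
      fun i => (⟨h.χ p * h.χ p, (h.bumpLike p).sq_mem_center⟩ : Subalgebra.center ℂ A) • X i :=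
    funext fun i => (h.bumpLike p).lift_of_related (h.push_related _)
  rw [e, hpow, eval_mul, epow]
  simp only [map_mul, eval_mul, hone, one_mul, one_pow]

/-- The alternating map on derivations of `A` which corresponds to a form on `S`. -/
def pull {q : ℕ} (η : Form S q) : Der A [⋀^Fin q]→ₗ[ℂ] S := η.1.compLinearMap h.pushLM

theorem pull_apply {q : ℕ} (η : Form S q) (X : Fin q → Der A) :
    h.pull η X = η.1 fun i => h.push (X i) := rfl

theorem pull_center_smul {q : ℕ} (η : Form S q) (z : Subalgebra.center ℂ A) (X : Fin q → Der A)
    (i : Fin q) : h.pull η (Function.update X i (z • X i)) = r z * h.pull η X := by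
  have := Form.map_smul η ⟨r z, h.map_mem_center z⟩ (fun i => h.push (X i)) i
  rw [← push_center_smul] at this
  rw [pull_apply, pull_apply, ← this]
  congr 1
  funext k
  by_cases hk : k = i
  · subst hk; simp
  · simp [hk]

/-- Uniqueness of push-forwards makes them functorial, so both sides evaluate the same form on the
same derivations. -/
theorem pull_formMap {V' R' : Type*} [TopologicalSpace V'] [Ring R'] [Algebra ℂ R']
    {S' : Subalgebra ℂ (V' → R')} {r' : A →ₐ[ℂ] S'} (h' : IsLocal r') {s : S →ₐ[ℂ] S'}
    (hs : IsLocal s) (hc : s.comp r = r') (u : UniqueImage s) {q : ℕ} (η : Form S q)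
    (X : Fin q → Der A) : h'.pull (formMap s u q η) X = s (h.pull η X) := by
  have e : ∀ x, h'.push x = hs.push (h.push x) := fun x =>
    h'.push_eq (hc ▸ (h.push_related x).comp (hs.push_related _))
  rw [pull_apply, pull_apply, ← hs.formMap_push u]
  simp only [e]

end IsLocal

end Push

end NCDeRham

end

noncomputable section

namespace NCDeRham

/-! ### The augmented cochain complex of a full simplex and its cone homotopies -/

section Simplex

variable {ι : Type*} [LinearOrder ι] {G : Type*} [AddCommGroup G] [Module ℂ G]

/-- The number of elements of `s` below `j`. -/
def rankIn (s : Finset ι) (j : ι) : ℕ := (s.filter (· < j)).card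

theorem rankIn_insert_of_lt {s : Finset ι} {i j : ι} (hi : i ∉ s) (h : i < j) :
    rankIn (insert i s) j = rankIn s j + 1 := by
  rw [rankIn, rankIn, Finset.filter_insert, if_pos h, Finset.card_insert_of_notMem]
  simp [hi]

theorem rankIn_insert_of_le {s : Finset ι} {i j : ι} (h : j ≤ i) :
    rankIn (insert i s) j = rankIn s j := by
  rw [rankIn, rankIn, Finset.filter_insert, if_neg h.not_gt]

/-- The Čech differential on the full simplex, for cochains indexed by finite sets of vertices. -/
def simplexDelta (f : Finset ι → G) (s : Finset ι) : G :=
  ∑ j ∈ s, (-1 : ℂ) ^ rankIn s j • f (s.erase j)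

/-- The cone homotopy with apex `i`. -/
def cone (i : ι) (f : Finset ι → G) (s : Finset ι) : G :=
  if i ∈ s then 0 else (-1 : ℂ) ^ rankIn s i • f (insert i s)

theorem neg_one_pow_smul_self (k : ℕ) (x : G) : (-1 : ℂ) ^ k • (-1 : ℂ) ^ k • x = x := by
  rw [smul_smul, ← mul_pow]
  simp

/-- Inserting a vertex raises the rank of the larger one only, so exactly one of the two exponents
grows by one. -/
theorem rankIn_swap {s : Finset ι} {i j : ι} (hi : i ∉ s) (hj : j ∉ s) (hij : i ≠ j) :
    (-1 : ℂ) ^ (rankIn s i + rankIn (insert i s) j) =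
      -(-1 : ℂ) ^ (rankIn s j + rankIn (insert j s) i) := by
  rcases lt_or_gt_of_ne hij with h | h
  · rw [rankIn_insert_of_lt hi h, rankIn_insert_of_le h.le, ← add_assoc, pow_succ, add_comm]
    ring
  · rw [rankIn_insert_of_lt hj h, rankIn_insert_of_le h.le, ← add_assoc, pow_succ, add_comm]
    ring

/-- If `i` belongs to `s`, removing any other vertex leaves `i` in place, so only the summand at `i`
survives. Otherwise that summand of `simplexDelta f` on `insert i s` gives `f s`, and the remaining
ones cancel in pairs. The empty set is allowed, which accounts for the augmentation. -/
theorem simplexDelta_cone_add (i : ι) (f : Finset ι → G) (s : Finset ι) :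
    simplexDelta (cone i f) s + cone i (simplexDelta f) s = f s := by
  by_cases hi : i ∈ s
  · rw [cone, if_pos hi, add_zero, simplexDelta, Finset.sum_eq_single_of_mem i hi]
    · have h1 : rankIn (s.erase i) i = rankIn s i := by
        conv_rhs => rw [← Finset.insert_erase hi, rankIn_insert_of_le le_rfl]
      rw [cone, if_neg (Finset.notMem_erase i s), h1, Finset.insert_erase hi,
        neg_one_pow_smul_self]
    · intro j _ hj
      rw [cone, if_pos (Finset.mem_erase.mpr ⟨hj.symm, hi⟩), smul_zero]
  · rw [cone, if_neg hi, simplexDelta, simplexDelta, Finset.sum_insert hi, Finset.erase_insert hi,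
      rankIn_insert_of_le le_rfl, smul_add, neg_one_pow_smul_self, add_comm, add_assoc,
      Finset.smul_sum, ← Finset.sum_add_distrib, Finset.sum_eq_zero, add_zero]
    intro j hj
    obtain ⟨t, hjt, rfl⟩ : ∃ t, j ∉ t ∧ s = insert j t :=
      ⟨s.erase j, Finset.notMem_erase j s, (Finset.insert_erase hj).symm⟩
    have hij : i ≠ j := fun e => hi (e ▸ hj)
    have hit : i ∉ t := fun e => hi (Finset.mem_insert_of_mem e)
    rw [cone, Finset.erase_insert hjt, if_neg hit, smul_smul, smul_smul, ← pow_add, ← pow_add,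
      Finset.erase_insert_of_ne hij, Finset.erase_insert hjt, rankIn_insert_of_le le_rfl,
      Finset.insert_comm, rankIn_insert_of_le (le_refl j)]
    rw [← add_smul]
    convert zero_smul ℂ (f (insert i t))
    rcases lt_or_gt_of_ne hij with h | h
    · rw [rankIn_insert_of_lt hit h, rankIn_insert_of_le h.le]
      ring
    · rw [rankIn_insert_of_lt hjt h, rankIn_insert_of_le h.le]
      ring

/-- Exchanging the order in which two vertices are removed changes the sign, so the double sum
equals its own negative. -/
theorem simplexDelta_simplexDelta (f : Finset ι → G) (s : Finset ι) :
    simplexDelta (simplexDelta f) s = 0 := by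
  have key : simplexDelta (simplexDelta f) s = -simplexDelta (simplexDelta f) s := by
    simp only [simplexDelta, Finset.smul_sum, smul_smul]
    conv_lhs => rw [Finset.sum_comm' (t' := s) (s' := fun k => s.erase k)
      (by intro x y; simp only [Finset.mem_erase]; tauto)]
    rw [← Finset.sum_neg_distrib]
    refine Finset.sum_congr rfl fun j hj => ?_
    rw [← Finset.sum_neg_distrib]
    refine Finset.sum_congr rfl fun k hk => ?_
    obtain ⟨t, hjt, hkt, hjk, rfl⟩ : ∃ t, j ∉ t ∧ k ∉ t ∧ j ≠ k ∧ s = insert j (insert k t) := by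
      refine ⟨(s.erase j).erase k, by simp, by simp, (Finset.ne_of_mem_erase hk).symm, ?_⟩
      rw [Finset.insert_erase hk, Finset.insert_erase hj]
    have h1 : (insert j (insert k t)).erase k = insert j t := by
      rw [Finset.insert_comm, Finset.erase_insert]
      simp [hjk.symm, hkt]
    have h2 : (insert j (insert k t)).erase j = insert k t := by
      rw [Finset.erase_insert]
      simp [hjk, hjt]
    rw [h1, h2, Finset.erase_insert hjt, Finset.erase_insert hkt, rankIn_insert_of_le (le_refl j),
      rankIn_insert_of_le (le_refl j), Finset.insert_comm, rankIn_insert_of_le (le_refl k),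
      rankIn_insert_of_le (le_refl k), ← pow_add, ← pow_add, ← neg_smul,
      add_comm _ (rankIn t j), add_comm _ (rankIn t k), rankIn_swap hjt hkt hjk]
  have h2 : (2 : ℂ) • simplexDelta (simplexDelta f) s = 0 := by
    rw [two_smul]
    nth_rw 1 [key]
    exact neg_add_cancel _
  exact (smul_eq_zero.mp h2).resolve_left two_ne_zero

end Simplex

end NCDeRham

end

noncomputable section

namespace NCDeRham

/-! ### Forms described by their values at points -/

section Pointwise

open scoped ShortcutInstances

variable {A : Type*} [Ring A] [Algebra ℂ A] {V R : Type*} [TopologicalSpace V] [Ring R]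
  [Algebra ℂ R] {S : Subalgebra ℂ (V → R)} {r : A →ₐ[ℂ] S} {Q : Type*} [Ring Q] [Algebra ℂ Q]

/-- Alternating maps on derivations with values in an `A`-algebra which are linear over the center
of `A`. -/
def centralAlt (ρ : A →ₐ[ℂ] Q) (q : ℕ) : Submodule ℂ (Der A [⋀^Fin q]→ₗ[ℂ] Q) where
  carrier := {w | ∀ (z : Subalgebra.center ℂ A) (X : Fin q → Der A) (i : Fin q),
    w (Function.update X i (z • X i)) = ρ z * w X}
  add_mem' := by
    intro w η hw hη z X i
    simp only [Set.mem_ofPred_eq] at hw hη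
    simp [hw, hη, mul_add]
  zero_mem' := by intro z X i; simp
  smul_mem' := by
    intro c w hw z X i
    simp only [Set.mem_ofPred_eq] at hw
    simp [hw]

/-- The values of a form on `S` under an evaluation of the elements of `S`, on push-forwards of
derivations of `A`. -/
def IsLocal.evalForm (h : IsLocal r) (ev : S →ₗ[ℂ] Q) (q : ℕ) :
    Form S q →ₗ[ℂ] Der A [⋀^Fin q]→ₗ[ℂ] Q where
  toFun η := ev.compAlternatingMap (h.pull η)
  map_add' η η' := AlternatingMap.ext fun X => map_add ev _ _
  map_smul' c η := AlternatingMap.ext fun X => map_smul ev c _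

/-- The evaluations are jointly injective, so additivity, alternation and central linearity of the
assembled map may be tested after each of them. -/
theorem exists_form_of_pointwise {κ : Type*} {Q : κ → Type*} [∀ k, Ring (Q k)]
    [∀ k, Algebra ℂ (Q k)] (ρ : ∀ k, A →ₐ[ℂ] Q k) (inj : ∀ a a', (∀ k, ρ k a = ρ k a') → a = a')
    {q : ℕ} (Ψ : ∀ k, Der A [⋀^Fin q]→ₗ[ℂ] Q k) (hc : ∀ k, Ψ k ∈ centralAlt (ρ k) q)
    (hs : ∀ X, ∃ a, ∀ k, ρ k a = Ψ k X) :
    ∃ w : Form A q, ∀ k X, ρ k (w.1 X) = Ψ k X := by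
  choose a ha using hs
  refine ⟨⟨{
      toFun := a
      map_update_add' := by
        intro _ X i Y Y'
        refine inj _ _ fun k => ?_
        rw [map_add, ha, ha, ha, AlternatingMap.map_update_add]
      map_update_smul' := by
        intro _ X i c Y
        refine inj _ _ fun k => ?_
        rw [map_smul, ha, ha, AlternatingMap.map_update_smul]
      map_eq_zero_of_eq' := by
        intro X i j hij hne
        refine inj _ _ fun k => ?_
        rw [map_zero, ha, AlternatingMap.map_eq_zero_of_eq _ _ hij hne] }, ?_⟩, ?_⟩
  · intro z X i
    refine inj _ _ fun k => ?_
    change ρ k (a _) = ρ k (_ * a _)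
    rw [map_mul, ha, ha]
    exact hc k z X i
  · intro k X
    exact ha X k

/-- The local analogue: it suffices to prescribe values on derivations of `A`, since `exists_form`
extends them to all derivations of `S`. -/
theorem IsLocal.exists_evalForm (h : IsLocal r) {κ : Type*} {Q : κ → Type*} [∀ k, Ring (Q k)]
    [∀ k, Algebra ℂ (Q k)] (ρ : ∀ k, A →ₐ[ℂ] Q k) (ev : ∀ k, S →ₗ[ℂ] Q k)
    (ev_mul : ∀ k b b', ev k (b * b') = ev k b * ev k b') (hρ : ∀ k a, ev k (r a) = ρ k a)
    (inj : ∀ b b', (∀ k, ev k b = ev k b') → b = b')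
    {q : ℕ} (Ψ : ∀ k, Der A [⋀^Fin q]→ₗ[ℂ] Q k) (hc : ∀ k, Ψ k ∈ centralAlt (ρ k) q)
    (hs : ∀ X, ∃ b, ∀ k, ev k b = Ψ k X) :
    ∃ η : Form S q, ∀ k, h.evalForm (ev k) q η = Ψ k := by
  choose b hb using hs
  obtain ⟨η, hη⟩ := h.exists_form (q := q) {
      toFun := b
      map_update_add' := by
        intro _ X i Y Y'
        refine inj _ _ fun k => ?_
        rw [map_add, hb, hb, hb, AlternatingMap.map_update_add]
      map_update_smul' := by
        intro _ X i c Y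
        refine inj _ _ fun k => ?_
        rw [map_smul, hb, hb, AlternatingMap.map_update_smul]
      map_eq_zero_of_eq' := by
        intro X i j hij hne
        refine inj _ _ fun k => ?_
        rw [map_zero, hb, AlternatingMap.map_eq_zero_of_eq _ _ hij hne] } (by
    intro z X i
    refine inj _ _ fun k => ?_
    change ev k (b _) = ev k (_ * b _)
    rw [ev_mul, hρ, hb, hb]
    exact hc k z X i)
  refine ⟨η, fun k => AlternatingMap.ext fun X => ?_⟩
  change ev k (h.pull η X) = _
  rw [IsLocal.pull_apply, hη]
  exact hb X k

theorem IsLocal.evalForm_mem (h : IsLocal r) (ρ : A →ₐ[ℂ] Q) (ev : S →ₗ[ℂ] Q)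
    (ev_mul : ∀ b b', ev (b * b') = ev b * ev b') (hρ : ∀ a, ev (r a) = ρ a) {q : ℕ}
    (η : Form S q) : h.evalForm ev q η ∈ centralAlt ρ q := by
  intro z X i
  change ev (h.pull η _) = _ * ev (h.pull η _)
  rw [h.pull_center_smul, ev_mul, hρ]

theorem IsLocal.evalForm_formMap {V' R' : Type*} [TopologicalSpace V'] [Ring R'] [Algebra ℂ R']
    {S' : Subalgebra ℂ (V' → R')} {r' : A →ₐ[ℂ] S'} (h : IsLocal r) (h' : IsLocal r')
    {s : S →ₐ[ℂ] S'} (hs : IsLocal s) (hc : s.comp r = r') (u : UniqueImage s)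
    (ev : S →ₗ[ℂ] Q) (ev' : S' →ₗ[ℂ] Q) (he : ∀ b, ev' (s b) = ev b) {q : ℕ} (η : Form S q) :
    h'.evalForm ev' q (formMap s u q η) = h.evalForm ev q η := by
  refine AlternatingMap.ext fun X => ?_
  change ev' (h'.pull _ X) = ev (h.pull η X)
  rw [← he, ← IsLocal.pull_formMap h h' hs hc u]

end Pointwise

/-! ### Local and global forms as smooth families of forms with values in the fibers of `End E` -/

section EndSections

open scoped ShortcutInstances

variable {m n : ℕ} {M : Type*} [TopologicalSpace M] [ChartedSpace (EuclideanSpace ℝ (Fin m)) M]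
  {E : M → Type*} [∀ x, NormedAddCommGroup (E x)] [∀ x, InnerProductSpace ℂ (E x)]
  [TopologicalSpace (TotalSpace (EuclideanSpace ℂ (Fin n)) E)]
  [FiberBundle (EuclideanSpace ℂ (Fin n)) E]
  [VectorBundle ℂ (EuclideanSpace ℂ (Fin n)) E]
  [VectorBundle ℝ (EuclideanSpace ℂ (Fin n)) E]
  [ContMDiffVectorBundle ∞ (EuclideanSpace ℂ (Fin n)) E (𝓡 m)]

variable (m n) in
/-- A family of endomorphisms of the fibers is smooth at a point. -/
def SmoothEndAt (Ψ : ∀ x, Module.End ℂ (E x)) (x₀ : M) : Prop :=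
  ∀ s : ∀ x, E x, SmoothSecAt m n s x₀ → SmoothSecAt m n (fun x => Ψ x (s x)) x₀

theorem SmoothEndAt.congr {Ψ Ψ' : ∀ x, Module.End ℂ (E x)} {x₀ : M} (h : SmoothEndAt m n Ψ x₀)
    (h' : ∀ᶠ x in nhds x₀, Ψ' x = Ψ x) : SmoothEndAt m n Ψ' x₀ := fun s hs =>
  (h s hs).congr (h'.mono fun x hx => by rw [hx])

theorem SmoothEndAt.zero {x₀ : M} : SmoothEndAt m n (fun x => (0 : Module.End ℂ (E x))) x₀ :=
  fun _ _ => SmoothSecAt.zero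

theorem SmoothEndAt.smul {f : M → ℂ} {Ψ : ∀ x, Module.End ℂ (E x)} {x₀ : M}
    (hf : ContMDiffAt (𝓡 m) 𝓘(ℝ, ℂ) ∞ f x₀) (h : SmoothEndAt m n Ψ x₀) :
    SmoothEndAt m n (fun x => f x • Ψ x) x₀ := fun s hs => SmoothSecAt.smul hf (h s hs)

theorem SmoothEndAt.sum {κ : Type*} (K : Finset κ) {Ψ : κ → ∀ x, Module.End ℂ (E x)} {x₀ : M}
    (h : ∀ k ∈ K, SmoothEndAt m n (Ψ k) x₀) :
    SmoothEndAt m n (fun x => ∑ k ∈ K, Ψ k x) x₀ := fun s hs =>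
  (SmoothSecAt.sum K fun k hk => h k hk s hs).congr
    (Filter.Eventually.of_forall fun x => LinearMap.sum_apply _ _ _)

variable {o : OrientedHermitian m n E} {U V : Opens M}

open Classical in
/-- The endomorphisms with given matrices in a frame, extended by zero. -/
def endOf (e : SUFrame o U) (x : M) : MatAlg m n U →ₗ[ℂ] Module.End ℂ (E x) where
  toFun b := if h : x ∈ U then Matrix.toLin (e.basis x).toBasis (e.basis x).toBasis (b.1 ⟨x, h⟩)
    else 0
  map_add' b b' := by
    split_ifs with h
    · exact map_add _ _ _
    · rw [add_zero]
  map_smul' c b := by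
    split_ifs with h
    · exact map_smul (Matrix.toLin _ _) c _
    · rw [smul_zero]

theorem endOf_apply (e : SUFrame o U) {x : M} (h : x ∈ U) (b : MatAlg m n U) :
    endOf e x b = Matrix.toLin (e.basis x).toBasis (e.basis x).toBasis (b.1 ⟨x, h⟩) := dif_pos h

theorem endOf_of_notMem (e : SUFrame o U) {x : M} (h : x ∉ U) (b : MatAlg m n U) :
    endOf e x b = 0 := dif_neg h

theorem endOf_locHom (e : SUFrame o U) {x : M} (h : x ∈ U) (a : EndAlg m n E) :
    endOf e x (locHom e a) = a.1 x := by
  rw [endOf_apply e h]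
  exact Matrix.toLin_toMatrix _ _ _

theorem endOf_mul (e : SUFrame o U) (x : M) (b b' : MatAlg m n U) :
    endOf e x (b * b') = endOf e x b * endOf e x b' := by
  by_cases h : x ∈ U
  · rw [endOf_apply e h, endOf_apply e h, endOf_apply e h]
    exact Matrix.toLin_mul _ _ _ _ _
  · rw [endOf_of_notMem e h, endOf_of_notMem e h, zero_mul]

theorem endOf_injective (e : SUFrame o U) {b b' : MatAlg m n U}
    (h : ∀ x ∈ U, endOf e x b = endOf e x b') : b = b' := by
  refine Subtype.ext <| funext fun x => ?_
  have := h x x.2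
  rw [endOf_apply e x.2, endOf_apply e x.2] at this
  exact (Matrix.toLin _ _).injective this

theorem endOf_smooth (e : SUFrame o U) (b : MatAlg m n U) {x₀ : M} (hx : x₀ ∈ U) :
    SmoothEndAt m n (fun x => endOf e x b) x₀ := by
  classical
  intro s hs
  let β : M → Matrix (Fin n) (Fin n) ℂ := fun x => if h : x ∈ U then b.1 ⟨x, h⟩ else 0
  have hβ : ∀ i j, ContMDiffAt (𝓡 m) 𝓘(ℝ, ℂ) ∞ (fun x => β x i j) x₀ := by
    intro i j
    refine (contMDiffAt_subtype_iff (U := U) (x := ⟨x₀, hx⟩)).mp ?_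
    convert b.2 i j ⟨x₀, hx⟩ using 2 with y
    simp [β]
  -- The endomorphism is expanded in the orthonormal frame. The coefficients of `s` are inner
  -- products with the frame, which the smooth metric makes smooth.
  have h2 : SmoothSecAt m n (fun x => ∑ i, (∑ j, β x i j * inner ℂ (e.basis x j) (s x)) •
      e.basis x i) x₀ :=
    SmoothSecAt.sum _ fun i _ => SmoothSecAt.smul
      (contMDiffAt_finsetSum fun j _ => contMDiffAt_cmul (hβ i j)
        (o.smooth_inner x₀ _ _ (e.smooth x₀ hx j) hs)) (e.smooth x₀ hx i)
  refine h2.congr ?_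
  filter_upwards [U.isOpen.mem_nhds hx] with x hxU
  have hxU' : x ∈ U := hxU
  rw [endOf_apply e hxU']
  simp [β, hxU', Matrix.toLin_apply, Matrix.mulVec, dotProduct, OrthonormalBasis.repr_apply_apply]

theorem exists_matAlg (e : SUFrame o U) (Ψ : ∀ x, Module.End ℂ (E x))
    (h : ∀ x ∈ U, SmoothEndAt m n Ψ x) :
    ∃ b : MatAlg m n U, ∀ x ∈ U, endOf e x b = Ψ x := by
  refine ⟨⟨fun x => LinearMap.toMatrix (e.basis x).toBasis (e.basis x).toBasis (Ψ x), ?_⟩, ?_⟩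
  · intro i j x
    have h1 := o.smooth_inner x _ _ (e.smooth x x.2 i) (h x x.2 _ (e.smooth x x.2 j))
    refine (contMDiffAt_subtype_iff.mpr h1).congr_of_eventuallyEq (Filter.Eventually.of_forall ?_)
    intro y
    simp [LinearMap.toMatrix_apply, OrthonormalBasis.repr_apply_apply]
  · intro x hx
    rw [endOf_apply e hx]
    exact Matrix.toLin_toMatrix _ _ _

theorem endOf_resHom (e : SUFrame o U) (e' : SUFrame o V) (hVU : V ≤ U) {x : M} (hx : x ∈ V)
    (he : e.basis x = e'.basis x) (b : MatAlg m n U) :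
    endOf e' x (resHom hVU b) = endOf e x b := by
  rw [endOf_apply e' hx, endOf_apply e (hVU hx), he]
  rfl

/-- As `g` is the base change matrix, `g⁻¹ b g` is the matrix in `e'` of the endomorphism with
matrix `b` in `e`. This is what removes the twist from the Čech differential. -/
theorem endOf_conjHom (e : SUFrame o U) (e' : SUFrame o V) (hVU : V ≤ U)
    (g : V → Matrix.specialUnitaryGroup (Fin n) ℂ)
    (hg : ∀ i j, ContMDiff (𝓡 m) 𝓘(ℝ, ℂ) ∞ (fun x => (g x).1 i j)) {x : M} (hx : x ∈ V)
    (he : (g ⟨x, hx⟩).1 = (e.basis x).toBasis.toMatrix (e'.basis x)) (b : MatAlg m n U) :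
    endOf e' x ((conjHom g hg).comp (resHom hVU) b) = endOf e x b := by
  rw [endOf_apply e' hx, endOf_apply e (hVU hx), ← LinearEquiv.eq_symm_apply,
    Matrix.toLin_symm, ← basis_toMatrix_mul_linearMap_toMatrix_mul_basis_toMatrix
      (e'.basis x).toBasis (e.basis x).toBasis (e'.basis x).toBasis (e.basis x).toBasis,
    LinearMap.toMatrix_toLin, OrthonormalBasis.coe_toBasis (e'.basis x), ← he]
  change ((g ⟨x, hx⟩)⁻¹).1 * b.1 ⟨x, hVU hx⟩ * (g ⟨x, hx⟩).1 = _
  congr 2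
  -- What remains is that the inverse of `g` in `SU(n)` is the opposite base change matrix; both are
  -- inverse to `g`.
  have h1 : ((g ⟨x, hx⟩)⁻¹).1 * (g ⟨x, hx⟩).1 = 1 := congrArg Subtype.val (inv_mul_cancel (g ⟨x, hx⟩))
  have h2 : (g ⟨x, hx⟩).1 * (e'.basis x).toBasis.toMatrix (e.basis x).toBasis = 1 := by
    rw [he, ← OrthonormalBasis.coe_toBasis (e'.basis x)]
    exact Module.Basis.toMatrix_mul_toMatrix_flip _ _
  exact left_inv_eq_right_inv h1 h2

namespace ShortcutInstances

scoped instance (q : ℕ) : AddCommGroup (Form (MatAlg m n U) q) := Submodule.addCommGroup _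

scoped instance (q : ℕ) : Module ℂ (Form (MatAlg m n U) q) := Submodule.module _

scoped instance (q : ℕ) : AddCommMonoid (Form (MatAlg m n U) q) := AddCommGroup.toAddCommMonoid

scoped instance (q : ℕ) : AddCommGroup (Form (EndAlg m n E) q) := Submodule.addCommGroup _

scoped instance (q : ℕ) : Module ℂ (Form (EndAlg m n E) q) := Submodule.module _

scoped instance (q : ℕ) : AddCommMonoid (Form (EndAlg m n E) q) := AddCommGroup.toAddCommMonoid

end ShortcutInstances

variable [IsManifold (𝓡 m) ∞ M] [T2Space M]

theorem locHom_isLocal (e : SUFrame o U) : IsLocal (S := MatAlg m n U) (locHom e) :=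
  ⟨MatAlg.glue, locHom_bump e⟩

theorem resHom_isLocal (h : V ≤ U) :
    IsLocal (S := MatAlg m n V) (resHom h : MatAlg m n U →ₐ[ℂ] MatAlg m n V) :=
  ⟨MatAlg.glue, resHom_bump h⟩

theorem conjHom_isLocal (h : V ≤ U) (g : V → Matrix.specialUnitaryGroup (Fin n) ℂ)
    (hg : ∀ i j, ContMDiff (𝓡 m) 𝓘(ℝ, ℂ) ∞ (fun x => (g x).1 i j)) :
    IsLocal (S := MatAlg m n V)
      ((conjHom g hg).comp (resHom h : MatAlg m n U →ₐ[ℂ] MatAlg m n V)) :=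
  ⟨MatAlg.glue, conjHom_bump _ (resHom_bump h) g hg⟩

variable (m n E) in
/-- The value of a section of `End(E)` at a point. -/
def valueAt (x : M) : EndAlg m n E →ₐ[ℂ] Module.End ℂ (E x) :=
  (Pi.evalAlgHom ℂ (fun x => Module.End ℂ (E x)) x).comp (EndAlg m n E).val

variable (m n E) in
/-- Alternating maps on derivations of the algebra of sections of `End(E)` with values in the
fiber at a point, linear over the center. -/
def FiberForm (q : ℕ) (x : M) : Type _ := centralAlt (valueAt m n E x) q

instance (q : ℕ) (x : M) : AddCommGroup (FiberForm m n E q x) := Submodule.addCommGroup _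

instance (q : ℕ) (x : M) : Module ℂ (FiberForm m n E q x) := Submodule.module _

/-- The value of a fiber form. -/
def FiberForm.eval {q : ℕ} (x : M) (X : Fin q → Der (EndAlg m n E)) :
    FiberForm m n E q x →ₗ[ℂ] Module.End ℂ (E x) where
  toFun w := w.1 X
  map_add' _ _ := rfl
  map_smul' _ _ := rfl

theorem FiberForm.ext {q : ℕ} {x : M} {w w' : FiberForm m n E q x}
    (h : ∀ X, FiberForm.eval x X w = FiberForm.eval x X w') : w = w' :=
  Subtype.ext (AlternatingMap.ext h)

theorem evalForm_mem_central (e : SUFrame o U) {q : ℕ} (x : M) (η : Form (MatAlg m n U) q) :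
    IsLocal.evalForm (locHom_isLocal e) (endOf e x) q η ∈ centralAlt (valueAt m n E x) q := by
  by_cases hx : x ∈ U
  · exact IsLocal.evalForm_mem _ _ _ (endOf_mul e x) (endOf_locHom e hx) η
  · have : IsLocal.evalForm (locHom_isLocal e) (endOf e x) q η = 0 :=
      AlternatingMap.ext fun _ => endOf_of_notMem e hx _
    rw [this]
    exact zero_mem _

/-- The values at `x`, in `End(E x)`, of a local form on derivations of the global algebra. -/
def secOf (e : SUFrame o U) (q : ℕ) (x : M) :
    Form (MatAlg m n U) q →ₗ[ℂ] FiberForm m n E q x :=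
  (IsLocal.evalForm (locHom_isLocal e) (endOf e x) q).codRestrict _ (evalForm_mem_central e x)

theorem eval_secOf (e : SUFrame o U) {q : ℕ} (x : M) (η : Form (MatAlg m n U) q)
    (X : Fin q → Der (EndAlg m n E)) :
    FiberForm.eval x X (secOf e q x η) = endOf e x ((locHom_isLocal e).pull η X) := rfl

theorem secOf_smooth (e : SUFrame o U) {q : ℕ} {x₀ : M} (h : x₀ ∈ U) (η : Form (MatAlg m n U) q)
    (X : Fin q → Der (EndAlg m n E)) :
    SmoothEndAt m n (fun x => FiberForm.eval x X (secOf e q x η)) x₀ :=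
  endOf_smooth e _ h

theorem secOf_injective (e : SUFrame o U) {q : ℕ} {η η' : Form (MatAlg m n U) q}
    (h : ∀ x ∈ U, secOf e q x η = secOf e q x η') : η = η' :=
  (locHom_isLocal e).form_ext fun X => endOf_injective e fun x hx => by
    have := congrArg (FiberForm.eval x X) (h x hx)
    exact this

/-- Together with `secOf_injective` and `secOf_smooth`, this identifies forms on the local algebra
with families of fiber forms over `U` that are smooth on every tuple of global derivations.
Primitives can therefore be built point by point. -/
theorem exists_secOf (e : SUFrame o U) {q : ℕ} (Ψ : ∀ x, FiberForm m n E q x)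
    (hs : ∀ X, ∀ x ∈ U, SmoothEndAt m n (fun x => FiberForm.eval x X (Ψ x)) x) :
    ∃ η : Form (MatAlg m n U) q, ∀ x ∈ U, secOf e q x η = Ψ x := by
  obtain ⟨η, hη⟩ := IsLocal.exists_evalForm (locHom_isLocal e) (κ := U)
    (fun x => valueAt m n E x) (fun x => endOf e x) (fun x => endOf_mul e x)
    (fun x => endOf_locHom e x.2) (fun b b' h => endOf_injective e fun x hx => h ⟨x, hx⟩)
    (fun x => (Ψ x).1) (fun x => (Ψ x).2) (fun X => by
      obtain ⟨b, hb⟩ := exists_matAlg e (fun x => FiberForm.eval x X (Ψ x)) (hs X)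
      exact ⟨b, fun x => hb x x.2⟩)
  exact ⟨η, fun x hx => Subtype.ext (hη ⟨x, hx⟩)⟩

theorem exists_globalForm {q : ℕ} (Ψ : ∀ x, FiberForm m n E q x)
    (hs : ∀ X, ∀ x, SmoothEndAt m n (fun x => FiberForm.eval x X (Ψ x)) x) :
    ∃ w : Form (EndAlg m n E) q, ∀ x X, (w.1 X).1 x = FiberForm.eval x X (Ψ x) :=
  exists_form_of_pointwise (fun x => valueAt m n E x)
    (fun _ _ h => Subtype.ext (funext h)) (fun x => (Ψ x).1) (fun x => (Ψ x).2)
    fun X => ⟨⟨fun x => FiberForm.eval x X (Ψ x), fun x => hs X x⟩, fun _ => rfl⟩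

/-- A homomorphism that preserves the underlying endomorphisms carries one frame localization to the
other, so it also preserves the fiber values of forms. -/
theorem secOf_formMap (e : SUFrame o U) (e' : SUFrame o V) (hVU : V ≤ U)
    {s : MatAlg m n U →ₐ[ℂ] MatAlg m n V} (hs : IsLocal (S := MatAlg m n V) s)
    (hc : ∀ b, ∀ x ∈ V, endOf e' x (s b) = endOf e x b) (u : UniqueImage s) {q : ℕ}
    (η : Form (MatAlg m n U) q) {x : M} (hx : x ∈ V) :
    secOf e' q x (formMap s u q η) = secOf e q x η := by
  have h : s.comp (locHom e) = locHom e' := AlgHom.ext fun a => endOf_injective e' fun y hy => by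
    rw [AlgHom.comp_apply, hc _ y hy, endOf_locHom e (hVU hy), endOf_locHom e' hy]
  exact Subtype.ext (IsLocal.evalForm_formMap (locHom_isLocal e) (locHom_isLocal e') hs h u
    (endOf e x) (endOf e' x) (fun b => hc b x hx) η)

theorem secOf_formMap_locHom (e : SUFrame o U) (u : UniqueImage (locHom e)) {q : ℕ}
    (w : Form (EndAlg m n E) q) {x : M} (hx : x ∈ U) (X : Fin q → Der (EndAlg m n E)) :
    FiberForm.eval x X (secOf e q x (formMap (B := MatAlg m n U) (locHom e) u q w)) =
      (w.1 X).1 x := by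
  rw [eval_secOf, IsLocal.pull_apply, IsLocal.formMap_push, endOf_locHom e hx]

end EndSections

end NCDeRham

end

noncomputable section

namespace NCDeRham

/-! ### The twisted Čech complex: reduction to the simplex and exactness of the rows -/

section CechValues

open scoped ShortcutInstances

variable {m n : ℕ} {M : Type*} [TopologicalSpace M] [ChartedSpace (EuclideanSpace ℝ (Fin m)) M]
  {ι : Type*} [LinearOrder ι] [IsManifold (𝓡 m) ∞ M] [T2Space M]
  {E : M → Type*} [∀ x, NormedAddCommGroup (E x)] [∀ x, InnerProductSpace ℂ (E x)]
  [TopologicalSpace (TotalSpace (EuclideanSpace ℂ (Fin n)) E)]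
  [FiberBundle (EuclideanSpace ℂ (Fin n)) E]
  [VectorBundle ℂ (EuclideanSpace ℂ (Fin n)) E]
  [VectorBundle ℝ (EuclideanSpace ℂ (Fin n)) E]
  [ContMDiffVectorBundle ∞ (EuclideanSpace ℂ (Fin n)) E (𝓡 m)]
  {o : OrientedHermitian m n E} {U : ι → Opens M} (e : ∀ i, SUFrame o (U i))

/-- The vertices of an ordered simplex. -/
def vertices {p : ℕ} (a : Fin (p + 1) ↪o ι) : Finset ι := Finset.univ.map a.toEmbedding

theorem card_vertices {p : ℕ} (a : Fin (p + 1) ↪o ι) : (vertices a).card = p + 1 := by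
  simp [vertices]

theorem mem_vertices {p : ℕ} (a : Fin (p + 1) ↪o ι) (i : Fin (p + 1)) : a i ∈ vertices a :=
  Finset.mem_map_of_mem a.toEmbedding (Finset.mem_univ i)

theorem orderEmbOfFin_vertices {p : ℕ} (a : Fin (p + 1) ↪o ι) :
    (vertices a).orderEmbOfFin (card_vertices a) = a :=
  (Finset.orderEmbOfFin_unique' _ (mem_vertices a)).symm

theorem vertices_orderEmbOfFin {p : ℕ} (s : Finset ι) (h : s.card = p + 1) :
    vertices (s.orderEmbOfFin h) = s := Finset.map_orderEmbOfFin_univ s h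

theorem vertices_face {p : ℕ} (a : Fin (p + 2) ↪o ι) (i : Fin (p + 2)) :
    vertices (face a i) = (vertices a).erase (a i) := by
  ext j
  simp only [vertices, Finset.mem_map, Finset.mem_univ, true_and, Finset.mem_erase]
  constructor
  · rintro ⟨k, rfl⟩
    exact ⟨fun h => Fin.succAbove_ne i k (a.injective h), i.succAbove k, rfl⟩
  · rintro ⟨hne, k, rfl⟩
    obtain ⟨l, hl⟩ := Fin.exists_succAbove_eq (x := k) (y := i) fun h => hne (h ▸ rfl)
    exact ⟨l, congrArg a hl⟩

theorem rankIn_vertices {p : ℕ} (a : Fin (p + 1) ↪o ι) (i : Fin (p + 1)) :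
    rankIn (vertices a) (a i) = i := by
  have : (vertices a).filter (· < a i) = (Finset.Iio i).map a.toEmbedding := by
    ext j
    simp only [vertices, Finset.mem_filter, Finset.mem_map, Finset.mem_univ, true_and,
      Finset.mem_Iio]
    constructor
    · rintro ⟨⟨k, rfl⟩, h⟩
      exact ⟨k, a.lt_iff_lt.mp h, rfl⟩
    · rintro ⟨k, hk, rfl⟩
      exact ⟨⟨k, rfl⟩, a.lt_iff_lt.mpr hk⟩
  rw [rankIn, this, Finset.card_map, Fin.card_Iio]

omit [T2Space M] [IsManifold (𝓡 m) ∞ M] in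
theorem mem_inter {p : ℕ} {a : Fin (p + 1) ↪o ι} {x : M} :
    x ∈ inter U a ↔ ∀ i ∈ vertices a, x ∈ U i := by
  change x ∈ ⋂ i, (U (a i) : Set M) ↔ _
  simp [vertices]

/-- The frame over `U_{α₀ ⋯ α_p}` which is used to trivialize the bundle. -/
def simplexFrame {p : ℕ} (a : Fin (p + 1) ↪o ι) : SUFrame o (inter U a) :=
  (e (a (Fin.last p))).restrict (inter_le U a _)

/-- Omitting a vertex other than the last one leaves the last vertex, hence the trivializing frame,
unchanged. -/
theorem secOf_resForm {p q : ℕ} (a : Fin (p + 2) ↪o ι) (i : Fin (p + 1))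
    (η : Form (MatAlg m n (inter U (face a i.castSucc))) q) {x : M} (hx : x ∈ inter U a) :
    secOf (simplexFrame e a) q x (resForm n U q a i.castSucc η) =
      secOf (simplexFrame e (face a i.castSucc)) q x η := by
  refine secOf_formMap (simplexFrame e (face a i.castSucc)) (simplexFrame e a)
    (inter_le_face U a i.castSucc) (resHom_isLocal _) (fun b y hy => ?_) _ η hx
  refine endOf_resHom _ _ _ hy ?_ b
  have h : face a i.castSucc (Fin.last p) = a (Fin.last (p + 1)) := by
    change a (i.castSucc.succAbove (Fin.last p)) = _
    rw [Fin.succAbove_castSucc_of_le _ _ (Fin.le_last i), Fin.succ_last]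
  change (e (face a i.castSucc (Fin.last p))).basis y = (e (a (Fin.last (p + 1)))).basis y
  rw [h]

/-- Omitting the last vertex passes to the frame of the preceding one; the conjugation compensates
exactly for this change. -/
theorem secOf_twistForm {p q : ℕ} (a : Fin (p + 2) ↪o ι)
    (η : Form (MatAlg m n (inter U (face a (Fin.last (p + 1))))) q) {x : M} (hx : x ∈ inter U a) :
    secOf (simplexFrame e a) q x (twistForm e q a η) =
      secOf (simplexFrame e (face a (Fin.last (p + 1)))) q x η := by
  refine secOf_formMap (simplexFrame e (face a (Fin.last (p + 1)))) (simplexFrame e a)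
    (inter_le_face U a (Fin.last (p + 1))) (conjHom_isLocal _ _ _) (fun b y hy => ?_) _ η hx
  refine endOf_conjHom _ _ _ _ _ hy ?_ b
  have h : face a (Fin.last (p + 1)) (Fin.last p) = a (Fin.last p).castSucc := by
    change a ((Fin.last (p + 1)).succAbove (Fin.last p)) = _
    rw [Fin.succAbove_last]
  change ((e (a (Fin.last p).castSucc)).basis y).toBasis.toMatrix _ =
    ((e (face a (Fin.last (p + 1)) (Fin.last p))).basis y).toBasis.toMatrix _
  rw [h]
  rfl

/-- The values of a Čech cochain, indexed by finite sets of indices and extended by zero. -/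
def cechVal {p q : ℕ} (c : CechForm m n U p q) (x : M) (s : Finset ι) :
    FiberForm m n E q x :=
  if h : s.card = p + 1 then secOf (simplexFrame e (s.orderEmbOfFin h)) q x (c _) else 0

theorem cechVal_vertices {p q : ℕ} (c : CechForm m n U p q) (x : M) (a : Fin (p + 1) ↪o ι) :
    cechVal e c x (vertices a) = secOf (simplexFrame e a) q x (c a) := by
  have h : ∀ b, b = a → secOf (simplexFrame e b) q x (c b) = secOf (simplexFrame e a) q x (c a) := by
    rintro b rfl
    rfl
  rw [cechVal, dif_pos (card_vertices a)]
  exact h _ (orderEmbOfFin_vertices a)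

theorem cechVal_smooth {p q : ℕ} (c : CechForm m n U p q) {x₀ : M} {s : Finset ι}
    (hs : ∀ i ∈ s, x₀ ∈ U i) (X : Fin q → Der (EndAlg m n E)) :
    SmoothEndAt m n (fun x => FiberForm.eval x X (cechVal e c x s)) x₀ := by
  by_cases h : s.card = p + 1
  · simp only [cechVal, dif_pos h]
    refine secOf_smooth _ ?_ _ _
    rw [mem_inter, vertices_orderEmbOfFin]
    exact hs
  · simp only [cechVal, dif_neg h, map_zero]
    exact SmoothEndAt.zero

theorem cechForm_ext {p q : ℕ} {c c' : CechForm m n U p q}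
    (h : ∀ a : Fin (p + 1) ↪o ι, ∀ x ∈ inter U a, cechVal e c x (vertices a) = cechVal e c' x (vertices a)) :
    c = c' := funext fun a => secOf_injective (simplexFrame e a) fun x hx => by
  rw [← cechVal_vertices, ← cechVal_vertices, h a x hx]

theorem simplexDelta_vertices {G : Type*} [AddCommGroup G] [Module ℂ G] (f : Finset ι → G) {p : ℕ}
    (a : Fin (p + 2) ↪o ι) : simplexDelta f (vertices a) =
      (∑ i : Fin (p + 1), (-1 : ℂ) ^ (i : ℕ) • f (vertices (face a i.castSucc))) +
        (-1 : ℂ) ^ (p + 1) • f (vertices (face a (Fin.last (p + 1)))) := by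
  have h : simplexDelta f (vertices a) =
      ∑ i : Fin (p + 2), (-1 : ℂ) ^ (i : ℕ) • f (vertices (face a i)) := by
    rw [simplexDelta]
    conv_lhs => rw [vertices, Finset.sum_map]
    refine Finset.sum_congr rfl fun i _ => ?_
    rw [vertices_face, ← rankIn_vertices a i]
    rfl
  rw [h, Fin.sum_univ_castSucc]
  rfl

theorem map_signedSum {W W' : Type*} [AddCommGroup W] [Module ℂ W] [AddCommGroup W'] [Module ℂ W']
    (L : W →ₗ[ℂ] W') {k : ℕ} (f : Fin k → W) (g : W) :
    L ((∑ i : Fin k, (-1 : ℂ) ^ (i : ℕ) • f i) + (-1 : ℂ) ^ k • g) =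
      (∑ i : Fin k, (-1 : ℂ) ^ (i : ℕ) • L (f i)) + (-1 : ℂ) ^ k • L g := by
  simp only [map_add, map_sum, map_smul]

theorem signedSum_congr {W : Type*} [AddCommGroup W] [Module ℂ W] {k : ℕ} {f f' : Fin k → W}
    {g g' : W} (hf : ∀ i, f i = f' i) (hg : g = g') :
    (∑ i : Fin k, (-1 : ℂ) ^ (i : ℕ) • f i) + (-1 : ℂ) ^ k • g =
      (∑ i : Fin k, (-1 : ℂ) ^ (i : ℕ) • f' i) + (-1 : ℂ) ^ k • g' := by
  rw [funext hf, hg]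

/-- All terms, the conjugated one included, have the fiber values of the cochain on the faces. The
twisted differential thus becomes the simplicial one at every point of the intersection. -/
theorem cechVal_cechDelta {p q : ℕ} (c : CechForm m n U p q) {x : M} (a : Fin (p + 2) ↪o ι)
    (hx : x ∈ inter U a) : cechVal e (cechDelta e p q c) x (vertices a) =
      simplexDelta (cechVal e c x) (vertices a) := by
  refine (cechVal_vertices e _ x a).trans ((map_signedSum (secOf (simplexFrame e a) q x)
    (fun i : Fin (p + 1) => resForm n U q a i.castSucc (c (face a i.castSucc)))
    (twistForm e q a (c (face a (Fin.last (p + 1)))))).trans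
    (Eq.trans (signedSum_congr (fun i => ?_) ?_) (simplexDelta_vertices _ a).symm))
  · exact (secOf_resForm e a i _ hx).trans (cechVal_vertices e c x _).symm
  · exact (secOf_twistForm e a _ hx).trans (cechVal_vertices e c x _).symm

theorem cechDelta_cechDelta {p q : ℕ} (c : CechForm m n U p q) :
    cechDelta e (p + 1) q (cechDelta e p q c) = 0 := by
  refine cechForm_ext e fun a x hx => ?_
  have h0 : cechVal e (0 : CechForm m n U (p + 2) q) x (vertices a) = 0 := by
    rw [cechVal_vertices]
    exact map_zero _
  rw [h0, cechVal_cechDelta e _ a hx, ← simplexDelta_simplexDelta (cechVal e c x) (vertices a)]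
  conv_lhs => rw [simplexDelta]
  conv_rhs => rw [simplexDelta]
  -- The outer differential reads only the codimension-one faces, and `x` lies in their
  -- intersections too, so `cechVal_cechDelta` applies to each.
  refine Finset.sum_congr rfl fun j hj => ?_
  obtain ⟨i, -, rfl⟩ := Finset.mem_map.mp hj
  congr 1
  have := cechVal_cechDelta e c (face a i) (inter_le_face U a i hx)
  rwa [vertices_face] at this

theorem cechVal_locCech {q : ℕ} (w : Form (EndAlg m n E) q) {x : M} (a : Fin 1 ↪o ι)
    (hx : x ∈ inter U a) (X : Fin q → Der (EndAlg m n E)) :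
    FiberForm.eval x X (cechVal e (locCech e q w) x (vertices a)) = (w.1 X).1 x := by
  rw [cechVal_vertices]
  exact secOf_formMap_locHom (simplexFrame e a) _ w hx X

theorem locCech_injective (hU : ∀ x, ∃ i, x ∈ U i) {q : ℕ} {w w' : Form (EndAlg m n E) q}
    (h : locCech e q w = locCech e q w') : w = w' := by
  refine Form.ext_apply fun X => Subtype.ext <| funext fun x => ?_
  obtain ⟨i, hi⟩ := hU x
  let a : Fin 1 ↪o ι := ({i} : Finset ι).orderEmbOfFin (Finset.card_singleton i)
  have hx : x ∈ inter U a := by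
    rw [mem_inter, vertices_orderEmbOfFin]
    simpa using hi
  exact (cechVal_locCech e w a hx X).symm.trans
    ((congrArg (fun c => FiberForm.eval x X (cechVal e c x (vertices a))) h).trans
      (cechVal_locCech e w' a hx X))

/-- Both faces of an edge carry the value of the same global form, with opposite signs. -/
theorem cechDelta_locCech {q : ℕ} (w : Form (EndAlg m n E) q) :
    cechDelta e 0 q (locCech e q w) = 0 := by
  refine cechForm_ext e fun a x hx => FiberForm.ext fun X => ?_
  have h0 : cechVal e (0 : CechForm m n U 1 q) x (vertices a) = 0 := by
    rw [cechVal_vertices]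
    exact map_zero _
  refine Eq.trans ?_ ((congrArg (FiberForm.eval x X) h0).trans (map_zero _)).symm
  refine (congrArg (FiberForm.eval x X) ((cechVal_cechDelta e _ a hx).trans
    (simplexDelta_vertices _ a))).trans ((map_signedSum (FiberForm.eval x X) _ _).trans
    ((signedSum_congr (f' := fun _ => (w.1 X).1 x)
      (fun i => cechVal_locCech e w (face a i.castSucc) (inter_le_face U a _ hx) X)
      (cechVal_locCech e w (face a (Fin.last 1)) (inter_le_face U a _ hx) X)).trans ?_))
  simp

/-- The average of the cone homotopies with respect to a partition of unity. -/
def coneSum (ρ : SmoothPartitionOfUnity ι (𝓡 m) M) {p q : ℕ} (c : CechForm m n U p q) (x : M)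
    (s : Finset ι) : FiberForm m n E q x :=
  ∑ i ∈ ρ.finsupport x, (ρ i x : ℂ) • cone i (cechVal e c x) s

/-- The value on `insert i s` is known to be smooth only on `U i`, but it is multiplied by a
function supported there, so each summand is smooth at every point of the intersection for `s`. -/
theorem coneSum_smooth {ρ : SmoothPartitionOfUnity ι (𝓡 m) M}
    (hρ : ρ.IsSubordinate fun i => (U i : Set M)) {p q : ℕ} (c : CechForm m n U p q)
    {x₀ : M} {s : Finset ι} (hs : ∀ i ∈ s, x₀ ∈ U i) (X : Fin q → Der (EndAlg m n E)) :
    SmoothEndAt m n (fun x => FiberForm.eval x X (coneSum e ρ c x s)) x₀ := by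
  have hterm : ∀ i, SmoothEndAt m n
      (fun x => (ρ i x : ℂ) • FiberForm.eval x X (cone i (cechVal e c x) s)) x₀ := by
    intro i
    by_cases hi : x₀ ∈ U i
    · refine SmoothEndAt.smul (Complex.ofRealCLM.contDiff.contMDiff.comp (ρ i).contMDiff x₀) ?_
      by_cases his : i ∈ s
      · simp only [cone, if_pos his, map_zero]
        exact SmoothEndAt.zero
      · simp only [cone, if_neg his, map_smul]
        refine SmoothEndAt.smul (f := fun _ => (-1 : ℂ) ^ rankIn s i) contMDiffAt_const
          (cechVal_smooth e c (fun j hj => ?_) X)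
        rcases Finset.mem_insert.mp hj with rfl | hj
        · exact hi
        · exact hs j hj
    · refine SmoothEndAt.zero.congr ?_
      filter_upwards [notMem_tsupport_iff_eventuallyEq.mp fun h => hi (hρ i h)] with x hx
      rw [hx]
      simp
  -- The index set of the sum varies with the point; near `x₀` it stays inside one finite set, and
  -- the added summands are zero.
  refine (SmoothEndAt.sum (ρ.fintsupport x₀) fun i _ => hterm i).congr ?_
  filter_upwards [ρ.eventually_finsupport_subset x₀] with x hx
  rw [coneSum, map_sum]
  simp only [map_smul]
  refine Finset.sum_subset hx fun i _ hi => ?_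
  have : ρ i x = 0 := by simpa [SmoothPartitionOfUnity.mem_finsupport] using hi
  simp [this]

/-- An index with nonzero weight at `x` satisfies `x ∈ U i`. Adjoining it therefore keeps `x` in the
intersection, where the cocycle condition kills the second term of the cone identity. The weights
sum to one. -/
theorem simplexDelta_coneSum {ρ : SmoothPartitionOfUnity ι (𝓡 m) M}
    (hρ : ρ.IsSubordinate fun i => (U i : Set M)) {p q : ℕ} {c : CechForm m n U p q}
    (hc : cechDelta e p q c = 0) {x : M} (a : Fin (p + 1) ↪o ι) (hx : x ∈ inter U a) :
    simplexDelta (coneSum e ρ c x) (vertices a) = cechVal e c x (vertices a) := by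
  have h1 : ∀ i ∈ ρ.finsupport x, simplexDelta (cone i (cechVal e c x)) (vertices a) =
      cechVal e c x (vertices a) := by
    intro i hi
    have hxi : x ∈ U i := hρ i (subset_tsupport _ (by
      simpa [SmoothPartitionOfUnity.mem_finsupport] using hi))
    rw [← simplexDelta_cone_add i (cechVal e c x) (vertices a), left_eq_add, cone]
    split_ifs with h
    · rfl
    · have hcard : (insert i (vertices a)).card = p + 1 + 1 := by
        rw [Finset.card_insert_of_notMem h, card_vertices]
      rw [← vertices_orderEmbOfFin _ hcard, ← cechVal_cechDelta, hc, cechVal_vertices]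
      · exact (congrArg _ (map_zero _)).trans (smul_zero _)
      · rw [mem_inter, vertices_orderEmbOfFin]
        intro j hj
        rcases Finset.mem_insert.mp hj with rfl | hj
        · exact hxi
        · exact mem_inter.mp hx j hj
  have h2 : ∑ i ∈ ρ.finsupport x, (ρ i x : ℂ) = 1 := by
    rw [← Complex.ofReal_sum, ρ.sum_finsupport x (Set.mem_univ x), Complex.ofReal_one]
  calc _ = ∑ i ∈ ρ.finsupport x, (ρ i x : ℂ) •
        simplexDelta (cone i (cechVal e c x)) (vertices a) := by
        simp only [simplexDelta, coneSum, Finset.smul_sum]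
        rw [Finset.sum_comm]
        simp only [smul_comm (_ ^ _ : ℂ)]
    _ = ∑ i ∈ ρ.finsupport x, (ρ i x : ℂ) • cechVal e c x (vertices a) :=
        Finset.sum_congr rfl fun i hi => by rw [h1 i hi]
    _ = _ := by rw [← Finset.sum_smul, h2, one_smul]

/-- The averaged cones are smooth on each intersection, so they are the values of a cochain, and
`simplexDelta_coneSum` makes it a primitive. -/
theorem exists_cechDelta_eq {ρ : SmoothPartitionOfUnity ι (𝓡 m) M}
    (hρ : ρ.IsSubordinate fun i => (U i : Set M)) {p q : ℕ} (c : CechForm m n U (p + 1) q)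
    (hc : cechDelta e (p + 1) q c = 0) : ∃ b : CechForm m n U p q, cechDelta e p q b = c := by
  have H := fun a : Fin (p + 1) ↪o ι => exists_secOf (simplexFrame e a)
    (fun x => coneSum e ρ c x (vertices a))
    (fun X x hx => coneSum_smooth e hρ c (mem_inter.mp hx) X)
  let b : CechForm m n U p q := fun a => (H a).choose
  have hb : ∀ (a : Fin (p + 1) ↪o ι), ∀ x ∈ inter U a, secOf (simplexFrame e a) q x (b a) =
    coneSum e ρ c x (vertices a) := fun a => (H a).choose_spec
  refine ⟨b, cechForm_ext e fun a x hx => ?_⟩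
  rw [cechVal_cechDelta e _ a hx, ← simplexDelta_coneSum e hρ hc a hx, simplexDelta, simplexDelta]
  refine Finset.sum_congr rfl fun j hj => ?_
  obtain ⟨i, -, rfl⟩ := Finset.mem_map.mp hj
  congr 1
  have := hb (face a i) x (inter_le_face U a i hx)
  rw [vertices_face] at this
  refine Eq.trans ?_ this
  have h2 := cechVal_vertices e b x (face a i)
  rwa [vertices_face] at h2

/-- On the empty simplex the averaged cone is the sum of the local values weighted by the partition
of unity, hence smooth on all of `M`. On a vertex the simplicial differential is evaluation at the
empty set, so the homotopy identity says that this global form restricts to the cocycle. -/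
theorem exists_locCech_eq {ρ : SmoothPartitionOfUnity ι (𝓡 m) M}
    (hρ : ρ.IsSubordinate fun i => (U i : Set M)) {q : ℕ} (c : CechForm m n U 0 q)
    (hc : cechDelta e 0 q c = 0) : ∃ w : Form (EndAlg m n E) q, locCech e q w = c := by
  obtain ⟨w, hw⟩ := exists_globalForm (fun x => coneSum e ρ c x ∅)
    (fun X x => coneSum_smooth e hρ c (fun i hi => absurd hi (Finset.notMem_empty i)) X)
  refine ⟨w, cechForm_ext e fun a x hx => FiberForm.ext fun X => ?_⟩
  rw [cechVal_locCech e w a hx, hw, ← simplexDelta_coneSum e hρ hc a hx]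
  have hv : vertices a = {a 0} := by simp [vertices]
  rw [hv, simplexDelta, Finset.sum_singleton]
  have hr : rankIn {a 0} (a 0) = 0 := by simp [rankIn]
  have he : ({a 0} : Finset ι).erase (a 0) = ∅ := by simp
  rw [hr, he, pow_zero, one_smul]

theorem dForm_resForm {p q : ℕ} (a : Fin (p + 2) ↪o ι) (i : Fin (p + 2))
    (η : Form (MatAlg m n (inter U (face a i))) q) :
    resForm n U (q + 1) a i (dForm _ q η) = dForm _ q (resForm n U q a i η) :=
  formMap_dForm _ _

theorem dForm_twistForm {p q : ℕ} (a : Fin (p + 2) ↪o ι)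
    (η : Form (MatAlg m n (inter U (face a (Fin.last (p + 1))))) q) :
    twistForm e (q + 1) a (dForm _ q η) = dForm _ q (twistForm e q a η) :=
  formMap_dForm _ _

theorem cechDelta_dCech {p q : ℕ} (c : CechForm m n U p q) :
    cechDelta e p (q + 1) (dCech m n U p q c) = dCech m n U (p + 1) q (cechDelta e p q c) :=
  funext fun a => Eq.trans
    (signedSum_congr (fun i => dForm_resForm a i.castSucc (c (face a i.castSucc)))
      (dForm_twistForm e a (c (face a (Fin.last (p + 1))))))
    (map_signedSum (dForm (MatAlg m n (inter U a)) q)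
      (fun i : Fin (p + 1) => resForm n U q a i.castSucc (c (face a i.castSucc)))
      (twistForm e q a (c (face a (Fin.last (p + 1)))))).symm

theorem locCech_dForm {q : ℕ} (w : Form (EndAlg m n E) q) :
    locCech e (q + 1) (dForm (EndAlg m n E) q w) = dCech m n U 0 q (locCech e q w) :=
  funext fun _ => formMap_dForm _ _

omit [T2Space M] [IsManifold (𝓡 m) ∞ M] in
theorem dCech_dCech {p q : ℕ} (c : CechForm m n U p q) :
    dCech m n U p (q + 1) (dCech m n U p q c) = 0 := funext fun a => dForm_dForm (c a)

end CechValues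

end NCDeRham

end

noncomputable section

namespace NCDeRham

/-! ### Double complexes with exact augmented rows -/

section DoubleComplex

variable {K : ℕ → ℕ → Type*} [∀ p q, AddCommGroup (K p q)] [∀ p q, Module ℂ (K p q)]

/-- The direct sum of the `K p q` with `p + q = k`. -/
abbrev TotSum (K : ℕ → ℕ → Type*) (k : ℕ) : Type _ :=
  ∀ s : {s : ℕ × ℕ // s.1 + s.2 = k}, K s.1.1 s.1.2

/-- `D` is the total differential `δ + (-1)^p d` of a double complex. -/
structure IsTotalDifferential (δ : ∀ p q, K p q →ₗ[ℂ] K (p + 1) q)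
    (d : ∀ p q, K p q →ₗ[ℂ] K p (q + 1)) (D : ∀ k, TotSum K k →ₗ[ℂ] TotSum K (k + 1)) : Prop where
  delta_delta : ∀ p q c, δ (p + 1) q (δ p q c) = 0
  d_d : ∀ p q c, d p (q + 1) (d p q c) = 0
  delta_d : ∀ p q c, δ p (q + 1) (d p q c) = d (p + 1) q (δ p q c)
  zero_succ : ∀ k c q (h : 0 + (q + 1) = k + 1),
    D k c ⟨(0, q + 1), h⟩ = d 0 q (c ⟨(0, q), Nat.succ.inj h⟩)
  succ_zero : ∀ k c p (h : (p + 1) + 0 = k + 1),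
    D k c ⟨(p + 1, 0), h⟩ = δ p 0 (c ⟨(p, 0), Nat.succ.inj h⟩)
  succ_succ : ∀ k c p q (h : (p + 1) + (q + 1) = k + 1),
    D k c ⟨(p + 1, q + 1), h⟩ = δ p (q + 1) (c ⟨(p, q + 1), by simp only; omega⟩) +
      (-1 : ℂ) ^ (p + 1) • d (p + 1) q (c ⟨(p + 1, q), Nat.succ.inj h⟩)

/-- An augmentation of a double complex along its column `p = 0`. -/
structure IsAugmentation {L : ℕ → Type*} [∀ q, AddCommGroup (L q)] [∀ q, Module ℂ (L q)]
    (δ : ∀ p q, K p q →ₗ[ℂ] K (p + 1) q) (d : ∀ p q, K p q →ₗ[ℂ] K p (q + 1))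
    (dL : ∀ q, L q →ₗ[ℂ] L (q + 1)) (ε : ∀ q, L q →ₗ[ℂ] K 0 q)
    (aug : ∀ k, L k →ₗ[ℂ] TotSum K k) : Prop where
  delta_aug : ∀ q w, δ 0 q (ε q w) = 0
  aug_d : ∀ q w, ε (q + 1) (dL q w) = d 0 q (ε q w)
  apply_zero : ∀ k w (h : 0 + k = k), aug k w ⟨(0, k), h⟩ = ε k w
  apply_succ : ∀ k w p q (h : (p + 1) + q = k), aug k w ⟨(p + 1, q), h⟩ = 0

/-- The rows of an augmented double complex are exact. -/
structure RowsExact {L : ℕ → Type*} [∀ q, AddCommGroup (L q)] [∀ q, Module ℂ (L q)]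
    (δ : ∀ p q, K p q →ₗ[ℂ] K (p + 1) q) (ε : ∀ q, L q →ₗ[ℂ] K 0 q) : Prop where
  exact_succ : ∀ p q c, δ (p + 1) q c = 0 → ∃ b, δ p q b = c
  exact_zero : ∀ q c, δ 0 q c = 0 → ∃ w, ε q w = c
  injective : ∀ q, Function.Injective (ε q)

variable {δ : ∀ p q, K p q →ₗ[ℂ] K (p + 1) q} {d : ∀ p q, K p q →ₗ[ℂ] K p (q + 1)}
  {D : ∀ k, TotSum K k →ₗ[ℂ] TotSum K (k + 1)}
  {L : ℕ → Type*} [∀ q, AddCommGroup (L q)] [∀ q, Module ℂ (L q)]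
  {dL : ∀ q, L q →ₗ[ℂ] L (q + 1)} {ε : ∀ q, L q →ₗ[ℂ] K 0 q}
  {aug : ∀ k, L k →ₗ[ℂ] TotSum K k}

namespace IsTotalDifferential

/-- Since `δ` and `d` commute, the mixed terms cancel because the sign of `d` alternates with the
column. -/
theorem comp_self (H : IsTotalDifferential δ d D) (k : ℕ) (c : TotSum K k) :
    D (k + 1) (D k c) = 0 := by
  funext ⟨⟨p, q⟩, h⟩
  match p, q, h with
  | 0, 0, h => simp at h
  | 0, 1, h => simp only at h; omega
  | 0, q + 2, h => rw [H.zero_succ, H.zero_succ, H.d_d]; rfl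
  | 1, 0, h => simp only at h; omega
  | 1, 1, h =>
    rw [H.succ_succ, H.zero_succ, H.succ_zero, H.delta_d]
    simp
  | 1, q + 2, h =>
    rw [H.succ_succ, H.zero_succ, H.succ_succ, H.delta_d, map_add, map_smul, H.d_d]
    simp
  | p + 2, 0, h => rw [H.succ_zero, H.succ_zero, H.delta_delta]; rfl
  | p + 2, 1, h =>
    rw [H.succ_succ, H.succ_succ, H.succ_zero, map_add, map_smul, H.delta_d, H.delta_delta,
      pow_succ _ (p + 1)]
    simp
  | p + 2, q + 2, h =>
    rw [H.succ_succ, H.succ_succ, H.succ_succ, map_add, map_smul, map_add, map_smul, H.delta_d,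
      H.d_d, H.delta_delta, pow_succ _ (p + 1)]
    simp

theorem apply_coboundary (H : IsTotalDifferential δ d D) : ∀ {k : ℕ} {b : TotSum K k},
    b ∈ coboundaries D k → D k b = 0
  | 0, b, hb => by
    rw [(Submodule.mem_bot ℂ).mp hb, map_zero]
  | k + 1, b, hb => by
    obtain ⟨b, rfl⟩ := hb
    exact H.comp_self k b

theorem apply_aug (H : IsTotalDifferential δ d D) (H' : IsAugmentation δ d dL ε aug) (k : ℕ)
    (w : L k) : D k (aug k w) = aug (k + 1) (dL k w) := by
  funext ⟨⟨p, q⟩, h⟩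
  match p, q, h with
  | 0, 0, h => simp at h
  | 0, q + 1, h =>
    obtain rfl : q = k := by simp only at h; omega
    rw [H.zero_succ, H'.apply_zero, H'.apply_zero, H'.aug_d]
  | 1, 0, h =>
    obtain rfl : 0 = k := by simp only at h; omega
    rw [H.succ_zero, H'.apply_zero, H'.delta_aug, H'.apply_succ]
  | 1, q + 1, h =>
    obtain rfl : q + 1 = k := by simp only at h; omega
    rw [H.succ_succ, H'.apply_zero, H'.apply_succ, H'.apply_succ, H'.delta_aug, map_zero,
      smul_zero, add_zero]
  | p + 2, 0, h => rw [H.succ_zero, H'.apply_succ, H'.apply_succ, map_zero]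
  | p + 2, q + 1, h =>
    rw [H.succ_succ, H'.apply_succ, H'.apply_succ, H'.apply_succ, map_zero, map_zero, smul_zero,
      add_zero]

theorem apply_succ_of_eq_zero (H : IsTotalDifferential δ d D) {k : ℕ} {c : TotSum K k} {p q : ℕ}
    (h : p + q = k) (hc : ∀ q' h', c ⟨(p + 1, q'), h'⟩ = 0) (h' : p + 1 + q = k + 1) :
    D k c ⟨(p + 1, q), h'⟩ = δ p q (c ⟨(p, q), h⟩) := by
  match q, h, h' with
  | 0, h, h' => rw [H.succ_zero]
  | q + 1, h, h' => rw [H.succ_succ, hc, map_zero, smul_zero, add_zero]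

/-- Induction on the last column `N` that may be nonzero. There the total differential acts by `δ`
alone into the next column, so the component is `δ`-closed, and subtracting the coboundary of a
primitive clears it. Vanishing of `D c` is needed only from column two on, as only columns from one
on are cleared. -/
theorem exists_reduction (H : IsTotalDifferential δ d D)
    (hex : ∀ p q c, δ (p + 1) q c = 0 → ∃ b, δ p q b = c) (N : ℕ) :
    ∀ {k : ℕ} (c : TotSum K k), (∀ p q h, N < p → c ⟨(p, q), h⟩ = 0) →
      (∀ p q h, D k c ⟨(p + 2, q), h⟩ = 0) →
      ∃ b ∈ coboundaries D k, ∀ p q h, (c - b) ⟨(p + 1, q), h⟩ = 0 := by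
  induction N with
  | zero =>
    intro k c hc _
    refine ⟨0, zero_mem _, fun p q h => ?_⟩
    rw [sub_zero]
    exact hc _ _ h p.succ_pos
  | succ N ih =>
    intro k c hc hD
    by_cases hk : N + 1 ≤ k
    · obtain ⟨q, rfl⟩ : ∃ q, k = N + q + 1 := ⟨k - N - 1, by omega⟩
      obtain ⟨β, hβ⟩ := hex N q (c ⟨(N + 1, q), by simp only; omega⟩) (by
        rw [← H.apply_succ_of_eq_zero (by omega) (fun q' h' => hc _ _ h' (by omega))
          (by omega), hD])
      let b₁ : TotSum K (N + q) :=
        Pi.single (M := fun s : {s : ℕ × ℕ // s.1 + s.2 = N + q} => K s.1.1 s.1.2)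
          ⟨(N, q), rfl⟩ β
      have hb₁ : ∀ p q' h, p ≠ N → b₁ ⟨(p, q'), h⟩ = 0 := by
        intro p q' h hp
        refine Pi.single_eq_of_ne (fun e => hp ?_) _
        exact congrArg (fun s => s.1.1) e
      have hb₁' : b₁ ⟨(N, q), rfl⟩ = β := Pi.single_eq_same _ _
      -- The coboundary of `b₁` meets only columns `N` and `N + 1`, so it cancels the last component
      -- without creating later ones.
      obtain ⟨b, hb, hb'⟩ := ih (c - D _ b₁) (by
        intro p q' h hp
        obtain ⟨p, rfl⟩ : ∃ p', p = p' + 1 := ⟨p - 1, by omega⟩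
        rw [Pi.sub_apply, H.apply_succ_of_eq_zero (by simp only at h; omega)
          (fun q' h' => hb₁ _ _ h' (by omega))]
        by_cases hpN : p = N
        · subst hpN
          obtain rfl : q' = q := by simp only at h; omega
          rw [hb₁', hβ, sub_self]
        · rw [hb₁ _ _ _ hpN, map_zero, sub_zero]
          exact hc _ _ h (by omega)) (by
        intro p q' h
        rw [map_sub, H.comp_self, sub_zero]
        exact hD _ _ _)
      refine ⟨b + D _ b₁, add_mem hb ⟨b₁, rfl⟩, fun p q h => ?_⟩
      rw [add_comm b, ← sub_sub]
      exact hb' p q h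
    · refine ih c (fun p q h hp => ?_) hD
      simp only at h
      omega

/-- The common core of both halves of the isomorphism: surjectivity uses it with `D c = 0`,
injectivity with `D c` equal to an augmented form. Column one of `D c` gives the `δ`-closedness of
the remaining component. -/
theorem exists_concentrated (H : IsTotalDifferential δ d D)
    (hex : ∀ p q c, δ (p + 1) q c = 0 → ∃ b, δ p q b = c) {k : ℕ} (c : TotSum K k)
    (hc : ∀ p q h, D k c ⟨(p + 1, q), h⟩ = 0) :
    ∃ b ∈ coboundaries D k, (∀ p q h, (c - b) ⟨(p + 1, q), h⟩ = 0) ∧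
      δ 0 k ((c - b) ⟨(0, k), k.zero_add⟩) = 0 ∧
      d 0 k ((c - b) ⟨(0, k), k.zero_add⟩) = D k c ⟨(0, k + 1), (k + 1).zero_add⟩ := by
  obtain ⟨b, hb, hb'⟩ := H.exists_reduction hex k c
    (fun p q h hp => by simp only at h; omega) (fun p q h => hc _ _ h)
  have hD : D k (c - b) = D k c := by rw [map_sub, H.apply_coboundary hb, sub_zero]
  refine ⟨b, hb, hb', ?_, ?_⟩
  · rw [← H.apply_succ_of_eq_zero k.zero_add (fun q' h' => hb' _ _ h') (by omega), hD, hc]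
  · rw [← hD, H.zero_succ]

/-- The component left in column zero is `δ`-closed, so it comes from the augmentation; its preimage
is closed because `ε` is injective. -/
theorem aug_surjective (H : IsTotalDifferential δ d D) (H' : IsAugmentation δ d dL ε aug)
    (hex : RowsExact δ ε) {k : ℕ} (c : TotSum K k) (hc : D k c = 0) :
    ∃ w, dL k w = 0 ∧ c - aug k w ∈ coboundaries D k := by
  obtain ⟨b, hb, hb', hδ, hd⟩ := H.exists_concentrated hex.exact_succ c
    (fun p q h => by rw [hc]; rfl)
  obtain ⟨w, hw⟩ := hex.exact_zero _ _ hδ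
  refine ⟨w, hex.injective _ ?_, ?_⟩
  · rw [H'.aug_d, hw, hd, hc, map_zero]
    rfl
  · have : aug k w = c - b := by
      funext ⟨⟨p, q⟩, h⟩
      match p, q, h with
      | 0, q, h =>
        obtain rfl : q = k := by simp only at h; omega
        rw [H'.apply_zero, hw]
      | p + 1, q, h => rw [H'.apply_succ, hb']
    rwa [this, sub_sub_cancel]

/-- A total primitive of an augmented element can be moved into column zero, where exactness turns
it into a primitive in `L`. In degree zero there are no coboundaries, and injectivity of `ε`
suffices. -/
theorem aug_injective (H : IsTotalDifferential δ d D) (H' : IsAugmentation δ d dL ε aug)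
    (hex : RowsExact δ ε) : ∀ {k : ℕ} (w : L k), aug k w ∈ coboundaries D k →
      w ∈ coboundaries dL k
  | 0, w, hw => by
    rw [coboundaries, Submodule.mem_bot] at hw ⊢
    apply hex.injective
    rw [← H'.apply_zero 0 w rfl, hw, map_zero]
    rfl
  | k + 1, w, hw => by
    obtain ⟨c, hc⟩ := hw
    obtain ⟨b, hb, hb', hδ, hd⟩ := H.exists_concentrated hex.exact_succ c
      (fun p q h => by rw [hc, H'.apply_succ])
    obtain ⟨v, hv⟩ := hex.exact_zero _ _ hδ
    refine ⟨v, hex.injective _ ?_⟩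
    rw [H'.aug_d, hv, hd, hc, H'.apply_zero]

theorem aug_coboundary (H : IsTotalDifferential δ d D) (H' : IsAugmentation δ d dL ε aug) :
    ∀ {k : ℕ} {w : L k}, w ∈ coboundaries dL k → aug k w ∈ coboundaries D k
  | 0, w, hw => by
    rw [coboundaries, Submodule.mem_bot] at hw ⊢
    rw [hw, map_zero]
  | k + 1, w, hw => by
    obtain ⟨v, rfl⟩ := hw
    exact ⟨aug k v, H.apply_aug H' k v⟩

/-- The augmentation of a double complex with exact rows is a quasi-isomorphism. -/
theorem exists_cohomology_equiv (H : IsTotalDifferential δ d D)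
    (H' : IsAugmentation δ d dL ε aug) (hex : RowsExact δ ε) (k : ℕ) :
    ∃ Φ : Cohomology dL k ≃ₗ[ℂ] Cohomology D k,
      ∀ (w : LinearMap.ker (dL k)) (c : LinearMap.ker (D k)),
        aug k w.1 = c.1 → Φ (Cohomology.mk dL k w) = Cohomology.mk D k c := by
  let F : LinearMap.ker (dL k) →ₗ[ℂ] LinearMap.ker (D k) :=
    (aug k).restrict fun w hw => by
      rw [LinearMap.mem_ker] at hw ⊢
      rw [H.apply_aug H', hw, map_zero]
  let G : Cohomology dL k →ₗ[ℂ] Cohomology D k :=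
    Submodule.mapQ _ _ F fun w hw => H.aug_coboundary H' hw
  have hG : ∀ w, G (Cohomology.mk dL k w) = Cohomology.mk D k (F w) := fun w => rfl
  have hinj : Function.Injective G := by
    rw [injective_iff_map_eq_zero]
    intro x hx
    obtain ⟨w, rfl⟩ := Submodule.mkQ_surjective _ x
    have h1 : F w ∈ (coboundaries D k).submoduleOf (LinearMap.ker (D k)) :=
      (Submodule.Quotient.mk_eq_zero _).mp hx
    exact (Submodule.Quotient.mk_eq_zero _).mpr (H.aug_injective H' hex w.1 h1)
  have hsurj : Function.Surjective G := by
    intro y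
    obtain ⟨c, rfl⟩ := Submodule.mkQ_surjective _ y
    obtain ⟨w, hw, hcw⟩ := H.aug_surjective H' hex c.1 c.2
    refine ⟨Cohomology.mk dL k ⟨w, hw⟩, ?_⟩
    rw [hG]
    refine ((Submodule.Quotient.eq _).mpr ?_).symm
    exact hcw
  refine ⟨LinearEquiv.ofBijective G ⟨hinj, hsurj⟩, fun w c hwc => ?_⟩
  obtain rfl : F w = c := Subtype.ext hwc
  rfl

end IsTotalDifferential

end DoubleComplex

end NCDeRham

end

noncomputable section

namespace NCDeRham

/-! ### The Čech–de Rham double complex and the comparison theorem -/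

section Main

open scoped ShortcutInstances

variable {m n : ℕ} {M : Type*} [TopologicalSpace M] [ChartedSpace (EuclideanSpace ℝ (Fin m)) M]
  {ι : Type*} [LinearOrder ι] [IsManifold (𝓡 m) ∞ M] [T2Space M]
  {E : M → Type*} [∀ x, NormedAddCommGroup (E x)] [∀ x, InnerProductSpace ℂ (E x)]
  [TopologicalSpace (TotalSpace (EuclideanSpace ℂ (Fin n)) E)]
  [FiberBundle (EuclideanSpace ℂ (Fin n)) E]
  [VectorBundle ℂ (EuclideanSpace ℂ (Fin n)) E]
  [VectorBundle ℝ (EuclideanSpace ℂ (Fin n)) E]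
  [ContMDiffVectorBundle ∞ (EuclideanSpace ℂ (Fin n)) E (𝓡 m)]
  {o : OrientedHermitian m n E} {U : ι → Opens M} (e : ∀ i, SUFrame o (U i))

theorem totalD_isTotalDifferential :
    IsTotalDifferential (K := CechForm m n U) (cechDelta e) (dCech m n U) (totalD e) where
  delta_delta _ _ c := cechDelta_cechDelta e c
  d_d _ _ c := dCech_dCech c
  delta_d _ _ c := cechDelta_dCech e c
  zero_succ _ _ _ _ := rfl
  succ_zero _ _ _ _ := rfl
  succ_succ _ _ _ _ _ := rfl

theorem augmentation_isAugmentation :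
    IsAugmentation (K := CechForm m n U) (L := fun q => Form (EndAlg m n E) q) (cechDelta e)
      (dCech m n U) (dForm (EndAlg m n E)) (locCech e) (augmentation e) where
  delta_aug _ w := cechDelta_locCech e w
  aug_d _ w := locCech_dForm e w
  apply_zero k w h := Pi.single_eq_same
    (M := fun s : {s : ℕ × ℕ // s.1 + s.2 = k} => CechForm m n U s.1.1 s.1.2) _ _
  apply_succ k w p q h := by
    have h' : (⟨(p + 1, q), h⟩ : {s : ℕ × ℕ // s.1 + s.2 = k}) ≠ ⟨(0, k), k.zero_add⟩ :=
      fun h' => Nat.succ_ne_zero p (congrArg (fun s => s.1.1) h')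
    exact Pi.single_eq_of_ne
      (M := fun s : {s : ℕ × ℕ // s.1 + s.2 = k} => CechForm m n U s.1.1 s.1.2) h' (locCech e k w)

theorem cechRows_exact [SecondCountableTopology M] (hU : ∀ x, ∃ i, x ∈ U i) :
    RowsExact (K := CechForm m n U) (L := fun q => Form (EndAlg m n E) q) (cechDelta e)
      (locCech e) := by
  -- Local compactness and second countability give the σ-compactness that a subordinate smooth
  -- partition of unity requires.
  have : LocallyCompactSpace M := ChartedSpace.locallyCompactSpace (EuclideanSpace ℝ (Fin m)) M
  obtain ⟨ρ, hρ⟩ := SmoothPartitionOfUnity.exists_isSubordinate (𝓡 m) isClosed_univ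
    (fun i => (U i : Set M)) (fun i => (U i).isOpen)
    (fun x _ => Set.mem_iUnion.mpr (hU x))
  exact ⟨fun _ _ c hc => exists_cechDelta_eq e hρ c hc, fun _ c hc => exists_locCech_eq e hρ c hc,
    fun _ _ _ h => locCech_injective e hU h⟩

end Main

end NCDeRham

end

theorem mainTheorem4 {m n : ℕ} {M : Type*} [TopologicalSpace M]
    [ChartedSpace (EuclideanSpace ℝ (Fin m)) M] [IsManifold (𝓡 m) ∞ M]
    [T2Space M] [SecondCountableTopology M]
    {E : M → Type*} [∀ x, NormedAddCommGroup (E x)] [∀ x, InnerProductSpace ℂ (E x)]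
    [TopologicalSpace (TotalSpace (EuclideanSpace ℂ (Fin n)) E)]
    [FiberBundle (EuclideanSpace ℂ (Fin n)) E]
    [VectorBundle ℂ (EuclideanSpace ℂ (Fin n)) E]
    [VectorBundle ℝ (EuclideanSpace ℂ (Fin n)) E]
    [ContMDiffVectorBundle ∞ (EuclideanSpace ℂ (Fin n)) E (𝓡 m)]
    (o : OrientedHermitian m n E)
    {ι : Type*} [LinearOrder ι] (U : ι → Opens M) (hU : IsGoodCover m U)
    (e : ∀ i, SUFrame o (U i)) :
    (∀ k, dForm (EndAlg m n E) (k + 1) ∘ₗ dForm (EndAlg m n E) k = 0) ∧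
    (∀ k, totalD e (k + 1) ∘ₗ totalD e k = 0) ∧
    (∀ k, totalD e k ∘ₗ augmentation e k = augmentation e (k + 1) ∘ₗ dForm (EndAlg m n E) k) ∧
    ∀ k, ∃ Φ : Cohomology (dForm (EndAlg m n E)) k ≃ₗ[ℂ] Cohomology (totalD e) k,
      ∀ (w : LinearMap.ker (dForm (EndAlg m n E) k)) (c : LinearMap.ker (totalD e k)),
        augmentation e k w.1 = c.1 →
          Φ (Cohomology.mk (dForm (EndAlg m n E)) k w) = Cohomology.mk (totalD e) k c :=
  ⟨fun _ => LinearMap.ext fun w => dForm_dForm w,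
    fun k => LinearMap.ext fun c => (totalD_isTotalDifferential e).comp_self k c,
    fun k => LinearMap.ext fun w =>
      (totalD_isTotalDifferential e).apply_aug (augmentation_isAugmentation e) k w,
    fun k => (totalD_isTotalDifferential e).exists_cohomology_equiv (augmentation_isAugmentation e)
      (cechRows_exact e hU.1) k⟩
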